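/- Let $K$ be a field, let $T=K[x_1,\dots,x_m]$ with its standard grading, let $\mathfrak m=(x_1,\dots,x_m)$, and let $I\subseteq T$ be a nonzero ideal generated by homogeneous polynomials $f_1,\dots,f_n$ with $\deg f_j=d_j$. Let $R=\bigoplus_{k\ge 0}I^kt^k\subseteq T[t]$ be the Rees algebra of $I$, bigraded by $R_{(j,k)}=(I^k)_j\,t^k$, and let $R_+=\bigoplus_{k>0}I^kt^k$. Let $S=K[x_1,\dots,x_m,y_1,\dots,y_n]$ be $\mathbb Z^2$-graded by $\deg x_i=(1,0)$ and $\deg y_j=(d_j,1)$, regard $R$ as a bigraded $S$-module via $x_i\mapsto x_i$, $y_j\mapsto f_jt$, let $\sigma=\deg(x_1\cdots x_my_1\cdots y_n)$, and let $\omega_R=\operatorname{Ext}^{n-1}_S(R,S(-\sigma))$ be the bigraded canonical module of $R$. For a bigraded module $N$ put $N_k=\bigoplus_jN_{(j,k)}$, and for a graded $T$-module $N$ let $N^*$ be its graded $K$-dual, $(N^*)_j=\operatorname{Hom}_K(N_{-j},K)$. Suppose that $R_{\mathfrak p}$ is Cohen–Macaulay for every prime ideal $\mathfrak p$ of $R$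 with $\mathfrak p\ne(\mathfrak m,R_+)$. Then there is $k_0$ such that for all $k\ge k_0$ and all $i\in\mathbb Z$ there is an isomorphism of graded $T$-modules $$H^i_{\mathfrak m}(I^k)\;\cong\;\bigl(H^{m+1-i}_{R_+}(\omega_R)_{-k}\bigr)^*,$$ where local cohomology in negative degrees is $0$. -/

import Mathlib

namespace GradedLC

noncomputable section

open scoped Polynomial

section Cech

/-! ### Čech cohomology of a (graded) module with respect to a finite sequence of ring elements

`A` is a `K`-algebra, `y : Fin n → A` a sequence, `M` an `A`-module. -/

variable {K A : Type*} [Field K] [CommRing A] [Algebra K A] {n : ℕ} (y : Fin n → A)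
  (M : Type*) [AddCommGroup M] [Module A M] [Module K M] [IsScalarTower K A M]

/-- The multiplicative set generated by the `y b`, `b ∈ B`. -/
def denominators (B : Finset (Fin n)) : Submonoid A := Submonoid.closure (y '' (B : Set (Fin n)))

theorem denominators_mono {B C : Finset (Fin n)} (h : B ⊆ C) :
    denominators y B ≤ denominators y C :=
  Submonoid.closure_mono (Set.image_mono (Finset.coe_subset.mpr h))

/-- The localization of `M` that inverts the `y b`, `b ∈ B`. -/
abbrev CechLoc (B : Finset (Fin n)) : Type _ := LocalizedModule (denominators y B) M

/-- The localization map `M_B → M_C` for `B ⊆ C`. -/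
def cechRes {B C : Finset (Fin n)} (h : B ⊆ C) : CechLoc y M B →ₗ[A] CechLoc y M C :=
  LocalizedModule.liftOfLE _ _ (denominators_mono y h)

/-- The total module `∏_B M_B` of the Čech complex, `B` running through all subsets of the
index set. -/
abbrev CechCochain : Type _ := (B : Finset (Fin n)) → CechLoc y M B

/-- The Čech differential: `(d c)_B = ∑_{b ∈ B} ± c_{B \ b}` with the sign `(-1) ^ r`,
where `r` is the number of elements of `B` below `b`. -/
def cechD : CechCochain y M →ₗ[A] CechCochain y M :=
  LinearMap.pi fun B => ∑ b ∈ B,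
    ((-1 : A) ^ (B.filter (· < b)).card) •
      (cechRes y M (B.erase_subset b)).comp (LinearMap.proj (B.erase b))

/-- The cochains of degree `p`, i.e. `∏_{|B| = p} M_B`; zero unless `0 ≤ p ≤ n`. -/
def cechDegree (p : ℤ) : Submodule A (CechCochain y M) where
  carrier := {c | ∀ B : Finset (Fin n), (B.card : ℤ) ≠ p → c B = 0}
  zero_mem' := fun _ _ => rfl
  add_mem' := fun {c c'} hc hc' B hB => by
    rw [Pi.add_apply, hc B hB, hc' B hB, add_zero]
  smul_mem' := fun a c hc B hB => by
    rw [Pi.smul_apply, hc B hB, smul_zero]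

/-- The cocycles of degree `p`. -/
def cechCocycles (p : ℤ) : Submodule A (CechCochain y M) :=
  cechDegree y M p ⊓ LinearMap.ker (cechD y M)

/-- The coboundaries of degree `p`. -/
def cechCoboundaries (p : ℤ) : Submodule A (CechCochain y M) :=
  (cechDegree y M (p - 1)).map (cechD y M)

/-- The local cohomology `H^p_J(M)` with support in `J = (y_0, …, y_{n-1})`, as the cohomology of
the Čech complex of `M` with respect to `y`, for every integer `p`. -/
abbrev LocalCohomology (p : ℤ) : Type _ :=
  cechCocycles y M p ⧸ (cechCoboundaries y M p).submoduleOf (cechCocycles y M p)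

variable {Γ : Type*} [AddCommGroup Γ] (𝒜 : Γ → Submodule K A)
  {M} (𝓜 : Γ → Submodule K M)

/-- The homogeneous elements of degree `γ` of the localization `M_B`: the fractions `x / s` with
`s` homogeneous of some degree `δ` and `x` homogeneous of degree `γ + δ`. -/
def cechLocPiece (B : Finset (Fin n)) (γ : Γ) : Submodule K (CechLoc y M B) :=
  Submodule.span K {z | ∃ (δ : Γ) (s : denominators y B) (x : M),
    (s : A) ∈ 𝒜 δ ∧ x ∈ 𝓜 (γ + δ) ∧ z = LocalizedModule.mk x s}

/-- The homogeneous Čech cochains of internal degree `γ`. -/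
def cechCochainPiece (γ : Γ) : Submodule K (CechCochain y M) :=
  Submodule.pi Set.univ fun B => cechLocPiece y 𝒜 𝓜 B γ

/-- The homogeneous component `H^p_J(M)_γ`: the classes of the homogeneous cocycles of internal
degree `γ`. -/
def localCohomologyPiece (p : ℤ) (γ : Γ) : Submodule K (LocalCohomology y M p) :=
  ((cechCochainPiece y 𝒜 𝓜 γ).comap
      ((cechCocycles y M p).subtype.restrictScalars K)).map
    (((cechCoboundaries y M p).submoduleOf (cechCocycles y M p)).mkQ.restrictScalars K)

variable {𝒜 𝓜} in
theorem smul_mem_localCohomologyPiece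
    (h𝓜 : ∀ {α γ : Γ} {a : A} {x : M}, a ∈ 𝒜 α → x ∈ 𝓜 γ → a • x ∈ 𝓜 (α + γ))
    (p : ℤ) {α γ : Γ} {a : A} (ha : a ∈ 𝒜 α) {h : LocalCohomology y M p}
    (hh : h ∈ localCohomologyPiece y 𝒜 𝓜 p γ) :
    a • h ∈ localCohomologyPiece y 𝒜 𝓜 p (α + γ) := by
  obtain ⟨c, hc, rfl⟩ := hh
  refine ⟨a • c, ?_, rfl⟩
  intro B hB
  have hcB : c.1 B ∈ cechLocPiece y 𝒜 𝓜 B γ := hc B hB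
  change a • c.1 B ∈ cechLocPiece y 𝒜 𝓜 B (α + γ)
  generalize c.1 B = z at hcB
  induction hcB using Submodule.span_induction with
  | mem z hz =>
    obtain ⟨δ, s, x, hs, hx, rfl⟩ := hz
    refine Submodule.subset_span ⟨δ, s, a • x, hs, ?_, LocalizedModule.smul'_mk _ _ _⟩
    rw [add_assoc]
    exact h𝓜 ha hx
  | zero => rw [smul_zero]; exact Submodule.zero_mem _
  | add z w _ _ hz hw => rw [smul_add]; exact Submodule.add_mem _ hz hw
  | smul k z _ hz => rw [smul_comm]; exact Submodule.smul_mem _ _ hz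

end Cech

section Pieces

variable {K A H : Type*} [Field K] [CommRing A] [Algebra K A] [AddCommGroup H] [Module A H]
  [Module K H] [IsScalarTower K A H]

/-- Multiplication by `a`, as a `K`-linear map between two subspaces. -/
def mulPiece (a : A) (V W : Submodule K H) (h : ∀ x ∈ V, a • x ∈ W) : V →ₗ[K] W where
  toFun x := ⟨a • (x : H), h x x.2⟩
  map_add' x x' := Subtype.ext (smul_add a (x : H) (x' : H))
  map_smul' k x := Subtype.ext (smul_comm a k (x : H))

end Pieces

section Ext

/-! ### Graded free resolutions and graded Ext into a shifted copy of the ring -/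

variable {K A : Type*} [Field K] [CommRing A] [Algebra K A]
  {Γ : Type*} [AddCommGroup Γ] (𝒜 : Γ → Submodule K A)

/-- A graded resolution `⋯ → F₁ → F₀ → M → 0` of the graded `A`-module `M` by finite free graded
modules. The module `F_p` is free on homogeneous elements `e_i`, `i < rank p`, of degrees
`deg p i`; in these bases the differential `F_{p+1} → F_p` has the matrix `mat p`, and `gen i` is
the image of `e_i` under the augmentation `F₀ → M`. All maps preserve degrees. -/
structure GradedFreeResolution {M : Type*} [AddCommGroup M] [Module A M] [Module K M]
    (𝓜 : Γ → Submodule K M) where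
  rank : ℕ → ℕ
  deg : (p : ℕ) → Fin (rank p) → Γ
  mat : (p : ℕ) → Matrix (Fin (rank p)) (Fin (rank (p + 1))) A
  gen : Fin (rank 0) → M
  mat_mem : ∀ p i j, mat p i j ∈ 𝒜 (deg (p + 1) j - deg p i)
  gen_mem : ∀ i, gen i ∈ 𝓜 (deg 0 i)
  gen_surjective : LinearMap.range (Fintype.linearCombination A gen) = ⊤
  exact_zero : LinearMap.ker (Fintype.linearCombination A gen) =
    LinearMap.range (mat 0).mulVecLin
  exact_succ : ∀ p, LinearMap.ker (mat p).mulVecLin = LinearMap.range (mat (p + 1)).mulVecLin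

variable {𝒜} {M : Type*} [AddCommGroup M] [Module A M] [Module K M] {𝓜 : Γ → Submodule K M}
  (F : GradedFreeResolution 𝒜 𝓜)

/-- `Hom_A(F_p, A)`; a homomorphism is given by its values on the basis of `F_p`. -/
abbrev DualTerm (p : ℕ) : Type _ := Fin (F.rank p) → A

/-- The map `Hom_A(F_p, A) → Hom_A(F_{p+1}, A)` induced by the differential of `F`. -/
def dualD (p : ℕ) : DualTerm F p →ₗ[A] DualTerm F (p + 1) :=
  (F.mat p).transpose.mulVecLin

/-- The cocycles of `Hom_A(F, A)` in degree `p`. -/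
def extCocycles (p : ℕ) : Submodule A (DualTerm F p) := LinearMap.ker (dualD F p)

/-- The coboundaries of `Hom_A(F, A)` in degree `p`. -/
def extCoboundaries : (p : ℕ) → Submodule A (DualTerm F p)
  | 0 => ⊥
  | p + 1 => LinearMap.range (dualD F p)

/-- `Ext^p_A(M, A)`, computed from the resolution `F` of `M`. -/
abbrev ExtModule (p : ℕ) : Type _ :=
  extCocycles F p ⧸ (extCoboundaries F p).submoduleOf (extCocycles F p)

/-- The homomorphisms `F_p → A(-σ)` of degree `γ`: they send the basis element `e_i`
into `A(-σ)_{γ + deg e_i}`, where `A(-σ)_β = A_{β - σ}`. -/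
def dualPiece (σ : Γ) (p : ℕ) (γ : Γ) : Submodule K (DualTerm F p) :=
  Submodule.pi Set.univ fun i => 𝒜 (γ + F.deg p i - σ)

/-- The homogeneous component of degree `γ` of `Ext^p_A(M, A(-σ))`. -/
def extPiece (σ : Γ) (p : ℕ) (γ : Γ) : Submodule K (ExtModule F p) :=
  ((dualPiece F σ p γ).comap ((extCocycles F p).subtype.restrictScalars K)).map
    (((extCoboundaries F p).submoduleOf (extCocycles F p)).mkQ.restrictScalars K)

theorem smul_mem_extPiece
    (h𝒜 : ∀ {α γ : Γ} {a x : A}, a ∈ 𝒜 α → x ∈ 𝒜 γ → a * x ∈ 𝒜 (α + γ))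
    (σ : Γ) (p : ℕ) {α γ : Γ} {a : A} (ha : a ∈ 𝒜 α) {h : ExtModule F p}
    (hh : h ∈ extPiece F σ p γ) : a • h ∈ extPiece F σ p (α + γ) := by
  obtain ⟨c, hc, rfl⟩ := hh
  refine ⟨a • c, ?_, rfl⟩
  intro i hi
  have hci : c.1 i ∈ 𝒜 (γ + F.deg p i - σ) := hc i hi
  change a * c.1 i ∈ 𝒜 (α + γ + F.deg p i - σ)
  have := h𝒜 ha hci
  rwa [add_sub_assoc, ← add_assoc, ← add_sub_assoc] at this

end Ext

section CohenMacaulay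

/-- A Noetherian local ring is Cohen–Macaulay if its maximal ideal contains a regular sequence
whose length is the Krull dimension of the ring. -/
def IsCohenMacaulayLocal (A : Type*) [CommRing A] [IsLocalRing A] : Prop :=
  IsNoetherianRing A ∧ ∃ rs : List A, (∀ r ∈ rs, r ∈ IsLocalRing.maximalIdeal A) ∧
    RingTheory.Sequence.IsRegular A rs ∧ (rs.length : WithBot ℕ∞) = ringKrullDim A

end CohenMacaulay

section Rees

/-! ### The Rees algebra of a graded ideal of `T = K[x_1, …, x_m]`, bigraded -/

variable (K : Type*) [Field K] (m n : ℕ)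

/-- The polynomial ring `T = K[x_1, …, x_m]`. -/
abbrev PolyT : Type _ := MvPolynomial (Fin m) K

/-- The standard grading of `T`, indexed by `ℤ`. -/
def gradingT (j : ℤ) : Submodule K (PolyT K m) :=
  MvPolynomial.weightedHomogeneousSubmodule K (fun _ => (1 : ℤ)) j

/-- The polynomial ring `S = K[x_1, …, x_m, y_1, …, y_n]`. -/
abbrev PolyS : Type _ := MvPolynomial (Fin m ⊕ Fin n) K

variable {K m n}

/-- The bidegrees of the variables of `S`: `deg x_i = (1, 0)` and `deg y_j = (d_j, 1)`. -/
def bidegree (m : ℕ) (d : Fin n → ℕ) : Fin m ⊕ Fin n → ℤ × ℤ :=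
  Sum.elim (fun _ => (1, 0)) (fun j => ((d j : ℤ), 1))

/-- The bigrading of `S`. -/
def gradingS (K : Type*) [Field K] (m : ℕ) (d : Fin n → ℕ) (γ : ℤ × ℤ) :
    Submodule K (PolyS K m n) :=
  MvPolynomial.weightedHomogeneousSubmodule K (bidegree m d) γ

/-- The bidegree `σ` of the product of all variables of `S`. -/
def sigma (m : ℕ) (d : Fin n → ℕ) : ℤ × ℤ := ∑ v, bidegree m d v

/-- The ideal `I` of `T` generated by `f_1, …, f_n`. -/
abbrev genIdeal (f : Fin n → PolyT K m) : Ideal (PolyT K m) := Ideal.span (Set.range f)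

/-- The Rees algebra `R = ⨁_k I^k t^k ⊆ T[t]`. -/
abbrev Rees (f : Fin n → PolyT K m) : Type _ := reesAlgebra (genIdeal f)

/-- The element `f_j t` of the Rees algebra. -/
def reesGen (f : Fin n → PolyT K m) (j : Fin n) : Rees f :=
  ⟨Polynomial.monomial 1 (f j), reesAlgebra.monomial_mem.mpr (by
    rw [pow_one]; exact Ideal.subset_span ⟨j, rfl⟩)⟩

/-- The homomorphism of `K`-algebras `S → R` with `x_i ↦ x_i` and `y_j ↦ f_j t`. -/
def toRees (f : Fin n → PolyT K m) : PolyS K m n →ₐ[K] Rees f :=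
  MvPolynomial.aeval
    (Sum.elim (fun i => algebraMap (PolyT K m) (Rees f) (MvPolynomial.X i)) (reesGen f))

/-- The Rees algebra as a module over `S` by means of `S → R`. -/
def ReesModule (f : Fin n → PolyT K m) : Type _ := Rees f

instance (f : Fin n → PolyT K m) : AddCommGroup (ReesModule f) :=
  inferInstanceAs (AddCommGroup (Rees f))

instance (f : Fin n → PolyT K m) : Module K (ReesModule f) :=
  inferInstanceAs (Module K (Rees f))

instance (f : Fin n → PolyT K m) : Module (PolyS K m n) (ReesModule f) :=
  Module.compHom (Rees f) (toRees f).toRingHom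

/-- An element of the Rees algebra as a polynomial in `t` with coefficients in `T`. -/
def ReesModule.toPoly {f : Fin n → PolyT K m} (r : ReesModule f) : (PolyT K m)[X] :=
  Subtype.val (p := fun q => q ∈ reesAlgebra (genIdeal f)) r

/-- The bigrading of the Rees algebra: `R_{(j,k)} = (I^k)_j t^k`. -/
def gradingRees (f : Fin n → PolyT K m) (γ : ℤ × ℤ) : Submodule K (ReesModule f) where
  carrier := {r | ∀ e : ℕ, r.toPoly.coeff e ∈ gradingT K m γ.1 ∧
    ((e : ℤ) ≠ γ.2 → r.toPoly.coeff e = 0)}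
  zero_mem' := fun e => ⟨Submodule.zero_mem _, fun _ => rfl⟩
  add_mem' := fun {r s} hr hs e => by
    have h : (r + s).toPoly.coeff e = r.toPoly.coeff e + s.toPoly.coeff e :=
      Polynomial.coeff_add _ _ e
    rw [h]
    exact ⟨Submodule.add_mem _ (hr e).1 (hs e).1, fun he => by
      rw [(hr e).2 he, (hs e).2 he, add_zero]⟩
  smul_mem' := fun a r hr e => by
    have h : (a • r).toPoly.coeff e = a • r.toPoly.coeff e := Polynomial.coeff_smul a _ e
    rw [h]
    exact ⟨Submodule.smul_mem _ a (hr e).1, fun he => by rw [(hr e).2 he, smul_zero]⟩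

/-- The grading of the `T`-module `I^k`. -/
def gradingPow (f : Fin n → PolyT K m) (k : ℕ) (j : ℤ) : Submodule K ↥(genIdeal f ^ k) :=
  (gradingT K m j).comap ((genIdeal f ^ k).subtype.restrictScalars K)

/-- The ideal `R_+ = ⨁_{k > 0} I^k t^k` of the Rees algebra. -/
def reesPlus (f : Fin n → PolyT K m) : Ideal (Rees f) :=
  RingHom.ker (Polynomial.constantCoeff.comp (reesAlgebra (genIdeal f)).toSubring.subtype)

/-- The maximal bigraded ideal `(𝔪, R_+)` of the Rees algebra, `𝔪 = (x_1, …, x_m)`. -/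
def reesMaximal (f : Fin n → PolyT K m) : Ideal (Rees f) :=
  (Ideal.span (Set.range (MvPolynomial.X : Fin m → PolyT K m))).map
    (algebraMap (PolyT K m) (Rees f)) ⊔ reesPlus f

theorem X_mem_gradingT (l : Fin m) :
    (MvPolynomial.X l : PolyT K m) ∈ gradingT K m 1 :=
  MvPolynomial.isWeightedHomogeneous_X K _ l

theorem X_mem_gradingS (d : Fin n → ℕ) (l : Fin m) :
    (MvPolynomial.X (Sum.inl l) : PolyS K m n) ∈ gradingS K m d (1, 0) :=
  MvPolynomial.isWeightedHomogeneous_X K (bidegree m d) (Sum.inl l)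

theorem mul_mem_gradingS (d : Fin n → ℕ) {α γ : ℤ × ℤ} {a x : PolyS K m n}
    (ha : a ∈ gradingS K m d α) (hx : x ∈ gradingS K m d γ) : a * x ∈ gradingS K m d (α + γ) :=
  MvPolynomial.IsWeightedHomogeneous.mul ha hx

theorem smul_mem_gradingPow (f : Fin n → PolyT K m) (k : ℕ) {α γ : ℤ} {a : PolyT K m}
    {x : ↥(genIdeal f ^ k)} (ha : a ∈ gradingT K m α) (hx : x ∈ gradingPow f k γ) :
    a • x ∈ gradingPow f k (α + γ) :=
  MvPolynomial.IsWeightedHomogeneous.mul ha hx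

/-- The local cohomology `H^i_𝔪(I^k)` over `T`, `𝔪 = (x_1, …, x_m)`. -/
abbrev PowCohomology (f : Fin n → PolyT K m) (k : ℕ) (i : ℤ) : Type _ :=
  LocalCohomology (MvPolynomial.X : Fin m → PolyT K m) ↥(genIdeal f ^ k) i

/-- The homogeneous component `H^i_𝔪(I^k)_j`. -/
def powCohomologyPiece (f : Fin n → PolyT K m) (k : ℕ) (i j : ℤ) :
    Submodule K (PowCohomology f k i) :=
  localCohomologyPiece (MvPolynomial.X : Fin m → PolyT K m) (gradingT K m) (gradingPow f k) i j

/-- Multiplication by `x_l` on the graded `T`-module `H^i_𝔪(I^k)`. -/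
def powMulX (f : Fin n → PolyT K m) (k : ℕ) (i j : ℤ) (l : Fin m) :
    powCohomologyPiece f k i j →ₗ[K] powCohomologyPiece f k i (1 + j) :=
  mulPiece (MvPolynomial.X l : PolyT K m) _ _ fun _ hx =>
    smul_mem_localCohomologyPiece (K := K) (A := PolyT K m) (M := ↥(genIdeal f ^ k))
      (𝒜 := gradingT K m) (𝓜 := gradingPow f k) (MvPolynomial.X : Fin m → PolyT K m)
      (fun {_ _ _ _} ha hx => smul_mem_gradingPow f k ha hx) i (X_mem_gradingT l) hx

/-- The canonical module `ω_R = Ext^{n-1}_S(R, S(-σ))` of the Rees algebra of an ideal `I ≠ 0`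
(so that `dim R = m + 1 = dim S - (n - 1)`), computed from a graded free resolution `F` of the
`S`-module `R`. The shift by `σ` enters in its bigrading `canonicalPiece`. -/
abbrev CanonicalModule {d : Fin n → ℕ} {f : Fin n → PolyT K m}
    (F : GradedFreeResolution (gradingS K m d) (gradingRees f)) : Type _ :=
  ExtModule F (n - 1)

/-- The bigrading of `ω_R`. -/
def canonicalPiece {d : Fin n → ℕ} {f : Fin n → PolyT K m}
    (F : GradedFreeResolution (gradingS K m d) (gradingRees f)) (γ : ℤ × ℤ) :
    Submodule K (CanonicalModule F) :=
  extPiece F (sigma m d) (n - 1) γ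

/-- The local cohomology `H^q_{R_+}(ω_R)`. The ideal `R_+` is generated by the `f_j t`, and
`f_j t` acts on `ω_R` as `y_j ∈ S`. -/
abbrev CanonicalCohomology {d : Fin n → ℕ} {f : Fin n → PolyT K m}
    (F : GradedFreeResolution (gradingS K m d) (gradingRees f)) (q : ℤ) : Type _ :=
  LocalCohomology (fun j : Fin n => (MvPolynomial.X (Sum.inr j) : PolyS K m n))
    (CanonicalModule F) q

/-- The homogeneous component `H^q_{R_+}(ω_R)_γ`, for a bidegree `γ`. For fixed `k` the components
of bidegrees `(j, k)`, `j ∈ ℤ`, are those of the graded `T`-module `H^q_{R_+}(ω_R)_k`. -/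
def canonicalCohomologyPiece {d : Fin n → ℕ} {f : Fin n → PolyT K m}
    (F : GradedFreeResolution (gradingS K m d) (gradingRees f)) (q : ℤ) (γ : ℤ × ℤ) :
    Submodule K (CanonicalCohomology F q) :=
  localCohomologyPiece _ (gradingS K m d) (canonicalPiece F) q γ

theorem smul_mem_canonicalPiece {d : Fin n → ℕ} {f : Fin n → PolyT K m}
    (F : GradedFreeResolution (gradingS K m d) (gradingRees f)) {α γ : ℤ × ℤ} {a : PolyS K m n}
    {x : CanonicalModule F} (ha : a ∈ gradingS K m d α) (hx : x ∈ canonicalPiece F γ) :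
    a • x ∈ canonicalPiece F (α + γ) :=
  smul_mem_extPiece F (mul_mem_gradingS d) (sigma m d) (n - 1) ha hx

theorem X_smul_mem_canonicalCohomologyPiece {d : Fin n → ℕ} {f : Fin n → PolyT K m}
    (F : GradedFreeResolution (gradingS K m d) (gradingRees f)) (q : ℤ) {j j' : ℤ}
    (hj : 1 + j = j') (k : ℤ) (l : Fin m) (x : CanonicalCohomology F q)
    (hx : x ∈ canonicalCohomologyPiece F q (j, k)) :
    (MvPolynomial.X (Sum.inl l) : PolyS K m n) • x ∈ canonicalCohomologyPiece F q (j', k) := by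
  have h : ((1, 0) + (j, k) : ℤ × ℤ) = (j', k) := by rw [Prod.mk_add_mk, zero_add, hj]
  rw [← h]
  exact smul_mem_localCohomologyPiece (K := K) (A := PolyS K m n) (M := CanonicalModule F)
    (𝒜 := gradingS K m d) (𝓜 := canonicalPiece F)
    (fun j : Fin n => (MvPolynomial.X (Sum.inr j) : PolyS K m n))
    (fun {_ _ _ _} ha hx => smul_mem_canonicalPiece F ha hx) q (X_mem_gradingS d l) hx

/-- Multiplication by `x_l` on the graded `T`-module `H^q_{R_+}(ω_R)_k`, as a map from degree `j`
to degree `j' = 1 + j`. -/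
def canonicalMulX {d : Fin n → ℕ} {f : Fin n → PolyT K m}
    (F : GradedFreeResolution (gradingS K m d) (gradingRees f)) (q : ℤ) {j j' : ℤ}
    (hj : 1 + j = j') (k : ℤ) (l : Fin m) :
    canonicalCohomologyPiece F q (j, k) →ₗ[K] canonicalCohomologyPiece F q (j', k) :=
  mulPiece (MvPolynomial.X (Sum.inl l) : PolyS K m n) _ _
    (X_smul_mem_canonicalCohomologyPiece F q hj k l)

end Rees

end

end GradedLC

/-! ### Regular sequences generating the maximal ideals of a polynomial ring. -/

namespace GradedLC

/-! Let `F` be the given resolution of `R` over `S`, and let F* be its dual Hom(F, S(-σ)). The proof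
compares the complexes H^m_{(x)}(F) and H^n_{(y)}(F*). The module H^m_{(x)}(S) has as basis the
monomials with negative x-exponents and nonnegative y-exponents, and H^n_{(y)}(S) those with the
signs reversed. Taking the coefficient of (x_1⋯x_m y_1⋯y_n)^{-1} in a product therefore pairs them
perfectly, and the shift by σ makes complementary bidegrees add up to zero. The differentials of F
and F* are transposes of each other, so the homology of H^m_{(x)}(F) at position q, in bidegree (j,
k), is the dual of the cohomology of H^n_{(y)}(F*) at q, in bidegree (-j, -k)
(`isPerfectPairing_residuePairing`, `IsPerfectPairing.exists_dual_equiv`).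

Each side is then computed by a Čech double complex whose rows are exact before the last column. For
F and the x_i the columns have homology only at position 0, because F resolves R; the strand of
y-degree k gives H^{m-q}_𝔪(I^k). For F* and the y_j the columns compute localizations of Ext^q_S(R,
S). Columns that invert some y_b have cohomology only in degree n - 1, since the other Ext modules
are R_+-torsion. The column that inverts nothing is not controlled in this way, but the y-degrees of
its terms in a bounded range of positions are bounded below, so it vanishes there in y-degree -k for
large k; this is where k₀ comes from. What remains is H^{q+1}_{R_+}(ω_R)_{-k}, and q = m - i gives
the theorem.

The torsion statement (`exists_pow_smul_mem_extCoboundaries`) is checked at maximal ideals P of S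
with y_b ∉ P. If P does not contain the kernel of S → R, everything vanishes. Otherwise P comes from
a prime 𝔭 ≠ (𝔪, R_+), the ring R_𝔭 is Cohen–Macaulay, and the maximal ideal of S_P is generated by a
regular sequence of length m + n. So Ext lives in the single degree m + n - dim R_𝔭. Comparing
heights shows that this degree is at least n - 1. As Ext vanishes below it, also at the generic
point of R, it is at most the height of the kernel, which is n - 1 (`height_ker_toRees`).

Spectral sequences are replaced by linear relations: a zigzag in a double complex is a relation that
induces an isomorphism of subquotients (`IsCorrespondence`). All terms of a Čech double complex are
subspaces of one space of families of Laurent polynomials, so multiplication by x_l visibly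
preserves these relations. It is also self-adjoint for the residue pairing, and this makes the final
isomorphism T-linear. -/

open RingTheory.Sequence Polynomial in
theorem exists_weaklyRegular_generators_polynomial {A : Type*} [CommRing A] [IsJacobsonRing A]
    [Nontrivial A] {N : ℕ}
    (hA : ∀ I : Ideal A, I.IsMaximal →
      ∃ rs : List A, rs.length = N ∧ Ideal.ofList rs = I ∧ IsWeaklyRegular A rs)
    (P : Ideal A[X]) (hP : P.IsMaximal) :
    ∃ rs : List A[X], rs.length = N + 1 ∧ Ideal.ofList rs = P ∧ IsWeaklyRegular A[X] rs := by
  have hmax : (P.comap C).IsMaximal := Polynomial.isMaximal_comap_C_of_isJacobsonRing P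
  have hprime : ((P.comap C).map (C : A →+* A[X])).IsPrime :=
    (Ideal.isPrime_map_C_iff_isPrime _).2 hmax.isPrime
  have hX : (X : A[X]) ∉ (P.comap C).map (C : A →+* A[X]) := fun h => by
    have := Ideal.mem_map_C_iff.1 h 1
    rw [coeff_X_one] at this
    exact hmax.ne_top ((Ideal.eq_top_iff_one _).2 this)
  -- Otherwise X would be invertible modulo the extended ideal, and comparing constant coefficients
  -- would put 1 into the contraction of P.
  have hne : P ≠ (P.comap C).map C := fun h => by
    have hm : ((P.comap C).map (C : A →+* A[X])).IsMaximal := h ▸ hP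
    obtain ⟨y, hy⟩ := hm.exists_inv hX
    obtain ⟨i, hi, h1⟩ := hy
    have := Ideal.mem_map_C_iff.1 hi 0
    have h0 := congrArg (fun q => coeff q 0) h1
    simp only [coeff_add, mul_coeff_zero, coeff_X_zero, mul_zero, zero_add, coeff_one_zero] at h0
    rw [h0] at this
    exact hmax.ne_top ((Ideal.eq_top_iff_one _).2 this)
  -- Modulo the contraction of P the ring is a polynomial ring over a field, so one further
  -- generator is enough.
  obtain ⟨g, -, hgP⟩ := Polynomial.exists_monic_span_sup_map_eq A P hmax hne
  obtain ⟨rs, hlen, hrs, hreg⟩ := hA _ hmax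
  have hmap : Ideal.ofList (rs.map (C : A →+* A[X])) = (P.comap C).map C := by
    rw [← Ideal.map_ofList, hrs]
  refine ⟨rs.map (C : A →+* A[X]) ++ [g], by simp [hlen], ?_, ?_⟩
  · rw [Ideal.ofList_append, Ideal.ofList_singleton, hmap, ← hgP]
  · rw [isWeaklyRegular_append_iff]
    refine ⟨IsWeaklyRegular.of_flat (S := A[X]) hreg, ?_⟩
    rw [isWeaklyRegular_singleton_iff, hmap]
    -- The extended ideal is prime, so g is a nonzerodivisor modulo it as soon as g lies outside it.
    have hg : g ∉ (P.comap C).map C := fun h => hne <| by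
      nth_rw 1 [hgP]
      rw [sup_eq_left, Ideal.span_singleton_le_iff_mem]
      exact h
    refine isSMulRegular_iff_right_eq_zero_of_smul.2 fun x => ?_
    obtain ⟨x, rfl⟩ := Submodule.Quotient.mk_surjective _ x
    rw [← Submodule.Quotient.mk_smul, Submodule.Quotient.mk_eq_zero, Submodule.Quotient.mk_eq_zero]
    simp only [smul_eq_mul, Ideal.mul_top]
    exact fun h => (hprime.mem_or_mem h).resolve_left hg

open RingTheory.Sequence in
theorem exists_weaklyRegular_generators_of_ringEquiv {A B : Type*} [CommRing A] [CommRing B]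
    (e : A ≃+* B) {N : ℕ}
    (hA : ∀ I : Ideal A, I.IsMaximal →
      ∃ rs : List A, rs.length = N ∧ Ideal.ofList rs = I ∧ IsWeaklyRegular A rs)
    (P : Ideal B) (hP : P.IsMaximal) :
    ∃ rs : List B, rs.length = N ∧ Ideal.ofList rs = P ∧ IsWeaklyRegular B rs := by
  obtain ⟨rs, h1, h2, h3⟩ := hA (P.comap e) (Ideal.comap_isMaximal_of_equiv e)
  refine ⟨rs.map (e : A →+* B), by simpa, ?_, ?_⟩
  · rw [← Ideal.map_ofList, h2]
    exact Ideal.map_comap_of_surjective _ e.surjective _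
  · refine (AddEquiv.isWeaklyRegular_congr (e := e.toAddEquiv) ?_).1 h3
    rw [List.forall₂_map_right_iff, List.forall₂_same]
    exact fun r _ x => map_mul e r x

-- Induction on the number of variables. Polynomial rings over a field are Jacobson rings, so
-- maximal ideals contract to maximal ideals and each variable contributes one generator.
open RingTheory.Sequence in
theorem exists_weaklyRegular_generators_fin (K : Type*) [Field K] (N : ℕ)
    (P : Ideal (MvPolynomial (Fin N) K)) (hP : P.IsMaximal) :
    ∃ rs : List (MvPolynomial (Fin N) K), rs.length = N ∧ Ideal.ofList rs = P ∧
      IsWeaklyRegular (MvPolynomial (Fin N) K) rs := by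
  induction N with
  | zero =>
    refine exists_weaklyRegular_generators_of_ringEquiv
      (MvPolynomial.isEmptyRingEquiv K (Fin 0)).symm (fun I hI => ⟨[], rfl, ?_, .nil _ _⟩) P hP
    rw [Ideal.ofList_nil]
    exact ((Ideal.eq_bot_or_top I).resolve_right hI.ne_top).symm
  | succ N ih =>
    exact exists_weaklyRegular_generators_of_ringEquiv (MvPolynomial.finSuccEquiv K N).symm.toRingEquiv
      (fun I hI => exists_weaklyRegular_generators_polynomial ih I hI) P hP

open RingTheory.Sequence in
theorem exists_weaklyRegular_generators (K : Type*) [Field K] (σ : Type*) [Finite σ]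
    (P : Ideal (MvPolynomial σ K)) (hP : P.IsMaximal) :
    ∃ rs : List (MvPolynomial σ K), rs.length = Nat.card σ ∧ Ideal.ofList rs = P ∧
      IsWeaklyRegular (MvPolynomial σ K) rs :=
  exists_weaklyRegular_generators_of_ringEquiv
    (MvPolynomial.renameEquiv K (Finite.equivFin σ)).symm.toRingEquiv
    (exists_weaklyRegular_generators_fin K _) P hP

open CategoryTheory Abelian IsLocalRing RingTheory.Sequence Module

universe u

/-! ### Vanishing of Ext over a Noetherian local ring. -/

section Ext

variable {A : Type u} [CommRing A]

theorem subsingleton_ext_middle {S : ShortComplex (ModuleCat.{u} A)} (hS : S.ShortExact)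
    (Y : ModuleCat.{u} A) (q : ℕ) (h₁ : Subsingleton (Ext S.X₁ Y q))
    (h₃ : Subsingleton (Ext S.X₃ Y q)) : Subsingleton (Ext S.X₂ Y q) := by
  refine subsingleton_of_forall_eq 0 fun x => ?_
  obtain ⟨y, rfl⟩ := Ext.contravariant_sequence_exact₂ hS Y x (Subsingleton.elim _ _)
  rw [Subsingleton.elim y 0, Ext.comp_zero]

theorem subsingleton_ext_of_iso {X X' : ModuleCat.{u} A} (e : X ≅ X') (Y : ModuleCat.{u} A) (q : ℕ)
    (h : Subsingleton (Ext X Y q)) : Subsingleton (Ext X' Y q) := by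
  refine subsingleton_of_forall_eq 0 fun x => ?_
  have hx : (Ext.mk₀ e.inv).comp ((Ext.mk₀ e.hom).comp x (zero_add q)) (zero_add q) = x := by
    rw [Ext.mk₀_comp_mk₀_assoc, e.inv_hom_id, Ext.mk₀_id_comp]
  rw [← hx, Subsingleton.elim ((Ext.mk₀ e.hom).comp x (zero_add q)) 0, Ext.comp_zero]

/-- Over a Noetherian local ring whose maximal ideal is generated by a regular sequence of length
`h`, a module of finite length has `Ext` into the ring only in degree `h`. -/
theorem subsingleton_ext_of_support_subset [IsNoetherianRing A] [IsLocalRing A] {rs : List A}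
    (hrs : Ideal.ofList rs = maximalIdeal A) (hreg : IsRegular A rs)
    (M : Type u) [AddCommGroup M] [Module A M] [Module.Finite A M]
    (hM : support A M ⊆ {closedPoint A}) {q : ℕ} (hq : q ≠ rs.length) :
    Subsingleton (Ext (ModuleCat.of A M) (ModuleCat.of A A) q) := by
  have hzero : PrimeSpectrum.zeroLocus (maximalIdeal A : Set A) = {closedPoint A} := by
    ext p
    simp only [PrimeSpectrum.mem_zeroLocus, SetLike.coe_subset_coe, Set.mem_singleton_iff]
    refine ⟨fun h => PrimeSpectrum.ext ?_, fun h => h ▸ le_rfl⟩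
    exact (IsLocalRing.eq_maximalIdeal
      (((maximalIdeal.isMaximal A).eq_of_le p.2.ne_top h) ▸ maximalIdeal.isMaximal A))
  rcases lt_or_gt_of_ne hq with hq | hq
  -- Below the length of `rs` this is the Ext characterization of depth: `rs` is regular on the ring
  -- and M is supported at the closed point.
  · refine ModuleCat.subsingleton_ext_of_exists_isRegular (maximalIdeal A) (ModuleCat.of A M)
      (hzero ▸ hM) (ModuleCat.of A A) ?_ rs (fun r hr => hrs ▸ Ideal.subset_span hr) hreg q hq
    rw [lt_top_iff_ne_top]
    change maximalIdeal A • (⊤ : Submodule A A) ≠ ⊤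
    rw [smul_eq_mul, Ideal.mul_top]
    exact (maximalIdeal.isMaximal A).ne_top
  -- Above that degree the residue field has no Ext, its projective dimension being the length of
  -- `rs`.
  · have hpd := ModuleCat.projectiveDimension_quotient_eq_length rs hreg
    have hκ : Subsingleton (Ext (ModuleCat.of A (A ⧸ maximalIdeal A)) (ModuleCat.of A A) q) := by
      have hlt : HasProjectiveDimensionLT
          (ModuleCat.of A (Shrink.{u} (A ⧸ Ideal.ofList rs))) (rs.length + 1) := by
        exact (projectiveDimension_le_iff _ _).1 hpd.le
      exact subsingleton_ext_of_iso (LinearEquiv.toModuleIso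
        ((Shrink.linearEquiv A _).trans (Submodule.quotEquivOfEq _ _ hrs))) _ q
        (HasProjectiveDimensionLT.subsingleton _ (rs.length + 1) q hq _)
    -- Dévissage: M is filtered by quotients by primes, and the support condition passes to
    -- submodules and quotients, so only the residue field occurs.
    revert hM
    refine IsNoetherianRing.induction_on_isQuotientEquivQuotientPrime A (M := M) inferInstance
      (motive := fun N _ _ _ => support A N ⊆ {closedPoint A} →
        Subsingleton (Ext (ModuleCat.of A N) (ModuleCat.of A A) q)) ?_ ?_ ?_
    · intro N _ _ _ _ _
      refine subsingleton_of_forall_eq 0 fun x => ?_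
      rw [← Ext.mk₀_id_comp x, show 𝟙 (ModuleCat.of A N) = 0 from ?_, Ext.mk₀_zero, Ext.zero_comp]
      ext x
      exact Subsingleton.elim _ _
    · intro N _ _ _ p e hN
      rw [e.support_eq, Module.support_eq_zeroLocus, Ideal.annihilator_quotient] at hN
      have hp : p = closedPoint A := hN (fun _ h => h)
      exact subsingleton_ext_of_iso (LinearEquiv.toModuleIso
        ((Submodule.quotEquivOfEq _ _ (by rw [hp]; rfl)).trans e.symm)) _ q hκ
    · intro N₁ _ _ _ N₂ _ _ _ N₃ _ _ _ f g hf hg hfg h₁ h₃ h₂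
      have hS : (ShortComplex.mk (ModuleCat.ofHom f) (ModuleCat.ofHom g) (by
          ext x; exact hfg.apply_apply_eq_zero x)).ShortExact :=
        { exact := (ShortComplex.ShortExact.moduleCat_exact_iff_function_exact _).2 hfg
          mono_f := (ModuleCat.mono_iff_injective _).2 hf
          epi_g := (ModuleCat.epi_iff_surjective _).2 hg }
      exact subsingleton_ext_middle hS _ q
        (h₁ ((Module.support_subset_of_injective f hf).trans h₂))
        (h₃ ((Module.support_subset_of_surjective g hg).trans h₂))

/-- By the long exact sequence of 0 → M → M → M/xM → 0, multiplication by x is surjective on the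
finitely generated module Ext^q(M, A); Nakayama's lemma applies. -/
theorem subsingleton_ext_of_quotSMulTop [IsNoetherianRing A] [IsLocalRing A]
    (M : Type u) [AddCommGroup M] [Module A M] [Module.Finite A M] {x : A}
    (hx : x ∈ maximalIdeal A) (hreg : IsSMulRegular M x) (q : ℕ)
    (h : Subsingleton (Ext (ModuleCat.of A (QuotSMulTop x M)) (ModuleCat.of A A) (q + 1))) :
    Subsingleton (Ext (ModuleCat.of A M) (ModuleCat.of A A) q) := by
  have hS : ((ModuleCat.of A M).smulShortComplex x).ShortExact := hreg.smulShortComplex_shortExact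
  have hsurj : ∀ y : Ext (ModuleCat.of A M) (ModuleCat.of A A) q, ∃ z, x • z = y := by
    intro y
    obtain ⟨z, rfl⟩ : ∃ z : Ext (ModuleCat.of A M) (ModuleCat.of A A) q,
        (Ext.mk₀ (x • 𝟙 (ModuleCat.of A M))).comp z (zero_add q) = y :=
      Ext.contravariant_sequence_exact₁ hS (ModuleCat.of A A) y
        (add_comm 1 q) (@Subsingleton.elim _ h _ _)
    exact ⟨z, by rw [Ext.mk₀_smul, Ext.smul_comp, Ext.mk₀_id_comp]⟩
  refine (Submodule.subsingleton_iff A).1 (subsingleton_of_bot_eq_top ?_)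
  refine (Submodule.eq_bot_of_le_smul_of_le_jacobson_bot (maximalIdeal A) ⊤
    (Module.Finite.fg_top) ?_ (IsLocalRing.maximalIdeal_le_jacobson _)).symm
  intro y _
  obtain ⟨z, rfl⟩ := hsurj y
  exact Submodule.smul_mem_smul hx trivial

/-- Dividing by one element of the sequence moves the question up by one Ext degree, so the only
degree allowed for M is h minus the length of the sequence. -/
theorem subsingleton_ext_of_isWeaklyRegular [IsNoetherianRing A] [IsLocalRing A] (h : ℕ)
    (as : List A) (has : ∀ a ∈ as, a ∈ maximalIdeal A)
    (M : Type u) [AddCommGroup M] [Module A M] [Module.Finite A M] (hreg : IsWeaklyRegular M as)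
    (hM : ∀ q, q ≠ h → Subsingleton (Ext (ModuleCat.of A
      (M ⧸ (Ideal.ofList as • ⊤ : Submodule A M))) (ModuleCat.of A A) q))
    (q : ℕ) (hq : q + as.length ≠ h) :
    Subsingleton (Ext (ModuleCat.of A M) (ModuleCat.of A A) q) := by
  induction as generalizing M q with
  | nil =>
    refine subsingleton_ext_of_iso (LinearEquiv.toModuleIso ?_) _ q (hM q (by simpa using hq))
    exact Submodule.quotEquivOfEqBot _ (by simp)
  | cons a as ih =>
    rw [isWeaklyRegular_cons_iff] at hreg
    refine subsingleton_ext_of_quotSMulTop M (has a List.mem_cons_self) hreg.1 q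
      (ih (fun b hb => has b (List.mem_cons_of_mem _ hb)) (QuotSMulTop a M) hreg.2 (fun q' hq' => ?_)
        (q + 1) (by rw [List.length_cons] at hq; omega))
    exact subsingleton_ext_of_iso (LinearEquiv.toModuleIso
      (Submodule.quotOfListConsSMulTopEquivQuotSMulTopInner M a as)) _ q' (hM q' hq')

end Ext

end GradedLC


/-! ### Ext computed from the matrices of a free resolution. -/

namespace GradedLC

open CategoryTheory Abelian Module Matrix

universe u

section FreeResolution

variable {A : Type u} [CommRing A]

theorem subsingleton_ext_zero_iff (M : Type u) [AddCommGroup M] [Module A M] :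
    Subsingleton (Ext (ModuleCat.of A M) (ModuleCat.of A A) 0) ↔ ∀ φ : M →ₗ[A] A, φ = 0 := by
  rw [(Ext.addEquiv₀.trans ModuleCat.homAddEquiv).subsingleton_congr]
  exact ⟨fun h φ => Subsingleton.elim _ _, fun h => subsingleton_of_forall_eq 0 h⟩

variable {S : ShortComplex (ModuleCat.{u} A)} (hS : S.ShortExact) [Projective S.X₂]
include hS

theorem subsingleton_ext_add_two_iff (Y : ModuleCat.{u} A) (q : ℕ) :
    Subsingleton (Ext S.X₃ Y (q + 2)) ↔ Subsingleton (Ext S.X₁ Y (q + 1)) := by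
  constructor
  · intro h
    refine subsingleton_of_forall_eq 0 fun x => ?_
    obtain ⟨y, rfl⟩ := Ext.contravariant_sequence_exact₁ hS Y x (n₁ := q + 2) (by omega)
      (Subsingleton.elim _ _)
    rw [Ext.eq_zero_of_projective y, Ext.comp_zero]
  · intro h
    refine subsingleton_of_forall_eq 0 fun x => ?_
    obtain ⟨y, rfl⟩ := Ext.contravariant_sequence_exact₃ hS Y x
      (Ext.eq_zero_of_projective _) (n₀ := q + 1) (by omega)
    rw [Subsingleton.elim y 0, Ext.comp_zero]

/-- Ext^1 of the quotient is the cokernel of Hom(X₂, Y) → Hom(X₁, Y). This is kept apart from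
dimension shifting because Hom(X₂, Y) does not vanish. -/
theorem subsingleton_ext_one_iff (Y : ModuleCat.{u} A) :
    Subsingleton (Ext S.X₃ Y 1) ↔ ∀ φ : S.X₁ ⟶ Y, ∃ ψ : S.X₂ ⟶ Y, S.f ≫ ψ = φ := by
  constructor
  · intro h φ
    obtain ⟨y, hy⟩ := Ext.contravariant_sequence_exact₁ hS Y (Ext.mk₀ φ) (n₁ := 1) (by omega)
      (Subsingleton.elim _ _)
    obtain ⟨ψ, rfl⟩ := (Ext.mk₀_bijective _ _).2 y
    rw [Ext.mk₀_comp_mk₀] at hy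
    exact ⟨ψ, (Ext.mk₀_bijective _ _).1 hy⟩
  · intro h
    refine subsingleton_of_forall_eq 0 fun x => ?_
    obtain ⟨y, rfl⟩ := Ext.contravariant_sequence_exact₃ hS Y x
      (Ext.eq_zero_of_projective _) (n₀ := 0) (by omega)
    obtain ⟨φ, rfl⟩ := (Ext.mk₀_bijective _ _).2 y
    obtain ⟨ψ, rfl⟩ := h φ
    rw [← Ext.mk₀_comp_mk₀]
    exact ShortComplex.ShortExact.extClass_comp_assoc hS _

end FreeResolution

/-- A resolution of `M` by finite free modules, given by matrices. -/
structure FreeResolution (A : Type*) [CommRing A] (M : Type*) [AddCommGroup M] [Module A M] where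
  rank : ℕ → ℕ
  mat : (p : ℕ) → Matrix (Fin (rank p)) (Fin (rank (p + 1))) A
  gen : (Fin (rank 0) → A) →ₗ[A] M
  gen_surjective : Function.Surjective gen
  exact_zero : LinearMap.ker gen = LinearMap.range (mat 0).mulVecLin
  exact_succ : ∀ p, LinearMap.ker (mat p).mulVecLin = LinearMap.range (mat (p + 1)).mulVecLin

namespace FreeResolution

variable {A : Type u} [CommRing A] {M : Type u} [AddCommGroup M] [Module A M]
  (X : FreeResolution A M)

/-- The first syzygy module of a resolution, with its induced resolution. -/
def shift : FreeResolution A (LinearMap.ker X.gen) where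
  rank p := X.rank (p + 1)
  mat p := X.mat (p + 1)
  gen := (X.mat 0).mulVecLin.codRestrict _ fun v => X.exact_zero ▸ ⟨v, rfl⟩
  gen_surjective := fun ⟨v, hv⟩ => by
    rw [X.exact_zero] at hv
    obtain ⟨w, rfl⟩ := hv
    exact ⟨w, rfl⟩
  exact_zero := by rw [LinearMap.ker_codRestrict, X.exact_succ]
  exact_succ p := X.exact_succ (p + 1)

/-- Every cocycle of degree `q` of `Hom(X, A)` is a coboundary. -/
def DualExact : ℕ → Prop
  | 0 => ∀ z, (X.mat 0)ᵀ *ᵥ z = 0 → z = 0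
  | q + 1 => ∀ z, (X.mat (q + 1))ᵀ *ᵥ z = 0 → ∃ w, (X.mat q)ᵀ *ᵥ w = z

theorem transpose_mulVec_eq_zero_iff {r s : ℕ} (B : Matrix (Fin r) (Fin s) A) (z : Fin r → A) :
    Bᵀ *ᵥ z = 0 ↔ ∀ v, z ⬝ᵥ (B *ᵥ v) = 0 := by
  rw [mulVec_transpose]
  simp_rw [dotProduct_mulVec]
  exact ⟨fun h v => by rw [h, zero_dotProduct], fun h => dotProduct_eq_zero _ h⟩

/-- The linear form with coefficients `z`. -/
def dotLin {r : ℕ} (z : Fin r → A) : (Fin r → A) →ₗ[A] A where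
  toFun v := z ⬝ᵥ v
  map_add' := dotProduct_add z
  map_smul' c v := dotProduct_smul c z v

theorem exists_dotLin {r : ℕ} (φ : (Fin r → A) →ₗ[A] A) : ∃ z, dotLin z = φ := by
  refine ⟨fun i => φ (Pi.single i 1), LinearMap.pi_ext' fun i => LinearMap.ext_ring ?_⟩
  simp [dotLin]

theorem dotLin_transpose {r s : ℕ} (B : Matrix (Fin r) (Fin s) A) (z : Fin r → A) :
    dotLin (Bᵀ *ᵥ z) = dotLin z ∘ₗ B.mulVecLin := by
  refine LinearMap.ext fun v => ?_
  change (Bᵀ *ᵥ z) ⬝ᵥ v = z ⬝ᵥ (B *ᵥ v)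
  rw [mulVec_transpose, dotProduct_mulVec]

theorem dotLin_injective {r : ℕ} : Function.Injective (dotLin : (Fin r → A) → _) :=
  fun z w h => dotProduct_eq z w fun v => LinearMap.congr_fun h v

theorem exists_factor {P Q N : Type*} [AddCommGroup P] [AddCommGroup Q] [AddCommGroup N]
    [Module A P] [Module A Q] [Module A N] {g : P →ₗ[A] Q} (hg : Function.Surjective g)
    (φ : P →ₗ[A] N) (h : LinearMap.ker g ≤ LinearMap.ker φ) : ∃ ψ : Q →ₗ[A] N, ψ ∘ₗ g = φ := by
  refine ⟨(LinearMap.ker g).liftQ φ h ∘ₗ (g.quotKerEquivOfSurjective hg).symm, ?_⟩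
  ext x
  simp [LinearMap.quotKerEquivOfSurjective_symm_apply]

/-- A cocycle of degree 0 is a linear form on F₀ that vanishes on the image of F₁. -/
theorem exists_factor_of_cocycle (z : Fin (X.rank 0) → A) (hz : (X.mat 0)ᵀ *ᵥ z = 0) :
    ∃ φ : M →ₗ[A] A, φ ∘ₗ X.gen = dotLin z := by
  refine exists_factor X.gen_surjective _ ?_
  rw [X.exact_zero]
  rintro _ ⟨v, rfl⟩
  exact (transpose_mulVec_eq_zero_iff _ _).1 hz v

theorem exists_cocycle (φ : M →ₗ[A] A) :
    ∃ z, (X.mat 0)ᵀ *ᵥ z = 0 ∧ φ ∘ₗ X.gen = dotLin z := by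
  obtain ⟨z, hz⟩ := exists_dotLin (φ ∘ₗ X.gen)
  refine ⟨z, (transpose_mulVec_eq_zero_iff _ _).2 fun v => ?_, hz.symm⟩
  have hv : X.mat 0 *ᵥ v ∈ LinearMap.ker X.gen := X.exact_zero ▸ ⟨v, rfl⟩
  change dotLin z _ = 0
  rw [hz, LinearMap.comp_apply, LinearMap.mem_ker.1 hv, map_zero]

theorem shortExact : (X.gen.shortComplexKer).ShortExact :=
  LinearMap.shortExact_shortComplexKer X.gen_surjective

theorem projective_middle : Projective X.gen.shortComplexKer.X₂ :=
  ModuleCat.projective_of_free (M := ModuleCat.of A (Fin (X.rank 0) → A)) (Pi.basisFun A _)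

/-- A cocycle of degree 1 is a linear form on the first syzygy, and it is a coboundary exactly when
the form extends to F₀. -/
theorem dualExact_one_iff : X.DualExact 1 ↔
    Subsingleton (Ext (ModuleCat.of A M) (ModuleCat.of A A) 1) := by
  have := X.projective_middle
  refine Iff.trans ?_ (subsingleton_ext_one_iff X.shortExact (ModuleCat.of A A)).symm
  constructor
  · intro h φ
    obtain ⟨z, hz, hφ⟩ := X.shift.exists_cocycle φ.hom
    obtain ⟨w, rfl⟩ := h z hz
    refine ⟨ModuleCat.ofHom (dotLin w), ModuleCat.hom_ext (LinearMap.ext fun x => ?_)⟩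
    obtain ⟨v, rfl⟩ := X.shift.gen_surjective x
    exact (LinearMap.congr_fun (dotLin_transpose (X.mat 0) w) v).symm.trans
      (LinearMap.congr_fun hφ v).symm
  · intro h z hz
    obtain ⟨φ, hφ⟩ := X.shift.exists_factor_of_cocycle z hz
    obtain ⟨ψ, hψ⟩ := h (ModuleCat.ofHom φ)
    obtain ⟨w, hw⟩ := exists_dotLin ψ.hom
    refine ⟨w, dotLin_injective ?_⟩
    refine (dotLin_transpose _ _).trans (Eq.trans (LinearMap.ext fun v => ?_) hφ)
    rw [hw]
    exact congrArg (fun χ => χ.hom (X.shift.gen v)) hψ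

theorem dualExact_zero_iff : X.DualExact 0 ↔
    Subsingleton (Ext (ModuleCat.of A M) (ModuleCat.of A A) 0) := by
  rw [subsingleton_ext_zero_iff]
  constructor
  · intro h φ
    obtain ⟨z, hz, hφ⟩ := X.exists_cocycle φ
    ext x
    obtain ⟨v, rfl⟩ := X.gen_surjective x
    change (φ ∘ₗ X.gen) v = 0
    rw [hφ, h z hz]
    exact zero_dotProduct v
  · intro h z hz
    obtain ⟨φ, hφ⟩ := X.exists_factor_of_cocycle z hz
    refine dotLin_injective ?_
    rw [← hφ, h φ]
    ext
    simp [dotLin]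

/-- Passing to the first syzygy lowers both sides by one degree. Degrees 0 and 1 are the base cases.
-/
theorem dualExact_iff (q : ℕ) : X.DualExact q ↔
    Subsingleton (Ext (ModuleCat.of A M) (ModuleCat.of A A) q) := by
  induction q generalizing M with
  | zero => exact X.dualExact_zero_iff
  | succ q ih =>
    cases q with
    | zero => exact X.dualExact_one_iff
    | succ q =>
      have := X.projective_middle
      exact (ih X.shift).trans (subsingleton_ext_add_two_iff X.shortExact _ q).symm

end FreeResolution

end GradedLC


/-! ### Localization of free resolutions given by matrices. -/

namespace GradedLC

open Matrix

universe u

namespace FreeResolution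

variable {S : Type u} [CommRing S] (W : Submonoid S)

theorem exists_common_denominator {r : ℕ} (v : Fin r → Localization W) :
    ∃ s ∈ W, ∃ v₀ : Fin r → S,
      (algebraMap S (Localization W) s) • v = fun i => algebraMap S (Localization W) (v₀ i) := by
  obtain ⟨s, hs⟩ := IsLocalization.exist_integer_multiples_of_finite W v
  choose v₀ hv₀ using hs
  refine ⟨s, s.2, v₀, funext fun i => ?_⟩
  rw [hv₀, Pi.smul_apply, smul_eq_mul, Algebra.smul_def]

theorem map_mulVec_algebraMap {r s : ℕ} (B : Matrix (Fin r) (Fin s) S) (v : Fin s → S) :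
    (B.map (algebraMap S (Localization W))) *ᵥ (fun i => algebraMap S (Localization W) (v i)) =
      fun i => algebraMap S (Localization W) ((B *ᵥ v) i) := by
  ext i
  simp [mulVec, dotProduct]

theorem exists_smul_eq_zero {r : ℕ} {v : Fin r → S}
    (h : (fun i => algebraMap S (Localization W) (v i)) = 0) : ∃ t ∈ W, t • v = 0 := by
  have h' : ∀ i, ∃ t : W, (t : S) * v i = 0 := fun i =>
    (IsLocalization.map_eq_zero_iff W (Localization W) (v i)).1 (congrFun h i)
  choose t ht using h'
  refine ⟨∏ i, (t i : S), Submonoid.prod_mem _ fun i _ => (t i).2, funext fun i => ?_⟩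
  rw [Pi.smul_apply, smul_eq_mul, ← Finset.prod_erase_mul _ _ (Finset.mem_univ i), mul_assoc, ht,
    mul_zero, Pi.zero_apply]

theorem isUnit_algebraMap {s : S} (hs : s ∈ W) : IsUnit (algebraMap S (Localization W) s) :=
  IsLocalization.map_units _ (⟨s, hs⟩ : W)

/-- Flatness of localization by hand: clear denominators, solve over S, divide again. -/
theorem exact_localize {r s t : ℕ} {B : Matrix (Fin r) (Fin s) S} {C : Matrix (Fin s) (Fin t) S}
    (h : LinearMap.ker B.mulVecLin = LinearMap.range C.mulVecLin) :
    LinearMap.ker (B.map (algebraMap S (Localization W))).mulVecLin =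
      LinearMap.range (C.map (algebraMap S (Localization W))).mulVecLin := by
  ext v
  simp only [LinearMap.mem_ker, LinearMap.mem_range, mulVecLin_apply]
  constructor
  · intro hv
    obtain ⟨a, ha, v₀, hv₀⟩ := exists_common_denominator W v
    have h0 := map_mulVec_algebraMap W B v₀
    rw [← hv₀, mulVec_smul, hv, smul_zero] at h0
    obtain ⟨b, hb, hb0⟩ := exists_smul_eq_zero W h0.symm
    have hker : b • v₀ ∈ LinearMap.ker B.mulVecLin := by
      rw [LinearMap.mem_ker, mulVecLin_apply, mulVec_smul]
      exact hb0
    rw [h] at hker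
    obtain ⟨w, hw⟩ := hker
    have hu := (isUnit_algebraMap W hb).mul (isUnit_algebraMap W ha)
    obtain ⟨u, hu⟩ := hu
    refine ⟨u⁻¹ • fun i => algebraMap S _ (w i), ?_⟩
    rw [mulVec_smul, map_mulVec_algebraMap, ← mulVecLin_apply, hw, inv_smul_eq_iff]
    simp only [Units.smul_def, hu, mul_smul, hv₀]
    ext i
    simp
  · rintro ⟨w, rfl⟩
    obtain ⟨a, ha, w₀, hw₀⟩ := exists_common_denominator W w
    have h0 : B *ᵥ (C *ᵥ w₀) = 0 := by
      have : C.mulVecLin w₀ ∈ LinearMap.ker B.mulVecLin := h ▸ ⟨w₀, rfl⟩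
      exact this
    have h1 : algebraMap S (Localization W) a • ((B.map (algebraMap S (Localization W))) *ᵥ
        ((C.map (algebraMap S (Localization W))) *ᵥ w)) = 0 := by
      rw [← mulVec_smul, ← mulVec_smul, hw₀, map_mulVec_algebraMap, map_mulVec_algebraMap, h0]
      ext; simp
    obtain ⟨u, hu⟩ := isUnit_algebraMap W ha
    rw [← hu] at h1
    exact (smul_eq_zero_iff_eq u).1 h1

variable {W} in
theorem ker_le_of_mk {M : Type u} [AddCommGroup M] [Module S M] (X : FreeResolution S M)
    {v : Fin (X.rank 0) → S} (h : X.gen v = 0) : ∃ w, X.mat 0 *ᵥ w = v := by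
  have : v ∈ LinearMap.ker X.gen := h
  rw [X.exact_zero] at this
  exact this

variable {M : Type u} [AddCommGroup M] [Module S M] (X : FreeResolution S M)

/-- The augmentation of a localized resolution. -/
noncomputable def localizeGen : (Fin (X.rank 0) → Localization W) →ₗ[Localization W]
    LocalizedModule W M :=
  Fintype.linearCombination (Localization W)
    fun i => LocalizedModule.mkLinearMap W M (X.gen (Pi.single i 1))

theorem localizeGen_algebraMap (v : Fin (X.rank 0) → S) :
    X.localizeGen W (fun i => algebraMap S (Localization W) (v i)) =
      LocalizedModule.mkLinearMap W M (X.gen v) := by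
  rw [localizeGen, Fintype.linearCombination_apply]
  conv_rhs => rw [← LinearMap.sum_single_apply (fun _ => S) v]
  rw [map_sum, map_sum]
  refine Finset.sum_congr rfl fun i _ => ?_
  rw [algebraMap_smul, ← map_smul, ← map_smul]
  congr 2
  ext j
  simp [Pi.single_apply]

/-- The localization of a free resolution. -/
noncomputable def localize : FreeResolution (Localization W) (LocalizedModule W M) where
  rank := X.rank
  mat p := (X.mat p).map (algebraMap S (Localization W))
  gen := X.localizeGen W
  gen_surjective := by
    intro x
    induction x using LocalizedModule.induction_on with
    | h m s =>
      obtain ⟨v, rfl⟩ := X.gen_surjective m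
      refine ⟨(Localization.mk 1 s) • fun i => algebraMap S _ (v i), ?_⟩
      rw [map_smul, localizeGen_algebraMap, LocalizedModule.mkLinearMap_apply,
        LocalizedModule.mk_smul_mk, one_smul, mul_one]
  exact_zero := by
    ext v
    simp only [LinearMap.mem_ker, LinearMap.mem_range, mulVecLin_apply]
    constructor
    · intro hv
      obtain ⟨a, ha, v₀, hv₀⟩ := exists_common_denominator W v
      have h0 := X.localizeGen_algebraMap W v₀
      rw [← hv₀, map_smul, hv, smul_zero] at h0
      obtain ⟨b, hb⟩ := (IsLocalizedModule.eq_zero_iff W (LocalizedModule.mkLinearMap W M)).1 h0.symm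
      have hb' : X.gen ((b : S) • v₀) = 0 := by rw [map_smul]; exact hb
      obtain ⟨w, hw⟩ := X.ker_le_of_mk hb'
      obtain ⟨u, hu⟩ := (isUnit_algebraMap W b.2).mul (isUnit_algebraMap W ha)
      refine ⟨u⁻¹ • fun i => algebraMap S _ (w i), ?_⟩
      rw [mulVec_smul, map_mulVec_algebraMap, hw, inv_smul_eq_iff]
      simp only [Units.smul_def, hu, mul_smul, hv₀]
      ext i
      simp
    · rintro ⟨w, rfl⟩
      obtain ⟨a, ha, w₀, hw₀⟩ := exists_common_denominator W w
      have h0 : X.gen (X.mat 0 *ᵥ w₀) = 0 := by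
        have : (X.mat 0).mulVecLin w₀ ∈ LinearMap.ker X.gen := X.exact_zero ▸ ⟨w₀, rfl⟩
        exact this
      have h1 : algebraMap S (Localization W) a • X.localizeGen W
          (((X.mat 0).map (algebraMap S (Localization W))) *ᵥ w) = 0 := by
        rw [← map_smul, ← mulVec_smul, hw₀, map_mulVec_algebraMap, localizeGen_algebraMap, h0,
          map_zero]
      obtain ⟨u, hu⟩ := isUnit_algebraMap W ha
      rw [← hu] at h1
      exact (smul_eq_zero_iff_eq u).1 h1
  exact_succ p := exact_localize W (X.exact_succ p)

/-- The coboundaries of degree `q` of `Hom(X, S)`. -/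
def coboundaries : (q : ℕ) → Submodule S (Fin (X.rank q) → S)
  | 0 => ⊥
  | q + 1 => LinearMap.range (X.mat q)ᵀ.mulVecLin

theorem dualExact_iff_coboundaries (q : ℕ) : X.DualExact q ↔
    ∀ z, (X.mat q)ᵀ *ᵥ z = 0 → z ∈ X.coboundaries q := by
  cases q <;> rfl

theorem map_mem_coboundaries_localize {q : ℕ} {z : Fin (X.rank q) → S}
    (hz : z ∈ X.coboundaries q) :
    (fun i => algebraMap S (Localization W) (z i)) ∈ (X.localize W).coboundaries q := by
  cases q with
  | zero =>
    rw [show z = 0 from hz]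
    exact funext fun i => map_zero _
  | succ q =>
    obtain ⟨w, rfl⟩ := hz
    exact ⟨fun i => algebraMap S _ (w i), map_mulVec_algebraMap W (X.mat q)ᵀ w⟩

theorem exists_smul_mem_coboundaries {q : ℕ} {z : Fin (X.rank q) → S}
    (hz : (fun i => algebraMap S (Localization W) (z i)) ∈ (X.localize W).coboundaries q) :
    ∃ s ∈ W, s • z ∈ X.coboundaries q := by
  cases q with
  | zero => exact exists_smul_eq_zero W hz
  | succ q =>
    obtain ⟨(w : Fin (X.rank q) → Localization W), hw⟩ := hz
    obtain ⟨a, ha, w₀, hw₀⟩ := exists_common_denominator W w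
    have h1 : (fun i => algebraMap S (Localization W) ((a • z - (X.mat q)ᵀ *ᵥ w₀) i)) = 0 := by
      have h2 := map_mulVec_algebraMap W (X.mat q)ᵀ w₀
      rw [← hw₀, mulVec_smul] at h2
      ext i
      have h3 := congrFun h2 i
      have h4 := congrFun hw i
      rw [Pi.smul_apply, smul_eq_mul] at h3
      rw [Pi.sub_apply, map_sub, ← h3, Pi.smul_apply, smul_eq_mul, map_mul, Pi.zero_apply,
        sub_eq_zero]
      exact congrArg _ h4.symm
    obtain ⟨b, hb, hb0⟩ := exists_smul_eq_zero W h1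
    refine ⟨b * a, W.mul_mem hb ha, b • w₀, ?_⟩
    rw [smul_sub, sub_eq_zero] at hb0
    rw [mulVecLin_apply, mulVec_smul, mul_smul, hb0]

/-- This turns vanishing of a localized Ext module into a statement about annihilators of individual
classes over S, the form in which local information is later collected. -/
theorem dualExact_localize_iff (q : ℕ) : (X.localize W).DualExact q ↔
    ∀ z, (X.mat q)ᵀ *ᵥ z = 0 → ∃ s ∈ W, s • z ∈ X.coboundaries q := by
  rw [dualExact_iff_coboundaries]
  constructor
  · intro h z hz
    refine X.exists_smul_mem_coboundaries W (h _ ?_)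
    refine (map_mulVec_algebraMap W (X.mat q)ᵀ z).trans ?_
    rw [hz]
    exact funext fun i => map_zero _
  · intro h (z : Fin (X.rank q) → Localization W) hz
    obtain ⟨a, ha, z₀, hz₀⟩ := exists_common_denominator W z
    have h0 := map_mulVec_algebraMap W (X.mat q)ᵀ z₀
    rw [← hz₀, mulVec_smul] at h0
    rw [show ((X.mat q)ᵀ.map (algebraMap S (Localization W))) *ᵥ z = 0 from hz, smul_zero] at h0
    obtain ⟨b, hb, hb0⟩ := exists_smul_eq_zero W h0.symm
    rw [← mulVec_smul] at hb0
    obtain ⟨c, hc, hc0⟩ := h _ hb0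
    have h1 := X.map_mem_coboundaries_localize W hc0
    have h2 : (fun i => algebraMap S (Localization W) ((c • b • z₀) i)) =
        (algebraMap S (Localization W) (c * b * a)) • z := by
      rw [map_mul, mul_smul, hz₀]
      ext i
      simp [mul_assoc]
    rw [h2] at h1
    exact (Submodule.smul_mem_iff_of_isUnit _
      (isUnit_algebraMap W (W.mul_mem (W.mul_mem hc hb) ha))).1 h1

end FreeResolution

end GradedLC


/-! ### The presentation S → R of the Rees algebra and the height of its kernel. -/

namespace GradedLC

open MvPolynomial

universe u

variable {K : Type u} [Field K] {m n : ℕ} (f : Fin n → PolyT K m)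

theorem toRees_X_inl (i : Fin m) :
    toRees f (X (Sum.inl i)) = algebraMap (PolyT K m) (Rees f) (X i) := by
  simp [toRees]

theorem toRees_X_inr (j : Fin n) : toRees f (X (Sum.inr j)) = reesGen f j := by
  simp [toRees]

theorem toRees_rename (g : PolyT K m) :
    toRees f (rename Sum.inl g) = algebraMap (PolyT K m) (Rees f) g := by
  induction g using MvPolynomial.induction_on with
  | C a =>
    rw [rename_C, ← algebraMap_eq, AlgHom.commutes, ← algebraMap_eq]
    exact IsScalarTower.algebraMap_apply K (PolyT K m) (Rees f) a
  | add p q hp hq => rw [map_add, map_add, hp, hq, map_add]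
  | mul_X p i hp => rw [map_mul, map_mul, hp, rename_X, toRees_X_inl, map_mul]

/-- The Rees algebra is generated over T by I t, and I t is spanned over T by the f_j t. -/
theorem toRees_surjective : Function.Surjective (toRees f) := by
  have h : ∀ p ∈ reesAlgebra (genIdeal f), ∃ s, (toRees f s : Polynomial (PolyT K m)) = p := by
    intro p hp
    rw [← adjoin_monomial_eq_reesAlgebra] at hp
    induction hp using Algebra.adjoin_induction with
    | mem x hx =>
      obtain ⟨g, hg, rfl⟩ := hx
      induction hg using Submodule.span_induction with
      | mem g hg =>
        obtain ⟨j, rfl⟩ := hg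
        exact ⟨X (Sum.inr j), by rw [toRees_X_inr]; rfl⟩
      | zero => exact ⟨0, by simp⟩
      | add g g' _ _ h h' =>
        obtain ⟨s, hs⟩ := h
        obtain ⟨s', hs'⟩ := h'
        exact ⟨s + s', by rw [map_add, map_add, ← hs, ← hs']; rfl⟩
      | smul a g _ h =>
        obtain ⟨s, hs⟩ := h
        refine ⟨rename Sum.inl a * s, ?_⟩
        rw [map_mul, toRees_rename, map_smul, ← hs, Algebra.smul_def]
        rfl
    | algebraMap g => exact ⟨rename Sum.inl g, by rw [toRees_rename]; rfl⟩
    | add x y _ _ hx hy =>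
      obtain ⟨s, rfl⟩ := hx
      obtain ⟨t, rfl⟩ := hy
      exact ⟨s + t, by rw [map_add]; rfl⟩
    | mul x y _ _ hx hy =>
      obtain ⟨s, rfl⟩ := hx
      obtain ⟨t, rfl⟩ := hy
      exact ⟨s * t, by rw [map_mul]; rfl⟩
  intro r
  obtain ⟨s, hs⟩ := h r r.2
  exact ⟨s, Subtype.ext hs⟩

/-- A chain of primes below P pulls back to a chain above the prime ker φ, and chains below ker φ
can be attached to it. Only this inequality is needed, so no catenarity enters. -/
theorem le_height_comap {S R : Type*} [CommRing S] [IsNoetherianRing S] [CommRing R]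
    [IsNoetherianRing R] [IsDomain R] {φ : S →+* R} (hφ : Function.Surjective φ) (a : ℕ)
    (P : Ideal R) [P.IsPrime] (ha : (a : ℕ∞) ≤ P.height) :
    a + (RingHom.ker φ).height ≤ (P.comap φ).height := by
  induction a generalizing P with
  | zero =>
    rw [Nat.cast_zero, zero_add]
    exact Ideal.height_mono (Ideal.comap_mono bot_le)
  | succ a ih =>
    have h : ¬ P.height ≤ a := fun h => by
      have := ha.trans h
      rw [Nat.cast_le] at this
      omega
    rw [Ideal.height_le_iff] at h
    push Not at h
    obtain ⟨Q, hQ, hQP, haQ⟩ := h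
    have hlt : Q.comap φ < P.comap φ :=
      lt_of_le_of_ne (Ideal.comap_mono hQP.le) fun h =>
        hQP.ne (Ideal.comap_injective_of_surjective φ hφ h)
    refine le_trans ?_ (Ideal.height_add_one_le_of_lt_of_isPrime hlt)
    rw [Nat.cast_add, Nat.cast_one, add_right_comm]
    gcongr
    exact ih Q haQ

/-- The homomorphism `S → T[t]` with `x_i ↦ x_i` and `y_j ↦ f_j t`. -/
noncomputable def toPolynomial : PolyS K m n →+* Polynomial (PolyT K m) :=
  (reesAlgebra (genIdeal f)).toSubring.subtype.comp (toRees f).toRingHom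

theorem toPolynomial_apply (s : PolyS K m n) :
    toPolynomial f s = (toRees f s : Polynomial (PolyT K m)) := rfl

theorem toPolynomial_rename (g : PolyT K m) :
    toPolynomial f (rename Sum.inl g) = Polynomial.C g := by
  rw [toPolynomial_apply, toRees_rename]; rfl

theorem toPolynomial_X_inr (j : Fin n) :
    toPolynomial f (X (Sum.inr j)) = Polynomial.monomial 1 (f j) := by
  rw [toPolynomial_apply, toRees_X_inr]; rfl

theorem ker_toPolynomial : RingHom.ker (toPolynomial f) = RingHom.ker (toRees f) := by
  ext s
  rw [RingHom.mem_ker, RingHom.mem_ker, toPolynomial_apply]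
  exact ⟨fun h => Subtype.ext h, fun h => by rw [h]; rfl⟩

theorem exists_ne_zero_of_genIdeal_ne_bot {f : Fin n → PolyT K m} (hI : genIdeal f ≠ ⊥) :
    ∃ j, f j ≠ 0 := by
  by_contra! h
  refine hI (Ideal.span_eq_bot.2 ?_)
  rintro _ ⟨j, rfl⟩
  exact h j

/-- Krull's height theorem: if f_{j₀} ≠ 0, the kernel is a minimal prime of the ideal generated by
the n - 1 elements f_{j₀} y_j - f_j y_{j₀}, j ≠ j₀. -/
theorem height_ker_toRees_le (hI : genIdeal f ≠ ⊥) :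
    (RingHom.ker (toRees f)).height ≤ (n - 1 : ℕ) := by
  classical
  obtain ⟨j₀, hj₀⟩ := exists_ne_zero_of_genIdeal_ne_bot hI
  set a : Fin n → PolyS K m n := fun j => rename Sum.inl (f j₀) * X (Sum.inr j) -
    rename Sum.inl (f j) * X (Sum.inr j₀) with ha
  have hcard : ((Finset.univ.erase j₀).image a).card ≤ n - 1 := by
    refine Finset.card_image_le.trans ?_
    rw [Finset.card_erase_of_mem (Finset.mem_univ _), Finset.card_univ, Fintype.card_fin]
  refine le_trans (Ideal.height_le_card_of_mem_minimalPrimes_span_finset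
    (s := (Finset.univ.erase j₀).image a) ?_) (Nat.cast_le.2 hcard)
  rw [← ker_toPolynomial]
  refine ⟨⟨RingHom.ker_isPrime _, ?_⟩, ?_⟩
  · rw [Ideal.span_le]
    intro x hx
    obtain ⟨j, -, rfl⟩ := Finset.mem_image.1 hx
    change toPolynomial f _ = 0
    rw [map_sub, map_mul, map_mul, toPolynomial_rename, toPolynomial_rename, toPolynomial_X_inr,
      toPolynomial_X_inr, Polynomial.C_mul_monomial, Polynomial.C_mul_monomial, mul_comm, sub_self]
  -- A prime Q inside the kernel that contains these elements does not contain f_{j₀}. Hence S →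
  -- Frac(S/Q) factors through T[t], with t ↦ y_{j₀} / f_{j₀}, and Q contains the whole kernel.
  · rintro Q ⟨hQ, haQ⟩ hQJ g hg
    have haQ' : ∀ j, a j ∈ Q := fun j => by
      by_cases h : j = j₀
      · rw [ha, h]; simp
      · exact haQ (Ideal.subset_span (Finset.mem_image_of_mem _ (by simpa using h)))
    let π : PolyS K m n →+* FractionRing (PolyS K m n ⧸ Q) :=
      (algebraMap _ _).comp (Ideal.Quotient.mk Q)
    have hπ : ∀ s, π s = 0 ↔ s ∈ Q := fun s => by
      rw [RingHom.comp_apply, FaithfulSMul.algebraMap_eq_zero_iff, Ideal.Quotient.eq_zero_iff_mem]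
    have hf₀ : π (rename Sum.inl (f j₀)) ≠ 0 := fun h => hj₀ <| by
      have := hQJ ((hπ _).1 h)
      rw [RingHom.mem_ker, toPolynomial_rename, Polynomial.C_eq_zero] at this
      exact this
    let χ : Polynomial (PolyT K m) →+* FractionRing (PolyS K m n ⧸ Q) :=
      Polynomial.eval₂RingHom (π.comp (rename Sum.inl).toRingHom)
        (π (X (Sum.inr j₀)) / π (rename Sum.inl (f j₀)))
    have hχ : π = χ.comp (toPolynomial f) := by
      refine MvPolynomial.ringHom_ext (fun c => ?_) fun v => ?_
      · change π _ = χ (toPolynomial f _)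
        rw [← rename_C Sum.inl, toPolynomial_rename]
        simp [χ]
      · change π _ = χ (toPolynomial f _)
        rcases v with i | j
        · rw [← rename_X (R := K) Sum.inl i, toPolynomial_rename]
          simp [χ]
        · rw [toPolynomial_X_inr]
          have := (hπ _).2 (haQ' j)
          rw [ha, map_sub, map_mul, map_mul, sub_eq_zero] at this
          simp only [χ, Polynomial.coe_eval₂RingHom, Polynomial.eval₂_monomial, pow_one]
          rw [← mul_div_assoc, eq_div_iff hf₀, mul_comm, this]
          rfl
    rw [← hπ, hχ, RingHom.comp_apply, hg, map_zero]

/-- The homomorphism `S → S[t]` with `x_i ↦ x_i`, `y_j ↦ f_j t` for `j ∈ B` and `y_j ↦ y_j`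
otherwise. -/
noncomputable def partialSubst (B : Finset (Fin n)) : PolyS K m n →ₐ[K] Polynomial (PolyS K m n) :=
  aeval (Sum.elim (fun i => Polynomial.C (X (Sum.inl i))) fun j =>
    if j ∈ B then Polynomial.monomial 1 (rename Sum.inl (f j)) else Polynomial.C (X (Sum.inr j)))

theorem partialSubst_rename (B : Finset (Fin n)) (g : PolyT K m) :
    partialSubst f B (rename Sum.inl g) = Polynomial.C (rename Sum.inl g) := by
  induction g using MvPolynomial.induction_on with
  | C a =>
    rw [rename_C, ← algebraMap_eq, AlgHom.commutes]
    rfl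
  | add p q hp hq => rw [map_add, map_add, hp, hq, map_add]
  | mul_X p i hp => rw [map_mul, map_mul, hp, rename_X, map_mul]; simp [partialSubst]

theorem partialSubst_X_inr (B : Finset (Fin n)) (j : Fin n) :
    partialSubst f B (X (Sum.inr j)) = if j ∈ B then Polynomial.monomial 1 (rename Sum.inl (f j))
      else Polynomial.C (X (Sum.inr j)) := by
  simp [partialSubst]

/-- The substitution for the larger set factors through the one for B: apply the substitution of y_j
to coefficients and fix t. The kernel grows because f_{j₀} y_j - f_j y_{j₀} dies only once y_j has
been substituted. -/
theorem ker_partialSubst_lt {B : Finset (Fin n)} {j₀ j : Fin n} (hj₀ : j₀ ∈ B) (hf : f j₀ ≠ 0)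
    (hj : j ∉ B) : RingHom.ker (partialSubst f B) < RingHom.ker (partialSubst f (insert j B)) := by
  classical
  have hcomp : ∀ s, partialSubst f (insert j B) s =
      Polynomial.eval₂RingHom (partialSubst f {j}).toRingHom Polynomial.X (partialSubst f B s) := by
    intro s
    have : ((partialSubst f (insert j B)).toRingHom : PolyS K m n →+* _) =
        (Polynomial.eval₂RingHom (partialSubst f {j}).toRingHom Polynomial.X).comp
          (partialSubst f B).toRingHom := by
      refine MvPolynomial.ringHom_ext (fun c => ?_) fun v => ?_
      · change partialSubst f _ _ = Polynomial.eval₂RingHom _ _ (partialSubst f B _)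
        rw [← rename_C Sum.inl, partialSubst_rename, partialSubst_rename]
        rw [Polynomial.coe_eval₂RingHom, Polynomial.eval₂_C]
        exact (partialSubst_rename f {j} _).symm
      · change partialSubst f _ _ = Polynomial.eval₂RingHom _ _ (partialSubst f B _)
        rcases v with i | l
        · rw [← rename_X (R := K) Sum.inl i, partialSubst_rename, partialSubst_rename]
          rw [Polynomial.coe_eval₂RingHom, Polynomial.eval₂_C]
          exact (partialSubst_rename f {j} _).symm
        · rw [partialSubst_X_inr, partialSubst_X_inr]
          by_cases hl : l ∈ B
          · simp only [hl, Finset.mem_insert, or_true, if_true, Polynomial.coe_eval₂RingHom,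
              Polynomial.eval₂_monomial, pow_one]
            change _ = partialSubst f {j} _ * _
            rw [partialSubst_rename, Polynomial.C_mul_X_eq_monomial]
          · simp only [hl, Finset.mem_insert, or_false, if_false, Polynomial.coe_eval₂RingHom,
              Polynomial.eval₂_C]
            change _ = partialSubst f {j} _
            rw [partialSubst_X_inr]
            simp
    exact RingHom.congr_fun this s
  refine lt_of_le_of_ne (fun s hs => ?_) fun h => ?_
  · rw [RingHom.mem_ker] at hs ⊢
    rw [hcomp, hs, map_zero]
  · have hmem : rename Sum.inl (f j₀) * X (Sum.inr j) - rename Sum.inl (f j) * X (Sum.inr j₀) ∈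
        RingHom.ker (partialSubst f (insert j B)) := by
      rw [RingHom.mem_ker, map_sub, map_mul, map_mul, partialSubst_rename, partialSubst_rename,
        partialSubst_X_inr, partialSubst_X_inr, if_pos (Finset.mem_insert_self _ _),
        if_pos (Finset.mem_insert_of_mem hj₀), Polynomial.C_mul_monomial, Polynomial.C_mul_monomial,
        mul_comm, sub_self]
    rw [← h, RingHom.mem_ker, map_sub, map_mul, map_mul, partialSubst_rename, partialSubst_rename,
      partialSubst_X_inr, partialSubst_X_inr, if_neg hj, if_pos hj₀] at hmem
    have h0 := congrArg (fun p => Polynomial.coeff p 0) hmem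
    simp only [Polynomial.coeff_sub, Polynomial.coeff_C_mul, Polynomial.coeff_C_zero,
      Polynomial.coeff_monomial, one_ne_zero, if_false, mul_zero, sub_zero,
      Polynomial.coeff_zero] at h0
    rcases mul_eq_zero.1 h0 with h0 | h0
    · exact hf ((map_eq_zero_iff _ (rename_injective _ Sum.inl_injective)).1 h0)
    · exact X_ne_zero _ h0

/-- Substituting the variables one at a time after y_{j₀} gives a strictly increasing chain of
primes. -/
theorem le_height_ker_partialSubst {j₀ : Fin n} (hf : f j₀ ≠ 0) (B : Finset (Fin n))
    (hB : j₀ ∉ B) : (B.card : ℕ∞) ≤ (RingHom.ker (partialSubst f (insert j₀ B))).height := by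
  induction B using Finset.induction_on with
  | empty => simp
  | insert j B hj ih =>
    rw [Finset.mem_insert, not_or] at hB
    have hj' : j ∉ insert j₀ B := by
      rw [Finset.mem_insert, not_or]; exact ⟨fun h => hB.1 h.symm, hj⟩
    have := ker_partialSubst_lt f (Finset.mem_insert_self j₀ B) hf hj'
    rw [Finset.insert_comm] at this
    have hp : (RingHom.ker (partialSubst f (insert j₀ B))).IsPrime := RingHom.ker_isPrime _
    have hp' : (RingHom.ker (partialSubst f (insert j₀ (insert j B)))).IsPrime :=
      RingHom.ker_isPrime _
    rw [Finset.card_insert_of_notMem hj, Nat.cast_add, Nat.cast_one]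
    exact (add_le_add_left (ih hB.2) 1).trans (Ideal.height_add_one_le_of_lt_of_isPrime this)

/-- Once every y_j is substituted, the image lies in T[t] ⊆ S[t]. -/
theorem ker_partialSubst_univ : RingHom.ker (partialSubst f Finset.univ) =
    RingHom.ker (toRees f) := by
  rw [← ker_toPolynomial]
  have h : ∀ s, partialSubst f Finset.univ s =
      Polynomial.map (rename (R := K) (Sum.inl : Fin m → Fin m ⊕ Fin n)).toRingHom
        (toPolynomial f s) := by
    intro s
    induction s using MvPolynomial.induction_on with
    | C a =>
      rw [← rename_C Sum.inl, partialSubst_rename, toPolynomial_rename]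
      simp
    | add p q hp hq => rw [map_add, map_add, hp, hq, Polynomial.map_add]
    | mul_X p v hp =>
      rw [map_mul, map_mul, hp, Polynomial.map_mul]
      congr 1
      rcases v with i | j
      · rw [← rename_X (R := K) Sum.inl i, partialSubst_rename, toPolynomial_rename]
        simp
      · rw [partialSubst_X_inr, toPolynomial_X_inr]
        simp
  ext s
  rw [RingHom.mem_ker, RingHom.mem_ker, h]
  exact Polynomial.map_eq_zero_iff (rename_injective _ Sum.inl_injective)

theorem height_ker_toRees (hI : genIdeal f ≠ ⊥) :
    (RingHom.ker (toRees f)).height = (n - 1 : ℕ) := by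
  classical
  refine le_antisymm (height_ker_toRees_le f hI) ?_
  obtain ⟨j₀, hj₀⟩ := exists_ne_zero_of_genIdeal_ne_bot hI
  have := le_height_ker_partialSubst f hj₀ (Finset.univ.erase j₀) (Finset.notMem_erase _ _)
  rwa [Finset.insert_erase (Finset.mem_univ _), ker_partialSubst_univ,
    Finset.card_erase_of_mem (Finset.mem_univ _), Finset.card_univ, Fintype.card_fin] at this

end GradedLC


/-! ### Cohen–Macaulay quotients and Ext at a prime. -/

namespace GradedLC

open CategoryTheory Abelian IsLocalRing RingTheory.Sequence Module

universe u

section CohenMacaulay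

variable {A B : Type u} [CommRing A] [IsLocalRing A] [CommRing B] [IsLocalRing B] [Algebra A B]

theorem mem_maximalIdeal_of_surjective (hAB : Function.Surjective (algebraMap A B)) {a : A} :
    algebraMap A B a ∈ maximalIdeal B ↔ a ∈ maximalIdeal A := by
  constructor
  · intro h ha
    exact h (ha.map _)
  · intro h
    refine (mem_maximalIdeal _).2 fun hu => ?_
    obtain ⟨b, hb⟩ := hu.exists_right_inv
    obtain ⟨c, rfl⟩ := hAB b
    rw [← map_mul] at hb
    have h1 : 1 - a * c ∈ RingHom.ker (algebraMap A B) := by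
      rw [RingHom.mem_ker, map_sub, hb, map_one, sub_self]
    have h2 := le_maximalIdeal (RingHom.ker_ne_top (algebraMap A B)) h1
    have h3 := (maximalIdeal A).add_mem h2 (Ideal.mul_mem_right c _ h)
    rw [sub_add_cancel] at h3
    exact (Ideal.ne_top_iff_one _).1 (maximalIdeal.isMaximal A).ne_top h3

/-- Each element of a regular sequence lowers the dimension by one, so the quotient has dimension 0
and every prime over the sequence is maximal. -/
theorem mem_radical_ofList_of_isRegular [IsNoetherianRing B] {rs : List B} (hreg : IsRegular B rs)
    (hdim : (rs.length : WithBot ℕ∞) = ringKrullDim B) {b : B} (hb : b ∈ maximalIdeal B) :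
    b ∈ (Ideal.ofList rs).radical := by
  have h0 := ringKrullDim_add_length_eq_ringKrullDim_of_isRegular rs hreg
  rw [← hdim] at h0
  have h1 : ringKrullDim (B ⧸ Ideal.ofList rs) = 0 := by
    generalize ringKrullDim (B ⧸ Ideal.ofList rs) = d at h0
    induction d with
    | bot => exact absurd h0 (by simp)
    | coe d =>
      have h2 : d + (rs.length : ℕ∞) = 0 + (rs.length : ℕ∞) := by rw [zero_add]; exact_mod_cast h0
      rw [ENat.add_left_injective_of_ne_top (ENat.natCast_ne_top _) h2]
      rfl
  have : Ring.KrullDimLE 0 (B ⧸ Ideal.ofList rs) := by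
    rw [Ring.krullDimLE_iff, h1]; rfl
  rw [Ideal.radical_eq_sInf, Ideal.mem_sInf]
  rintro Q ⟨hQ, hQp⟩
  have hmax : (Q.map (Ideal.Quotient.mk (Ideal.ofList rs))).IsMaximal := by
    have : (Q.map (Ideal.Quotient.mk (Ideal.ofList rs))).IsPrime :=
      Ideal.map_isPrime_of_surjective Ideal.Quotient.mk_surjective (by rwa [Ideal.mk_ker])
    exact Ideal.IsPrime.isMaximal' this
  have hQmax : Q.IsMaximal := by
    have := Ideal.comap_isMaximal_of_surjective (Ideal.Quotient.mk (Ideal.ofList rs))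
      Ideal.Quotient.mk_surjective (K := Q.map (Ideal.Quotient.mk (Ideal.ofList rs)))
    rwa [Ideal.comap_map_of_surjective' _ Ideal.Quotient.mk_surjective, Ideal.mk_ker,
      sup_eq_left.2 hQ] at this
  rwa [IsLocalRing.eq_maximalIdeal hQmax]

/-- A Cohen–Macaulay quotient of a regular local ring has `Ext` into that ring in one degree only. -/
theorem subsingleton_ext_of_isRegular [IsNoetherianRing A] [IsNoetherianRing B]
    (hAB : Function.Surjective (algebraMap A B)) {rs : List A}
    (hrs : Ideal.ofList rs = maximalIdeal A) (hreg : IsRegular A rs) {ys : List B}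
    (hys : IsRegular B ys) (hdim : (ys.length : WithBot ℕ∞) = ringKrullDim B) {q : ℕ}
    (hq : q + ys.length ≠ rs.length) :
    Subsingleton (Ext (ModuleCat.of A B) (ModuleCat.of A A) q) := by
  -- The maximal regular sequence of B is lifted to A, where it acts on B in the same way.
  obtain ⟨as, rfl⟩ := List.map_surjective_iff.2 hAB ys
  have hfin : Module.Finite A B := Module.Finite.of_surjective (Algebra.linearMap A B) hAB
  have hmem : ∀ a ∈ as, a ∈ maximalIdeal A := fun a ha => by
    rw [← mem_maximalIdeal_of_surjective hAB]
    refine le_maximalIdeal (J := Ideal.ofList (as.map (algebraMap A B))) ?_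
      (Ideal.subset_span (List.mem_map_of_mem ha))
    intro h
    have := hys.2
    rw [h] at this
    simp at this
  rw [List.length_map] at hq
  refine subsingleton_ext_of_isWeaklyRegular rs.length as hmem B
    ((isWeaklyRegular_map_algebraMap_iff B B as).1 hys.1) (fun q' hq' => ?_) q hq
  -- Every element of the maximal ideal has a power in the ideal of the sequence, so the quotient is
  -- supported at the closed point.
  refine subsingleton_ext_of_support_subset hrs hreg _ ?_ hq'
  rw [Module.support_eq_zeroLocus]
  intro P hP
  rw [PrimeSpectrum.mem_zeroLocus, SetLike.coe_subset_coe] at hP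
  refine PrimeSpectrum.ext (((maximalIdeal.isMaximal A).eq_of_le P.2.ne_top fun a ha => ?_).symm)
  obtain ⟨k, hk⟩ := mem_radical_ofList_of_isRegular hys hdim
    ((mem_maximalIdeal_of_surjective hAB).2 ha)
  refine P.2.mem_of_pow_mem k (hP ?_)
  rw [Module.mem_annihilator]
  intro x
  obtain ⟨x, rfl⟩ := Submodule.Quotient.mk_surjective _ x
  rw [← Submodule.Quotient.mk_smul, Submodule.Quotient.mk_eq_zero, Ideal.smul_top_eq_map,
    Algebra.smul_def, Submodule.restrictScalars_mem]
  rw [← map_pow, ← Ideal.map_ofList] at hk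
  exact Ideal.mul_mem_right _ _ hk

end CohenMacaulay

section Localization

variable {S R : Type u} [CommRing S] [CommRing R] [Algebra S R]

noncomputable abbrev localizationAlgebra (p : Ideal R) [p.IsPrime] :
    Algebra (Localization.AtPrime (p.comap (algebraMap S R))) (Localization.AtPrime p) :=
  (Localization.localRingHom (p.comap (algebraMap S R)) p (algebraMap S R) rfl).toAlgebra

/-- By surjectivity, the image in R of the complement of the contracted prime is exactly the
complement of p, so module and ring localization agree. -/
theorem exists_localizedModule_equiv (hS : Function.Surjective (algebraMap S R)) (p : Ideal R)
    [p.IsPrime] :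
    let := localizationAlgebra (S := S) p
    Nonempty (LocalizedModule (p.comap (algebraMap S R)).primeCompl R
      ≃ₗ[Localization.AtPrime (p.comap (algebraMap S R))] Localization.AtPrime p) := by
  let := localizationAlgebra (S := S) p
  have htower : IsScalarTower S (Localization.AtPrime (p.comap (algebraMap S R)))
      (Localization.AtPrime p) := IsScalarTower.of_algebraMap_eq fun s => by
    rw [IsScalarTower.algebraMap_apply S R (Localization.AtPrime p)]
    exact (Localization.localRingHom_to_map _ _ _ _ s).symm
  have hsub : Algebra.algebraMapSubmonoid R (p.comap (algebraMap S R)).primeCompl =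
      p.primeCompl := by
    ext r
    constructor
    · rintro ⟨s, hs, rfl⟩
      exact hs
    · intro hr
      obtain ⟨s, rfl⟩ := hS r
      exact ⟨s, hr, rfl⟩
  have hloc : IsLocalization (Algebra.algebraMapSubmonoid R (p.comap (algebraMap S R)).primeCompl)
      (Localization.AtPrime p) := by
    rw [hsub]; infer_instance
  exact ⟨(IsLocalizedModule.iso (p.comap (algebraMap S R)).primeCompl
    (IsScalarTower.toAlgHom S R (Localization.AtPrime p)).toLinearMap).extendScalarsOfIsLocalization
      (p.comap (algebraMap S R)).primeCompl _⟩

theorem localRingHom_surjective (hS : Function.Surjective (algebraMap S R)) (p : Ideal R)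
    [p.IsPrime] : Function.Surjective
      (Localization.localRingHom (p.comap (algebraMap S R)) p (algebraMap S R) rfl) :=
  (RingHom.surjectiveOnStalks_of_surjective hS).localRingHom_surjective _ _ _

theorem isRegular_localization_of_ofList_eq [IsNoetherianRing S] (P : Ideal S) [P.IsPrime]
    {rs : List S} (hrs : Ideal.ofList rs = P) (hreg : IsWeaklyRegular S rs) :
    IsRegular (Localization.AtPrime P) (rs.map (algebraMap S (Localization.AtPrime P))) ∧
      Ideal.ofList (rs.map (algebraMap S (Localization.AtPrime P))) =
        maximalIdeal (Localization.AtPrime P) := by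
  have h : Ideal.ofList (rs.map (algebraMap S (Localization.AtPrime P))) =
      maximalIdeal (Localization.AtPrime P) := by
    rw [← Ideal.map_ofList, hrs, Localization.AtPrime.map_eq_maximalIdeal]
  refine ⟨⟨IsWeaklyRegular.of_isLocalization _ P.primeCompl hreg, ?_⟩, h⟩
  rw [h, smul_eq_mul, Ideal.mul_top]
  exact (maximalIdeal.isMaximal _).ne_top.symm

theorem dualExact_localize_of_not_ker_le (X : FreeResolution S R) (P : Ideal S) [P.IsPrime] (hP : ¬ RingHom.ker (algebraMap S R) ≤ P)
    (q : ℕ) : (X.localize P.primeCompl).DualExact q := by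
  obtain ⟨s, hs, hsP⟩ := Set.not_subset.1 hP
  rw [FreeResolution.dualExact_iff]
  have hzero : Subsingleton (LocalizedModule P.primeCompl R) :=
    LocalizedModule.subsingleton_iff.2 fun r => ⟨s, hsP, by
      rw [Algebra.smul_def, (RingHom.mem_ker).1 hs, zero_mul]⟩
  refine subsingleton_of_forall_eq 0 fun x => ?_
  rw [← Ext.mk₀_id_comp x, show 𝟙 (ModuleCat.of (Localization P.primeCompl)
    (LocalizedModule P.primeCompl R)) = 0 from ?_, Ext.mk₀_zero, Ext.zero_comp]
  ext x
  exact Subsingleton.elim _ _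

variable [IsNoetherianRing S]

theorem dualExact_localize_of_isCohenMacaulayLocal [IsNoetherianRing R] (hS : Function.Surjective (algebraMap S R))
    (X : FreeResolution S R) (p : Ideal R) [p.IsPrime] {rs : List S}
    (hrs : Ideal.ofList rs = p.comap (algebraMap S R)) (hreg : IsWeaklyRegular S rs)
    {ys : List (Localization.AtPrime p)} (hys : IsRegular (Localization.AtPrime p) ys)
    (hdim : (ys.length : WithBot ℕ∞) = ringKrullDim (Localization.AtPrime p)) (q : ℕ)
    (hq : q + ys.length ≠ rs.length) :
    (X.localize (p.comap (algebraMap S R)).primeCompl).DualExact q := by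
  rw [FreeResolution.dualExact_iff]
  let := localizationAlgebra (S := S) p
  obtain ⟨e⟩ := exists_localizedModule_equiv hS p
  obtain ⟨h₁, h₂⟩ := isRegular_localization_of_ofList_eq _ hrs hreg
  have : IsNoetherianRing (Localization.AtPrime (p.comap (algebraMap S R))) :=
    IsLocalization.isNoetherianRing (p.comap (algebraMap S R)).primeCompl _ inferInstance
  have : IsNoetherianRing (Localization.AtPrime p) :=
    IsLocalization.isNoetherianRing p.primeCompl _ inferInstance
  exact subsingleton_ext_of_iso (LinearEquiv.toModuleIso e.symm) _ q
    (subsingleton_ext_of_isRegular (localRingHom_surjective hS p) h₂ h₁ hys hdim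
      (by rwa [List.length_map]))

/-- If the dual of a resolution of the domain `R` is exact at the generic point of `R` in all
degrees but `c`, then `c` is at most the height of the kernel of `S → R`. -/
theorem le_height_ker_of_dualExact [IsDomain R] (X : FreeResolution S R)
    (hS : Function.Surjective (algebraMap S R)) (c : ℕ)
    (hX : ∀ q < c, ∀ z, (X.mat q).transpose.mulVec z = 0 →
      ∃ s ∉ RingHom.ker (algebraMap S R), s • z ∈ X.coboundaries q) :
    (c : ℕ∞) ≤ (RingHom.ker (algebraMap S R)).height := by
  have hprime : (RingHom.ker (algebraMap S R)).IsPrime := RingHom.ker_isPrime _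
  set J := RingHom.ker (algebraMap S R)
  have : IsNoetherianRing (Localization.AtPrime J) :=
    IsLocalization.isNoetherianRing J.primeCompl _ inferInstance
  have hfin : Module.Finite (Localization J.primeCompl) (LocalizedModule J.primeCompl R) := by
    have : Module.Finite S R := Module.Finite.of_surjective (Algebra.linearMap S R) hS
    infer_instance
  -- At its generic point R becomes the residue field of S_J; only the annihilator is needed, to
  -- identify the support.
  have hann : annihilator (Localization J.primeCompl) (LocalizedModule J.primeCompl R) =
      maximalIdeal (Localization.AtPrime J) := by
    refine le_antisymm (le_maximalIdeal fun h => ?_) ?_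
    · have h1 : LocalizedModule.mk (1 : R) (1 : J.primeCompl) = 0 := by
        rw [← one_smul (Localization J.primeCompl) (LocalizedModule.mk (1 : R) (1 : J.primeCompl))]
        exact Module.mem_annihilator.1 ((Ideal.eq_top_iff_one _).1 h) _
      rw [← LocalizedModule.zero_mk 1, LocalizedModule.mk_eq] at h1
      obtain ⟨u, hu⟩ := h1
      refine u.2 (RingHom.mem_ker.2 ?_)
      simpa [Submonoid.smul_def, Algebra.smul_def] using hu
    · rw [← Localization.AtPrime.map_eq_maximalIdeal, Ideal.map_le_iff_le_comap]
      intro s hs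
      rw [Ideal.mem_comap, Module.mem_annihilator]
      intro x
      induction x using LocalizedModule.induction_on with
      | h r t =>
        rw [algebraMap_smul, LocalizedModule.smul'_mk, Algebra.smul_def, RingHom.mem_ker.1 hs,
          zero_mul, LocalizedModule.zero_mk]
  -- Vanishing of Ext below c yields a regular sequence of length c in the maximal ideal of S_J,
  -- whose dimension is the height of J.
  obtain ⟨rs, hlen, -, hreg⟩ := ModuleCat.exists_isRegular_of_exists_subsingleton_ext
    (maximalIdeal (Localization.AtPrime J)) c
    (ModuleCat.of (Localization.AtPrime J) (Localization.AtPrime J)) (by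
      rw [lt_top_iff_ne_top]
      change maximalIdeal _ • (⊤ : Submodule _ (Localization.AtPrime J)) ≠ ⊤
      rw [smul_eq_mul, Ideal.mul_top]
      exact (maximalIdeal.isMaximal _).ne_top)
    (ModuleCat.of (Localization.AtPrime J) (LocalizedModule J.primeCompl R))
    (by rw [Module.support_eq_zeroLocus]; exact congrArg _ (congrArg _ hann))
    (fun q hq => (FreeResolution.dualExact_iff _ q).1
      ((X.dualExact_localize_iff J.primeCompl q).2 (hX q hq)))
  have h0 := ringKrullDim_add_length_eq_ringKrullDim_of_isRegular rs hreg
  rw [IsLocalization.AtPrime.ringKrullDim_eq_height J (Localization.AtPrime J), hlen] at h0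
  have hne : Nontrivial (Localization.AtPrime J ⧸ Ideal.ofList rs) := by
    refine Ideal.Quotient.nontrivial_iff.2 fun h => ?_
    have := hreg.2
    rw [h, Submodule.top_smul] at this
    exact this rfl
  have h1 := ringKrullDim_nonneg_of_nontrivial (R := Localization.AtPrime J ⧸ Ideal.ofList rs)
  have h2 : (c : WithBot ℕ∞) ≤ J.height := by
    rw [← h0]
    exact le_add_of_nonneg_left h1
  exact_mod_cast h2

end Localization

end GradedLC


/-! ### The R_+-torsion of Ext^q(R, S) for q ≠ n - 1. -/

namespace GradedLC

open MvPolynomial RingTheory.Sequence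

universe u

section Torsion

variable {K : Type u} [Field K] {m n : ℕ} {f : Fin n → PolyT K m}

/-- `S → R` as an algebra structure. -/
noncomputable abbrev reesAlgebraInst (f : Fin n → PolyT K m) : Algebra (PolyS K m n) (Rees f) :=
  (toRees f).toRingHom.toAlgebra

instance isNoetherianRing_rees (f : Fin n → PolyT K m) : IsNoetherianRing (Rees f) :=
  isNoetherianRing_of_surjective (PolyS K m n) (Rees f) (toRees f).toRingHom (toRees_surjective f)

/-- The underlying ungraded resolution of the Rees algebra. -/
noncomputable def GradedFreeResolution.forget {d : Fin n → ℕ}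
    (F : GradedFreeResolution (gradingS K m d) (gradingRees f)) :
    FreeResolution (PolyS K m n) (ReesModule f) where
  rank := F.rank
  mat := F.mat
  gen := Fintype.linearCombination (PolyS K m n) F.gen
  gen_surjective := LinearMap.range_eq_top.1 F.gen_surjective
  exact_zero := F.exact_zero
  exact_succ := F.exact_succ

theorem height_le_of_isPrime (P : Ideal (PolyS K m n)) [hP : P.IsPrime] :
    P.height ≤ ((m + n : ℕ) : ℕ∞) := by
  have h := Ideal.height_le_ringKrullDim_of_ne_top hP.ne_top
  rw [MvPolynomial.ringKrullDim_of_isNoetherianRing, ringKrullDim_eq_zero_of_field, zero_add] at h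
  simp only [Nat.card_eq_fintype_card, Fintype.card_sum, Fintype.card_fin] at h
  exact_mod_cast h

theorem exists_smul_mem_coboundaries_of_isMaximal (hI : genIdeal f ≠ ⊥)
    (hCM : ∀ (p : Ideal (Rees f)) [p.IsPrime], p ≠ reesMaximal f →
      IsCohenMacaulayLocal (Localization.AtPrime p))
    {d : Fin n → ℕ} (F : GradedFreeResolution (gradingS K m d) (gradingRees f)) {q : ℕ}
    (hq : q ≠ n - 1) {b : Fin n} {z : DualTerm F q} (hz : z ∈ extCocycles F q)
    (P : Ideal (PolyS K m n)) [hP : P.IsMaximal] (hb : X (Sum.inr b) ∉ P) :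
    ∃ s ∉ P, s • z ∈ extCoboundaries F q := by
  let := reesAlgebraInst f
  have hS : Function.Surjective (algebraMap (PolyS K m n) (Rees f)) := toRees_surjective f
  let Y : FreeResolution (PolyS K m n) (Rees f) := F.forget
  have hcob : Y.coboundaries q = extCoboundaries F q := by cases q <;> rfl
  suffices h : (Y.localize P.primeCompl).DualExact q by
    obtain ⟨s, hs, h⟩ := (Y.dualExact_localize_iff P.primeCompl q).1 h z hz
    exact ⟨s, hs, hcob ▸ h⟩
  by_cases hker : RingHom.ker (algebraMap (PolyS K m n) (Rees f)) ≤ P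
  swap
  · exact dualExact_localize_of_not_ker_le Y P hker q
  obtain ⟨p, hp, rfl⟩ : ∃ p : Ideal (Rees f), p.IsPrime ∧
      p.comap (algebraMap (PolyS K m n) (Rees f)) = P :=
    ⟨P.map (algebraMap _ _), Ideal.map_isPrime_of_surjective hS hker, by
      rw [Ideal.comap_map_of_surjective' _ hS, sup_eq_left.2 hker]⟩
  -- The element f_b t lies in R_+ but not in p, so the Cohen–Macaulay hypothesis is available at p.
  have hpm : p ≠ reesMaximal f := by
    rintro rfl
    refine hb (Ideal.mem_comap.2 (Ideal.mem_sup_right ?_))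
    change toRees f (X (Sum.inr b)) ∈ _
    rw [toRees_X_inr, reesPlus, RingHom.mem_ker]
    simp [reesGen]
  obtain ⟨-, ys, -, hys, hdim⟩ := hCM p hpm
  obtain ⟨rs, hlen, hrs, hreg⟩ := exists_weaklyRegular_generators K (Fin m ⊕ Fin n) _ hP
  replace hlen : rs.length = m + n := by rw [hlen]; simp
  have hex := fun q hq => dualExact_localize_of_isCohenMacaulayLocal hS Y p hrs hreg hys hdim q hq
  -- Ext can be nonzero at P only in degree m + n - dim R_p. It remains to see that if this degree
  -- is q, then q = n - 1.
  refine hex q fun h => hq ?_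
  rw [IsLocalization.AtPrime.ringKrullDim_eq_height p (Localization.AtPrime p)] at hdim
  have hdim' : (ys.length : ℕ∞) = p.height := by exact_mod_cast hdim
  have hht : (RingHom.ker (algebraMap (PolyS K m n) (Rees f))).height = ((n - 1 : ℕ) : ℕ∞) :=
    height_ker_toRees f hI
  -- Lower bound: dim R_p + (n - 1) ≤ m + n, that is, q ≥ n - 1.
  have h1 := (le_height_comap hS ys.length p hdim'.le).trans (height_le_of_isPrime _)
  rw [hht] at h1
  -- Upper bound: below degree q the local Ext vanishes at P, hence also at the smaller prime ker(S
  -- → R), so q is at most the height of that kernel.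
  have h2 := le_height_ker_of_dualExact Y hS q fun q' hq' z hz => by
    obtain ⟨s, hs, h'⟩ := (Y.dualExact_localize_iff _ q').1 (hex q' (by omega)) z hz
    exact ⟨s, fun h' => hs (hker h'), h'⟩
  rw [hht] at h2
  replace h1 : ys.length + (n - 1) ≤ m + n := by exact_mod_cast h1
  replace h2 : q ≤ n - 1 := by exact_mod_cast h2
  omega

/-- Away from the degree of the canonical module, the cohomology of the dual of a resolution of the
Rees algebra is `R_+`-torsion. -/
theorem exists_pow_smul_mem_extCoboundaries (hI : genIdeal f ≠ ⊥)
    (hCM : ∀ (p : Ideal (Rees f)) [p.IsPrime], p ≠ reesMaximal f →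
      IsCohenMacaulayLocal (Localization.AtPrime p))
    {d : Fin n → ℕ} (F : GradedFreeResolution (gradingS K m d) (gradingRees f)) {q : ℕ}
    (hq : q ≠ n - 1) (b : Fin n) {z : DualTerm F q} (hz : z ∈ extCocycles F q) :
    ∃ t : ℕ, (X (Sum.inr b) : PolyS K m n) ^ t • z ∈ extCoboundaries F q := by
  let 𝔞 : Ideal (PolyS K m n) :=
    (extCoboundaries F q).comap (LinearMap.toSpanSingleton (PolyS K m n) _ z)
  suffices h : X (Sum.inr b) ∈ 𝔞.radical from h
  -- S is a Jacobson ring, so membership in the radical of the annihilator of the class can be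
  -- tested at maximal ideals.
  rw [Ideal.radical_eq_jacobson, Ideal.jacobson, Ideal.mem_sInf]
  rintro P ⟨hle, hP⟩
  by_contra hb
  obtain ⟨s, hs, h⟩ := exists_smul_mem_coboundaries_of_isMaximal hI hCM F hq hz P hb
  exact hs (hle h)

end Torsion

end GradedLC


/-! ### Linear relations, and zigzags in a double complex. -/

namespace GradedLC

section Correspondence

variable {K E₁ E₂ E₃ : Type*} [Field K] [AddCommGroup E₁] [AddCommGroup E₂] [AddCommGroup E₃]
  [Module K E₁] [Module K E₂] [Module K E₃]

/-- A linear relation `Γ` between `A` and `B` that induces an isomorphism `A / A₀ ≃ B / B₀`. -/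
structure IsCorrespondence (Γ : Submodule K (E₁ × E₂)) (A A₀ : Submodule K E₁)
    (B B₀ : Submodule K E₂) : Prop where
  left_mem : ∀ {a b}, (a, b) ∈ Γ → a ∈ A
  right_mem : ∀ {a b}, (a, b) ∈ Γ → b ∈ B
  exists_right : ∀ a ∈ A, ∃ b, (a, b) ∈ Γ
  exists_left : ∀ b ∈ B, ∃ a, (a, b) ∈ Γ
  mem_iff : ∀ {a b}, (a, b) ∈ Γ → (a ∈ A₀ ↔ b ∈ B₀)

/-- The composition of two linear relations. -/
def relComp (Γ : Submodule K (E₁ × E₂)) (Δ : Submodule K (E₂ × E₃)) :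
    Submodule K (E₁ × E₃) where
  carrier := {x | ∃ b, (x.1, b) ∈ Γ ∧ (b, x.2) ∈ Δ}
  zero_mem' := ⟨0, Γ.zero_mem, Δ.zero_mem⟩
  add_mem' := fun ⟨b, h, h'⟩ ⟨c, k, k'⟩ => ⟨b + c, Γ.add_mem h k, Δ.add_mem h' k'⟩
  smul_mem' := fun r _ ⟨b, h, h'⟩ => ⟨r • b, Γ.smul_mem r h, Δ.smul_mem r h'⟩

theorem IsCorrespondence.comp {Γ : Submodule K (E₁ × E₂)} {Δ : Submodule K (E₂ × E₃)}
    {A A₀ : Submodule K E₁} {B B₀ : Submodule K E₂} {C C₀ : Submodule K E₃}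
    (h : IsCorrespondence Γ A A₀ B B₀) (h' : IsCorrespondence Δ B B₀ C C₀) :
    IsCorrespondence (relComp Γ Δ) A A₀ C C₀ where
  left_mem := fun ⟨_, hb, _⟩ => h.left_mem hb
  right_mem := fun ⟨_, _, hb⟩ => h'.right_mem hb
  exists_right := fun a ha => by
    obtain ⟨b, hb⟩ := h.exists_right a ha
    obtain ⟨c, hc⟩ := h'.exists_right b (h.right_mem hb)
    exact ⟨c, b, hb, hc⟩
  exists_left := fun c hc => by
    obtain ⟨b, hb⟩ := h'.exists_left c hc
    obtain ⟨a, ha⟩ := h.exists_left b (h'.left_mem hb)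
    exact ⟨a, b, ha, hb⟩
  mem_iff := fun ⟨_, hb, hb'⟩ => (h.mem_iff hb).trans (h'.mem_iff hb')

end Correspondence

/-- A double complex, as a bigraded family of subspaces of one vector space with a horizontal and
a vertical differential. -/
structure DoubleComplex (K E : Type*) [Field K] [AddCommGroup E] [Module K E] where
  X : ℤ → ℤ → Submodule K E
  h : E →ₗ[K] E
  v : E →ₗ[K] E
  h_h : ∀ a, h (h a) = 0
  v_v : ∀ a, v (v a) = 0
  h_v : ∀ a, h (v a) = v (h a)
  h_mem : ∀ {p q a}, a ∈ X p q → h a ∈ X (p + 1) q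
  v_mem : ∀ {p q a}, a ∈ X p q → v a ∈ X p (q + 1)

namespace DoubleComplex

variable {K E : Type*} [Field K] [AddCommGroup E] [Module K E] (D : DoubleComplex K E)

/-- The elements of bidegree `(p, q)` that are vertical cocycles modulo horizontal coboundaries. -/
def cocycles (p q : ℤ) : Submodule K E :=
  D.X p q ⊓ ((D.X (p - 1) (q + 1)).map D.h).comap D.v

/-- The sums of a horizontal and a vertical coboundary of bidegree `(p, q)`. -/
def coboundaries (p q : ℤ) : Submodule K E :=
  (D.X (p - 1) q).map D.h ⊔ (D.X p (q - 1)).map D.v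

/-- The vertical cocycles that represent horizontal cocycles of vertical cohomology. -/
def colCocycles (p q : ℤ) : Submodule K E :=
  (D.X p q ⊓ LinearMap.ker D.v) ⊓ ((D.X (p + 1) (q - 1)).map D.v).comap D.h

/-- The vertical cocycles that represent horizontal coboundaries of vertical cohomology. -/
def colCoboundaries (p q : ℤ) : Submodule K E :=
  (D.X (p - 1) q ⊓ LinearMap.ker D.v).map D.h ⊔ (D.X p (q - 1)).map D.v

variable {D}

theorem mem_coboundaries {p q : ℤ} {a : E} : a ∈ D.coboundaries p q ↔
    ∃ u ∈ D.X (p - 1) q, ∃ w ∈ D.X p (q - 1), D.h u + D.v w = a := by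
  simp only [coboundaries, Submodule.mem_sup, Submodule.mem_map, exists_exists_and_eq_and]

theorem mem_colCoboundaries {p q : ℤ} {a : E} : a ∈ D.colCoboundaries p q ↔
    ∃ u ∈ D.X (p - 1) q, D.v u = 0 ∧ ∃ w ∈ D.X p (q - 1), D.h u + D.v w = a := by
  simp only [colCoboundaries, Submodule.mem_sup, Submodule.mem_map, Submodule.mem_inf,
    LinearMap.mem_ker, exists_exists_and_eq_and, and_assoc]
  exact ⟨fun ⟨_, ⟨u, hu, hu', rfl⟩, h⟩ => ⟨u, hu, hu', h⟩,
    fun ⟨u, hu, hu', h⟩ => ⟨_, ⟨u, hu, hu', rfl⟩, h⟩⟩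

theorem h_mem' {p q : ℤ} {a : E} (ha : a ∈ D.X (p - 1) q) : D.h a ∈ D.X p q := by
  simpa using D.h_mem ha

theorem v_mem' {p q : ℤ} {a : E} (ha : a ∈ D.X p (q - 1)) : D.v a ∈ D.X p q := by
  simpa using D.v_mem ha

theorem coboundaries_le_cocycles (D : DoubleComplex K E) (p q : ℤ) :
    D.coboundaries p q ≤ D.cocycles p q := by
  intro a ha
  obtain ⟨u, hu, w, hw, rfl⟩ := mem_coboundaries.1 ha
  exact ⟨add_mem (h_mem' hu) (v_mem' hw), D.v u, D.v_mem hu, by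
    rw [map_add, D.v_v, add_zero, D.h_v]⟩

variable (D) in
/-- The relation `v a = h b` between bidegree `(p, q)` and bidegree `(p - 1, q + 1)`. -/
def step (p q : ℤ) : Submodule K (E × E) :=
  (D.X p q).prod (D.X (p - 1) (q + 1)) ⊓
    LinearMap.eqLocus (D.v ∘ₗ LinearMap.fst K E E) (D.h ∘ₗ LinearMap.snd K E E)

theorem mem_step {p q : ℤ} {a b : E} : (a, b) ∈ D.step p q ↔
    (a ∈ D.X p q ∧ b ∈ D.X (p - 1) (q + 1)) ∧ D.v a = D.h b := Iff.rfl

variable (D) in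
/-- The rows are exact at all places before the last one. -/
def RowExact (N : ℤ) : Prop :=
  ∀ {p q : ℤ} {a : E}, p < N → a ∈ D.X p q → D.h a = 0 → ∃ b ∈ D.X (p - 1) q, D.h b = a

variable (D) in
/-- The columns are exact in degree `q`. -/
def ColExact (q : ℤ) : Prop :=
  ∀ {p : ℤ} {a : E}, a ∈ D.X p q → D.v a = 0 → ∃ b ∈ D.X p (q - 1), D.v b = a

/-- A diagram chase. Exactness of the columns in degree q + 1 produces a from b, and in degree q it
absorbs the ambiguity of a; exactness of the rows before N shows that b is a cocycle and absorbs the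
ambiguity of b. -/
theorem step_isCorrespondence {N p q : ℤ} (hrow : D.RowExact N) (hp : p ≤ N)
    (hq : D.ColExact q) (hq' : D.ColExact (q + 1)) :
    IsCorrespondence (D.step p q) (D.cocycles p q) (D.coboundaries p q)
      (D.cocycles (p - 1) (q + 1)) (D.coboundaries (p - 1) (q + 1)) where
  left_mem := fun ⟨⟨ha, hb⟩, hab⟩ => ⟨ha, _, hb, hab.symm⟩
  right_mem := fun {a b} ⟨⟨_, hb⟩, hab⟩ => by
    obtain ⟨e, he, hbe⟩ := hrow (by omega) (D.v_mem hb) (by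
      rw [D.h_v]
      exact (congrArg D.v hab.symm).trans (D.v_v a))
    exact ⟨hb, e, he, hbe⟩
  exists_right := fun a ⟨ha, b, hb, hab⟩ => ⟨b, ⟨ha, hb⟩, hab.symm⟩
  exists_left := fun b ⟨hb, e, _, hbe⟩ => by
    obtain ⟨a, ha, hab⟩ := hq' (h_mem' hb) (by rw [← D.h_v, ← hbe, D.h_h])
    rw [add_sub_cancel_right] at ha
    exact ⟨a, ⟨ha, hb⟩, hab⟩
  mem_iff := fun {a b} hab => by
    obtain ⟨⟨ha, hb⟩, hab⟩ := mem_step.1 hab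
    rw [mem_coboundaries, mem_coboundaries, add_sub_cancel_right]
    constructor
    · rintro ⟨u, hu, w, hw, rfl⟩
      obtain ⟨e, he, hbe⟩ := hrow (p := p - 1) (a := b - D.v u) (by omega)
        (sub_mem hb (D.v_mem hu)) (by
          rw [map_sub, ← hab, map_add, D.v_v, D.h_v, add_zero, sub_self])
      exact ⟨e, he, u, hu, by rw [hbe, sub_add_cancel]⟩
    · rintro ⟨u, hu, w, hw, rfl⟩
      obtain ⟨e, he, hbe⟩ := hq (p := p) (a := a - D.h w) (sub_mem ha (h_mem' hw)) (by
          rw [map_sub, hab, map_add, D.h_h, D.h_v, zero_add, sub_self])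
      exact ⟨w, hw, e, he, by rw [hbe, add_sub_cancel]⟩

variable (D) in
/-- A horizontal coboundary of bidegree `(p + 1, q)` that is a vertical cocycle comes from a
vertical cocycle. -/
def LiftsCocycles (p q : ℤ) : Prop :=
  ∀ b ∈ D.X p q, D.h (D.v b) = 0 → ∃ b' ∈ D.X p q, D.h b' = D.h b ∧ D.v b' = 0

variable (D) in
/-- The relation `v a = h b`, `v b = 0`. -/
def lastStep (p q : ℤ) : Submodule K (E × E) :=
  D.step p q ⊓ (⊤ : Submodule K E).prod (LinearMap.ker D.v)

theorem mem_lastStep {p q : ℤ} {a b : E} : (a, b) ∈ D.lastStep p q ↔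
    ((a ∈ D.X p q ∧ b ∈ D.X (p - 1) (q + 1)) ∧ D.v a = D.h b) ∧ D.v b = 0 :=
  ⟨fun h => ⟨h.1, h.2.2⟩, fun h => ⟨h.1, trivial, h.2⟩⟩

/-- The zigzag ends in the row q + 1, whose columns need not be exact. Lifting of cocycles replaces
that exactness: b can be chosen as a vertical cocycle, so the target is horizontal cohomology of
vertical cohomology, the E₂ term of the spectral sequence. -/
theorem lastStep_isCorrespondence {N p q : ℤ} (hrow : D.RowExact N) (hp : p ≤ N)
    (hq : D.ColExact q) (h₁ : D.LiftsCocycles (p - 1) (q + 1))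
    (h₂ : D.LiftsCocycles (p - 1 - 1) (q + 1)) :
    IsCorrespondence (D.lastStep p q) (D.cocycles p q) (D.coboundaries p q)
      (D.colCocycles (p - 1) (q + 1)) (D.colCoboundaries (p - 1) (q + 1)) where
  left_mem := fun h => ⟨h.1.1.1, _, h.1.1.2, h.1.2.symm⟩
  right_mem := fun {a b} h => by
    obtain ⟨⟨⟨ha, hb⟩, hab⟩, hb'⟩ := mem_lastStep.1 h
    refine ⟨⟨hb, hb'⟩, a, ?_, hab⟩
    rwa [sub_add_cancel, add_sub_cancel_right]
  exists_right := fun a ⟨ha, b, hb, hab⟩ => by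
    obtain ⟨b', hb', hh, hv⟩ := h₁ b hb (by rw [D.h_v, hab, D.v_v])
    exact ⟨b', mem_lastStep.2 ⟨⟨⟨ha, hb'⟩, by rw [hh, hab]⟩, hv⟩⟩
  exists_left := fun b ⟨⟨hb, hvb⟩, a, ha, hab⟩ => by
    rw [sub_add_cancel, add_sub_cancel_right] at ha
    exact ⟨a, mem_lastStep.2 ⟨⟨⟨ha, hb⟩, hab⟩, hvb⟩⟩
  mem_iff := fun {a b} hab => by
    obtain ⟨⟨⟨ha, hb⟩, hab⟩, hvb⟩ := mem_lastStep.1 hab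
    rw [mem_coboundaries, mem_colCoboundaries, add_sub_cancel_right]
    constructor
    · rintro ⟨u, hu, w, hw, rfl⟩
      obtain ⟨e, he, hbe⟩ := hrow (p := p - 1) (a := b - D.v u) (by omega)
        (sub_mem hb (D.v_mem hu)) (by
          rw [map_sub, ← hab, map_add, D.v_v, D.h_v, add_zero, sub_self])
      obtain ⟨e', he', hh, hv⟩ := h₂ e he (by
        rw [D.h_v, hbe, map_sub, hvb, D.v_v, sub_zero])
      exact ⟨e', he', hv, u, hu, by rw [hh, hbe, sub_add_cancel]⟩
    · rintro ⟨u, hu, -, w, hw, rfl⟩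
      obtain ⟨e, he, hbe⟩ := hq (p := p) (a := a - D.h w) (sub_mem ha (h_mem' hw)) (by
          rw [map_sub, hab, map_add, D.h_h, D.h_v, zero_add, sub_self])
      exact ⟨w, hw, e, he, by rw [hbe, add_sub_cancel]⟩

variable (D) in
/-- The relation `a - b ∈ h (X (p - 1) q)`, `v b = 0`, for elements `a`, `b` of bidegree
`(p, q)`. -/
def edgeStep (p q : ℤ) : Submodule K (E × E) :=
  ((D.X p q).prod (D.X p q ⊓ LinearMap.ker D.v)) ⊓
    ((D.X (p - 1) q).map D.h).comap (LinearMap.fst K E E - LinearMap.snd K E E)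

theorem mem_edgeStep {p q : ℤ} {a b : E} : (a, b) ∈ D.edgeStep p q ↔
    (a ∈ D.X p q ∧ b ∈ D.X p q ∧ D.v b = 0) ∧ ∃ g ∈ D.X (p - 1) q, D.h g = a - b := Iff.rfl

theorem exists_sub_mem_ker {p q : ℤ} (hq : D.ColExact (q + 1))
    (h : D.LiftsCocycles (p - 1) (q + 1)) {a : E} (ha : a ∈ D.cocycles p q) :
    ∃ g ∈ D.X (p - 1) q, D.v (a - D.h g) = 0 := by
  obtain ⟨ha, e, he, hae⟩ := ha
  obtain ⟨e', he', hh, hv⟩ := h e he (by rw [D.h_v, hae, D.v_v])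
  obtain ⟨g, hg, hge⟩ := hq he' hv
  rw [add_sub_cancel_right] at hg
  exact ⟨g, hg, by rw [map_sub, ← D.h_v, hge, hh, hae, sub_self]⟩

/-- The zigzag of length zero, for the exceptional row meeting the last column itself: subtracting a
horizontal coboundary turns a into a vertical cocycle. -/
theorem edgeStep_isCorrespondence {p q : ℤ} (hbot : D.X (p + 1) q = ⊥)
    (hq : D.ColExact (q + 1)) (h₁ : D.LiftsCocycles (p - 1) (q + 1))
    (h₂ : D.LiftsCocycles (p - 1) q) :
    IsCorrespondence (D.edgeStep p q) (D.cocycles p q) (D.coboundaries p q)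
      (D.colCocycles p q) (D.colCoboundaries p q) where
  left_mem := fun {a b} h => by
    obtain ⟨⟨ha, hb, hvb⟩, g, hg, hgab⟩ := mem_edgeStep.1 h
    refine ⟨ha, D.v g, D.v_mem hg, ?_⟩
    rw [D.h_v, hgab, map_sub, hvb, sub_zero]
  right_mem := fun {a b} h => by
    obtain ⟨⟨ha, hb, hvb⟩, g, hg, hgab⟩ := mem_edgeStep.1 h
    have : D.h b = 0 := by simpa [hbot] using D.h_mem hb
    exact ⟨⟨hb, hvb⟩, 0, zero_mem _, by rw [this, map_zero]⟩
  exists_right := fun a ha => by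
    obtain ⟨g, hg, hv⟩ := exists_sub_mem_ker hq h₁ ha
    exact ⟨a - D.h g, mem_edgeStep.2 ⟨⟨ha.1, sub_mem ha.1 (h_mem' hg), hv⟩, g, hg,
      (sub_sub_cancel _ _).symm⟩⟩
  exists_left := fun b ⟨⟨hb, hvb⟩, _⟩ =>
    ⟨b, mem_edgeStep.2 ⟨⟨hb, hb, hvb⟩, 0, zero_mem _, by rw [map_zero, sub_self]⟩⟩
  mem_iff := fun {a b} hab => by
    obtain ⟨⟨ha, hb, hvb⟩, g, hg, hgab⟩ := mem_edgeStep.1 hab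
    rw [mem_coboundaries, mem_colCoboundaries]
    constructor
    · rintro ⟨u, hu, w, hw, rfl⟩
      have hb' : D.h (u - g) + D.v w = b := by rw [map_sub, hgab]; abel
      obtain ⟨e, he, hh, hv⟩ := h₂ (u - g) (sub_mem hu hg) (by
        rw [D.h_v, eq_sub_of_add_eq hb', map_sub, hvb, D.v_v, sub_zero])
      exact ⟨e, he, hv, w, hw, by rw [hh, hb']⟩
    · rintro ⟨u, hu, -, w, hw, rfl⟩
      exact ⟨u + g, add_mem hu hg, w, hw, by rw [map_add, hgab]; abel⟩

theorem cocycles_eq_coboundaries {p q : ℤ} (hq : D.ColExact q) (hq' : D.ColExact (q + 1))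
    (h : D.LiftsCocycles (p - 1) (q + 1)) :
    D.cocycles p q = D.coboundaries p q := by
  refine le_antisymm (fun a ha => ?_) (D.coboundaries_le_cocycles p q)
  · obtain ⟨g, hg, hv⟩ := exists_sub_mem_ker hq' h ha
    obtain ⟨w, hw, hwa⟩ := hq (sub_mem ha.1 (h_mem' hg)) hv
    exact mem_coboundaries.2 ⟨g, hg, w, hw, by rw [hwa, add_sub_cancel]⟩

variable (D) in
/-- The relation between bidegrees `(p, q)` and `(p - t, q + t)` given by zigzags. -/
def zigzag (p q : ℤ) : ℕ → Submodule K (E × E)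
  | 0 => (D.cocycles p q).prod (D.cocycles p q) ⊓
      LinearMap.eqLocus (LinearMap.fst K E E) (LinearMap.snd K E E)
  | t + 1 => relComp (zigzag p q t) (D.step (p - t) (q + t))

theorem zigzag_isCorrespondence {N p q : ℤ} (hrow : D.RowExact N) (hp : p ≤ N) (t : ℕ)
    (hcol : ∀ q', q ≤ q' → q' ≤ q + t → D.ColExact q') :
    IsCorrespondence (D.zigzag p q t) (D.cocycles p q) (D.coboundaries p q)
      (D.cocycles (p - t) (q + t)) (D.coboundaries (p - t) (q + t)) := by
  induction t with
  | zero =>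
    rw [Nat.cast_zero, sub_zero, add_zero]
    refine ⟨fun h => h.1.1, fun h => h.1.2, fun a ha => ⟨a, ⟨ha, ha⟩, rfl⟩,
      fun a ha => ⟨a, ⟨ha, ha⟩, rfl⟩, fun {a b} h => ?_⟩
    rw [show a = b from h.2]
  | succ t ih =>
    have h := step_isCorrespondence (p := p - t) (q := q + t) hrow (by omega)
      (hcol _ (by omega) (by push_cast; omega)) (hcol _ (by omega) (by push_cast; omega))
    rw [sub_sub, add_assoc] at h
    push_cast
    exact (ih fun q' h₁ h₂ => hcol q' h₁ (by push_cast; omega)).comp h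

variable (D) in
/-- The relation between the last column and the vertical cohomology in degree `c`, in total
degree `N + q`. -/
def edge (N q : ℤ) : ℕ → Submodule K (E × E)
  | 0 => D.edgeStep N q
  | t + 1 => relComp (D.zigzag N q t) (D.lastStep (N - t) (q + t))

/-- The edge isomorphism from the cohomology of the cokernel complex of the last column to the E₂
term in the row q + t. Column exactness is required only in the rows met by the zigzag, as
boundedness is available only in a finite range of rows. -/
theorem edge_isCorrespondence {N q : ℤ} (hrow : D.RowExact N) (hbot : ∀ q, D.X (N + 1) q = ⊥)
    (t : ℕ) (hcol : ∀ q', q ≤ q' → q' ≤ q + t + 1 → q' ≠ q + t → D.ColExact q')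
    (hlift : ∀ p < N, D.LiftsCocycles p (q + t) ∧ D.LiftsCocycles p (q + t + 1)) :
    IsCorrespondence (D.edge N q t) (D.cocycles N q) (D.coboundaries N q)
      (D.colCocycles (N - t) (q + t)) (D.colCoboundaries (N - t) (q + t)) := by
  cases t with
  | zero =>
    rw [Nat.cast_zero, sub_zero, add_zero]
    refine edgeStep_isCorrespondence (hbot q) (hcol _ (by omega) (by simp) (by simp)) ?_ ?_
    · simpa using (hlift (N - 1) (by omega)).2
    · simpa using (hlift (N - 1) (by omega)).1
  | succ t =>
    have h := lastStep_isCorrespondence (p := N - t) (q := q + t) hrow (by omega)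
      (hcol _ (by omega) (by push_cast; omega) (by push_cast; omega))
      (by simpa [add_assoc] using (hlift (N - t - 1) (by omega)).1)
      (by simpa [add_assoc] using (hlift (N - t - 1 - 1) (by omega)).1)
    rw [sub_sub, add_assoc] at h
    push_cast
    exact (zigzag_isCorrespondence hrow le_rfl t
      fun q' h₁ h₂ => hcol q' h₁ (by push_cast; omega) (by push_cast; omega)).comp h

theorem liftsCocycles_of_eq_bot {p q : ℤ} (h : D.X p (q + 1) = ⊥) : D.LiftsCocycles p q :=
  fun b hb _ => ⟨b, hb, rfl, by simpa [h] using D.v_mem hb⟩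

/-- If the rows are exact and the columns are exact above degree `c`, cocycles lift as soon as the
total degree is small enough for the first column to vanish. -/
theorem liftsCocycles {N c Q : ℤ} (hrow : D.RowExact N)
    (hcol : ∀ q, c < q → q ≤ Q → D.ColExact q) (hbot : ∀ p ≤ 0, ∀ q ≤ Q, D.X p q = ⊥)
    {p q : ℤ} (hp : p < N) (hq : c ≤ q) (hQ : q ≤ Q) (hpQ : p + q ≤ Q) : D.LiftsCocycles p q := by
  obtain hp0 | hp0 := le_or_gt p 0
  · intro b hb _
    have : b = 0 := by simpa [hbot p hp0 q hQ] using hb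
    exact ⟨b, hb, rfl, by rw [this, map_zero]⟩
  lift p to ℕ using hp0.le
  induction p generalizing q with
  | zero => exact absurd hp0 (lt_irrefl _)
  | succ p ih =>
    intro b hb hvb
    obtain ⟨e, he, heb⟩ := hrow hp (D.v_mem hb) hvb
    -- The induction moves along an antidiagonal. The sum p + q is unchanged, so the rows stay below
    -- Q until the vanishing column is reached.
    have hlift : D.LiftsCocycles p (q + 1) := by
      obtain hp1 | hp1 := Nat.eq_zero_or_pos p
      · subst hp1
        intro b hb _
        have : b = 0 := by simpa [hbot 0 le_rfl (q + 1) (by push_cast at hpQ; omega)] using hb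
        exact ⟨b, hb, rfl, by rw [this, map_zero]⟩
      · exact ih (by push_cast at hp; omega) (by omega) (by push_cast at hpQ; omega)
          (by push_cast at hpQ; omega) (by omega)
    rw [Nat.cast_succ, add_sub_cancel_right] at he
    obtain ⟨e', he', hh, hv⟩ := hlift e he (by rw [D.h_v, heb, D.v_v])
    obtain ⟨g, hg, hge⟩ := hcol _ (by omega) (by push_cast at hpQ; omega) he' hv
    rw [add_sub_cancel_right] at hg
    refine ⟨b - D.h g, sub_mem hb ?_, ?_, ?_⟩
    · simpa using D.h_mem hg
    · rw [map_sub, D.h_h, sub_zero]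
    · rw [map_sub, ← D.h_v, hge, hh, heb, sub_self]

section Naturality

variable {D' : DoubleComplex K E} {θ : E →ₗ[K] E} (hh : ∀ a, D'.h (θ a) = θ (D.h a))
  (hv : ∀ a, D'.v (θ a) = θ (D.v a)) (hθ : ∀ {p q a}, a ∈ D.X p q → θ a ∈ D'.X p q)
include hh hv hθ

theorem map_mem_step {p q : ℤ} {a b : E} (h : (a, b) ∈ D.step p q) :
    (θ a, θ b) ∈ D'.step p q := by
  obtain ⟨⟨ha, hb⟩, hab⟩ := mem_step.1 h
  exact ⟨⟨hθ ha, hθ hb⟩, by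
    change D'.v (θ a) = D'.h (θ b)
    rw [hv, hh, hab]⟩

theorem map_mem_lastStep {p q : ℤ} {a b : E} (h : (a, b) ∈ D.lastStep p q) :
    (θ a, θ b) ∈ D'.lastStep p q :=
  ⟨map_mem_step hh hv hθ h.1, trivial, by
    change D'.v (θ b) = 0
    rw [hv, show D.v b = 0 from h.2.2, map_zero]⟩

theorem map_mem_edgeStep {p q : ℤ} {a b : E} (h : (a, b) ∈ D.edgeStep p q) :
    (θ a, θ b) ∈ D'.edgeStep p q := by
  obtain ⟨⟨ha, hb, hvb⟩, g, hg, hgab⟩ := mem_edgeStep.1 h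
  exact mem_edgeStep.2 ⟨⟨hθ ha, hθ hb, by rw [hv, hvb, map_zero]⟩, θ g, hθ hg, by
    rw [hh, hgab, map_sub]⟩

theorem map_mem_cocycles {p q : ℤ} {a : E} (h : a ∈ D.cocycles p q) : θ a ∈ D'.cocycles p q := by
  obtain ⟨ha, e, he, hae⟩ := h
  exact ⟨hθ ha, θ e, hθ he, by rw [hh, hv, hae]⟩

theorem map_mem_zigzag {p q : ℤ} {t : ℕ} {a b : E} (h : (a, b) ∈ D.zigzag p q t) :
    (θ a, θ b) ∈ D'.zigzag p q t := by
  induction t generalizing b with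
  | zero =>
    exact ⟨⟨map_mem_cocycles hh hv hθ h.1.1, map_mem_cocycles hh hv hθ h.1.2⟩,
      congrArg θ (show a = b from h.2)⟩
  | succ t ih =>
    obtain ⟨e, h₁, h₂⟩ := h
    exact ⟨θ e, ih h₁, map_mem_step hh hv hθ h₂⟩

/-- Naturality of the edge relation; it is used for multiplication by x_l, which maps the double
complex of one degree to that of another. -/
theorem map_mem_edge {N q : ℤ} {t : ℕ} {a b : E} (h : (a, b) ∈ D.edge N q t) :
    (θ a, θ b) ∈ D'.edge N q t := by
  cases t with
  | zero => exact map_mem_edgeStep hh hv hθ h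
  | succ t =>
    obtain ⟨e, h₁, h₂⟩ := h
    exact ⟨θ e, map_mem_zigzag hh hv hθ h₁, map_mem_lastStep hh hv hθ h₂⟩

end Naturality

end DoubleComplex

end GradedLC


/-! ### Duality between cohomologies through a perfect pairing. -/

namespace GradedLC

section Duality

variable {K E₁ E₂ H G : Type*} [Field K] [AddCommGroup E₁] [AddCommGroup E₂] [AddCommGroup H]
  [AddCommGroup G] [Module K E₁] [Module K E₂] [Module K H] [Module K G]

/-- A pairing that is perfect modulo `A₀`, `B₀` identifies a space in correspondence with `A / A₀`
with the dual of a space in correspondence with `B / B₀`. -/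
theorem exists_dual_equiv {Γ₁ : Submodule K (E₁ × H)} {Γ₂ : Submodule K (E₂ × G)}
    {A A₀ : Submodule K E₁} {B B₀ : Submodule K E₂} (h₁ : IsCorrespondence Γ₁ A A₀ ⊤ ⊥)
    (h₂ : IsCorrespondence Γ₂ B B₀ ⊤ ⊥) (β : E₁ →ₗ[K] E₂ →ₗ[K] K) (hB : B₀ ≤ B)
    (hleft : ∀ a ∈ A, (a ∈ A₀ ↔ ∀ b ∈ B, β a b = 0))
    (hright : ∀ a ∈ A, ∀ b ∈ B₀, β a b = 0)
    (hrep : ∀ l : E₂ →ₗ[K] K, (∀ b ∈ B₀, l b = 0) → ∃ a ∈ A, ∀ b ∈ B, β a b = l b) :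
    ∃ φ : H ≃ₗ[K] Module.Dual K G, ∀ {a h b g}, (a, h) ∈ Γ₁ → (b, g) ∈ Γ₂ →
      φ h g = β a b := by
  -- Arbitrary representatives suffice: `key` shows that the pairing does not depend on them, and
  -- this also gives bilinearity.
  choose α hα using fun h => h₁.exists_left h (Submodule.mem_top)
  choose γ hγ using fun g => h₂.exists_left g (Submodule.mem_top)
  have key : ∀ {a a' h b b' g}, (a, h) ∈ Γ₁ → (a', h) ∈ Γ₁ → (b, g) ∈ Γ₂ → (b', g) ∈ Γ₂ →
      β a b = β a' b' := by
    intro a a' h b b' g ha ha' hb hb'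
    have haa : (a - a', (0 : H)) ∈ Γ₁ := by simpa using Γ₁.sub_mem ha ha'
    have hbb : (b - b', (0 : G)) ∈ Γ₂ := by simpa using Γ₂.sub_mem hb hb'
    have e₁ := (hleft _ (h₁.left_mem haa)).1 ((h₁.mem_iff haa).2 (zero_mem _)) b (h₂.left_mem hb)
    have e₂ := hright a' (h₁.left_mem ha') _ ((h₂.mem_iff hbb).2 (zero_mem _))
    rw [map_sub, LinearMap.sub_apply, sub_eq_zero] at e₁
    rw [map_sub, sub_eq_zero] at e₂
    rw [e₁, e₂]
  let ψ : H →ₗ[K] Module.Dual K G := LinearMap.mk₂ K (fun h g => β (α h) (γ g))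
    (fun h h' g => by
      rw [← LinearMap.add_apply, ← map_add]
      exact key (hα _) (Γ₁.add_mem (hα h) (hα h')) (hγ g) (hγ g))
    (fun c h g => by
      rw [← LinearMap.smul_apply, ← map_smul]
      exact key (hα _) (Γ₁.smul_mem c (hα h)) (hγ g) (hγ g))
    (fun h g g' => by
      rw [← map_add]
      exact key (hα h) (hα h) (hγ _) (Γ₂.add_mem (hγ g) (hγ g')))
    (fun c h g => by
      rw [← map_smul]
      exact key (hα h) (hα h) (hγ _) (Γ₂.smul_mem c (hγ g)))
  have hψ : ∀ {a h b g}, (a, h) ∈ Γ₁ → (b, g) ∈ Γ₂ → ψ h g = β a b :=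
    fun ha hb => key (hα _) ha (hγ _) hb
  refine ⟨LinearEquiv.ofBijective ψ ⟨?_, ?_⟩, fun ha hb => hψ ha hb⟩
  · rw [← LinearMap.ker_eq_bot, LinearMap.ker_eq_bot']
    intro h hh
    refine (h₁.mem_iff (hα h)).1 ((hleft _ (h₁.left_mem (hα h))).2 fun b hb => ?_)
    obtain ⟨g, hg⟩ := h₂.exists_right b hb
    rw [← hψ (hα h) hg, hh, LinearMap.zero_apply]
  · intro l
    -- A functional on G is pulled back to B along the relation and then extended to E₂, where
    -- representability applies.
    choose δ hδ using fun b : B => h₂.exists_right b b.2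
    have huniq : ∀ {b g g'}, (b, g) ∈ Γ₂ → (b, g') ∈ Γ₂ → g = g' := by
      intro b g g' hg hg'
      have : ((0 : E₂), g - g') ∈ Γ₂ := by simpa using Γ₂.sub_mem hg hg'
      exact sub_eq_zero.1 ((h₂.mem_iff this).1 (zero_mem _))
    let l₀ : B →ₗ[K] K :=
      { toFun := fun b => l (δ b)
        map_add' := fun b b' => by
          rw [← map_add, huniq (hδ (b + b')) (Γ₂.add_mem (hδ b) (hδ b'))]
        map_smul' := fun c b => by
          rw [← map_smul, huniq (hδ (c • b)) (Γ₂.smul_mem c (hδ b))]; rfl }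
    obtain ⟨l₁, hl₁⟩ := l₀.exists_extend
    have hl : ∀ {b g}, (b, g) ∈ Γ₂ → l₁ b = l g := fun {b g} hb => by
      rw [← huniq (hδ ⟨b, h₂.left_mem hb⟩) hb]
      exact LinearMap.congr_fun hl₁ ⟨b, h₂.left_mem hb⟩
    obtain ⟨a, ha, hal⟩ := hrep l₁ fun b hb => by
      obtain ⟨g, hg⟩ := h₂.exists_right b (hB hb)
      rw [hl hg, (show g = 0 from (h₂.mem_iff hg).1 hb), map_zero]
    obtain ⟨h, hh⟩ := h₁.exists_right a ha
    refine ⟨h, LinearMap.ext fun g => ?_⟩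
    rw [hψ hh (hγ g), hal _ (h₂.left_mem (hγ g)), hl (hγ g)]

namespace DoubleComplex

variable {D₁ : DoubleComplex K E₁} {D₂ : DoubleComplex K E₂} {M N : ℤ}
  {β : ℤ → E₁ →ₗ[K] E₂ →ₗ[K] K}

variable (D₁ D₂ M N β) in
/-- A pairing between the last columns of two double complexes that is perfect modulo horizontal
coboundaries and for which the vertical differentials are adjoint. -/
structure IsPerfectPairing : Prop where
  h_left : ∀ q, ∀ u ∈ D₁.X (M - 1) (-q), ∀ w ∈ D₂.X N q, β q (D₁.h u) w = 0
  h_right : ∀ q, ∀ u ∈ D₁.X M (-q), ∀ w ∈ D₂.X (N - 1) q, β q u (D₂.h w) = 0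
  adjoint : ∀ q u w, β q (D₁.v u) w = β (q + 1) u (D₂.v w)
  nondegenerate : ∀ q, ∀ u ∈ D₁.X M (-q), (∀ w ∈ D₂.X N q, β q u w = 0) →
    ∃ u' ∈ D₁.X (M - 1) (-q), D₁.h u' = u
  representable : ∀ q, ∀ l : E₂ →ₗ[K] K, (∀ w ∈ D₂.X (N - 1) q, l (D₂.h w) = 0) →
    ∃ u ∈ D₁.X M (-q), ∀ w ∈ D₂.X N q, β q u w = l w

namespace IsPerfectPairing

variable (P : IsPerfectPairing D₁ D₂ M N β) (q : ℤ)
include P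

theorem eq_zero_of_mem_coboundaries_right {a : E₁} (ha : a ∈ D₁.cocycles M (-q)) {b : E₂}
    (hb : b ∈ D₂.coboundaries N q) : β q a b = 0 := by
  obtain ⟨w, hw, x, hx, rfl⟩ := mem_coboundaries.1 hb
  obtain ⟨ha, u, hu, hua⟩ := ha
  have h := P.adjoint (q - 1) a x
  rw [sub_add_cancel, ← hua, P.h_left (q - 1) u (by
    rwa [show -(q - 1) = -q + 1 by ring]) x hx] at h
  rw [map_add, P.h_right q a ha w hw, ← h, add_zero]

theorem eq_zero_of_mem_coboundaries_left {a : E₁} (ha : a ∈ D₁.coboundaries M (-q)) {b : E₂}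
    (hb : b ∈ D₂.cocycles N q) : β q a b = 0 := by
  obtain ⟨w, hw, x, hx, rfl⟩ := mem_coboundaries.1 ha
  obtain ⟨hb, u, hu, hub⟩ := hb
  rw [map_add, LinearMap.add_apply, P.h_left q w hw b hb, P.adjoint q x b, ← hub,
    P.h_right (q + 1) x (by rwa [show -(q + 1) = -q - 1 by ring]) u hu, add_zero]

/-- Dualizing over a field is exact. If a kills all cocycles, then b ↦ β(a, b) depends only on the
class of v b modulo horizontal coboundaries. The induced functional extends and is represented by
some u; then a - v u pairs to zero with the whole last column, so it is a horizontal coboundary. -/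
theorem mem_coboundaries_iff {a : E₁} (ha : a ∈ D₁.cocycles M (-q)) :
    a ∈ D₁.coboundaries M (-q) ↔ ∀ b ∈ D₂.cocycles N q, β q a b = 0 := by
  refine ⟨fun ha b hb => P.eq_zero_of_mem_coboundaries_left q ha hb, fun h => ?_⟩
  -- the functional `v b ↦ β a b` on `v (X N q) + h (X (N - 1) (q + 1))`
  let C : Submodule K E₂ := (D₂.X (N - 1) (q + 1)).map D₂.h
  let ρ : D₂.X N q →ₗ[K] E₂ ⧸ C := C.mkQ ∘ₗ D₂.v ∘ₗ (D₂.X N q).subtype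
  have hker : LinearMap.ker ρ ≤ LinearMap.ker (β q a ∘ₗ (D₂.X N q).subtype) := fun b hb =>
    h b ⟨b.2, (Submodule.Quotient.mk_eq_zero C).1 hb⟩
  obtain ⟨l, hl⟩ : ∃ l : E₂ ⧸ C →ₗ[K] K, l ∘ₗ ρ = β q a ∘ₗ (D₂.X N q).subtype := by
    obtain ⟨l, hl⟩ := ((LinearMap.ker ρ).liftQ _ hker ∘ₗ
      ρ.quotKerEquivRange.symm.toLinearMap).exists_extend
    refine ⟨l, LinearMap.ext fun b => ?_⟩
    have := LinearMap.congr_fun hl ⟨ρ b, b, rfl⟩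
    simp only [LinearMap.comp_apply, Submodule.subtype_apply, LinearEquiv.coe_coe] at this
    rw [LinearMap.comp_apply, this]
    have h' : ρ.quotKerEquivRange.symm ⟨ρ b, b, rfl⟩ = (LinearMap.ker ρ).mkQ b := by
      rw [LinearEquiv.symm_apply_eq]; rfl
    rw [h']
    rfl
  obtain ⟨u, hu, hul⟩ := P.representable (q + 1) (l ∘ₗ C.mkQ) fun w hw => by
    rw [LinearMap.comp_apply, Submodule.mkQ_apply, (Submodule.Quotient.mk_eq_zero C).2 ⟨w, hw, rfl⟩,
      map_zero]
  rw [show -(q + 1) = -q - 1 by ring] at hu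
  obtain ⟨w, hw, hwa⟩ := P.nondegenerate q (a - D₁.v u) (sub_mem ha.1 (v_mem' hu)) fun b hb => by
    rw [map_sub, LinearMap.sub_apply, P.adjoint, hul _ (D₂.v_mem hb), sub_eq_zero]
    exact (LinearMap.congr_fun hl ⟨b, hb⟩).symm
  exact mem_coboundaries.2 ⟨w, hw, u, hu, by rw [hwa, sub_add_cancel]⟩

/-- A representative u of l is automatically a cocycle: by adjointness v u pairs with b as l(v b) =
0, so nondegeneracy makes v u a horizontal coboundary. -/
theorem exists_representing (l : E₂ →ₗ[K] K) (hl : ∀ b ∈ D₂.coboundaries N q, l b = 0) :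
    ∃ a ∈ D₁.cocycles M (-q), ∀ b ∈ D₂.cocycles N q, β q a b = l b := by
  obtain ⟨u, hu, hul⟩ := P.representable q l fun w hw =>
    hl _ (mem_coboundaries.2 ⟨w, hw, 0, zero_mem _, by rw [map_zero, add_zero]⟩)
  refine ⟨u, ⟨hu, ?_⟩, fun b hb => hul b hb.1⟩
  have hvu : D₁.v u ∈ D₁.X M (-(q - 1)) := by
    rw [show -(q - 1) = -q + 1 by ring]; exact D₁.v_mem hu
  obtain ⟨w, hw, hwu⟩ := P.nondegenerate (q - 1) _ hvu fun b hb => by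
    rw [P.adjoint, sub_add_cancel, hul _ (v_mem' hb)]
    exact hl _ (mem_coboundaries.2 ⟨0, zero_mem _, b, hb, by rw [map_zero, zero_add]⟩)
  rw [show -(q - 1) = -q + 1 by ring] at hw
  exact ⟨w, hw, hwu⟩

theorem exists_dual_equiv {Γ₁ : Submodule K (E₁ × H)} {Γ₂ : Submodule K (E₂ × G)}
    (h₁ : IsCorrespondence Γ₁ (D₁.cocycles M (-q)) (D₁.coboundaries M (-q)) ⊤ ⊥)
    (h₂ : IsCorrespondence Γ₂ (D₂.cocycles N q) (D₂.coboundaries N q) ⊤ ⊥) :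
    ∃ φ : H ≃ₗ[K] Module.Dual K G, ∀ {a h b g}, (a, h) ∈ Γ₁ → (b, g) ∈ Γ₂ →
      φ h g = β q a b :=
  GradedLC.exists_dual_equiv h₁ h₂ (β q) (D₂.coboundaries_le_cocycles N q)
    (fun _ ha => P.mem_coboundaries_iff q ha)
    (fun _ ha _ hb => P.eq_zero_of_mem_coboundaries_right q ha hb) (P.exists_representing q)

end IsPerfectPairing

end DoubleComplex

end Duality

end GradedLC


/-! ### Laurent polynomials, their coefficients and weights. -/

namespace GradedLC

open MvPolynomial

noncomputable section

/-- The ring of Laurent polynomials in the variables `σ`. -/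
def Laurent (K σ : Type*) [Field K] : Type _ := AddMonoidAlgebra K (σ → ℤ)

namespace Laurent

variable {K σ : Type*} [Field K]

instance : CommRing (Laurent K σ) := inferInstanceAs (CommRing (AddMonoidAlgebra K (σ → ℤ)))

instance : Algebra K (Laurent K σ) := inferInstanceAs (Algebra K (AddMonoidAlgebra K (σ → ℤ)))

/-- The exponents of a monomial, as integers. -/
def expo : (σ →₀ ℕ) →+ (σ → ℤ) where
  toFun u v := u v
  map_zero' := rfl
  map_add' u u' := funext fun v => by simp

theorem expo_apply (u : σ →₀ ℕ) (v : σ) : expo u v = u v := rfl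

theorem expo_injective : Function.Injective (expo : (σ →₀ ℕ) → σ → ℤ) := fun u u' h =>
  Finsupp.ext fun v => by
    have := congrFun h v
    rwa [expo_apply, expo_apply, Nat.cast_inj] at this

/-- The inclusion of the polynomial ring. -/
def ofPoly : MvPolynomial σ K →ₐ[K] Laurent K σ :=
  AddMonoidAlgebra.mapDomainAlgHom K K expo

instance : Algebra (MvPolynomial σ K) (Laurent K σ) := (ofPoly : _ →ₐ[K] _).toRingHom.toAlgebra

instance : IsScalarTower K (MvPolynomial σ K) (Laurent K σ) :=
  IsScalarTower.of_algebraMap_eq fun r => ((ofPoly (K := K) (σ := σ)).commutes r).symm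

/-- The monomial with exponents `e`. -/
def single (e : σ → ℤ) (r : K) : Laurent K σ := AddMonoidAlgebra.single e r

/-- The coefficient of the monomial with exponents `e`. -/
def coef (e : σ → ℤ) : Laurent K σ →ₗ[K] K where
  toFun a := AddMonoidAlgebra.coeff (R := K) (M := σ → ℤ) a e
  map_add' _ _ := rfl
  map_smul' _ _ := rfl

@[ext]
theorem ext {a b : Laurent K σ} (h : ∀ e, coef e a = coef e b) : a = b :=
  AddMonoidAlgebra.ext (Finsupp.ext h)

theorem finite_support (a : Laurent K σ) : {e | coef e a ≠ 0}.Finite := by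
  refine (AddMonoidAlgebra.coeff (R := K) (M := σ → ℤ) a).support.finite_toSet.subset fun e he => ?_
  exact Finsupp.mem_support_iff.2 he

open Classical in
theorem coef_single (e f : σ → ℤ) (r : K) : coef e (single f r) = if f = e then r else 0 :=
  Finsupp.single_apply

theorem coef_mul (a b : Laurent K σ) (e : σ → ℤ) :
    coef e (a * b) = ∑ f ∈ a.finite_support.toFinset, coef f a * coef (e - f) b := by
  refine (AddMonoidAlgebra.coeff_mul_apply_left (R := K) (G := σ → ℤ) a b e).trans ?_
  have : (AddMonoidAlgebra.coeff (R := K) (M := σ → ℤ) a).support = a.finite_support.toFinset := by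
    ext f
    rw [Set.Finite.mem_toFinset, Finsupp.mem_support_iff]
    rfl
  rw [Finsupp.sum, this]
  refine Finset.sum_congr rfl fun f _ => ?_
  rw [sub_eq_neg_add]
  rfl

theorem exists_of_coef_mul_ne_zero {a b : Laurent K σ} {e : σ → ℤ} (h : coef e (a * b) ≠ 0) :
    ∃ f, coef f a ≠ 0 ∧ coef (e - f) b ≠ 0 := by
  rw [coef_mul] at h
  obtain ⟨f, hf, h⟩ := Finset.exists_ne_zero_of_sum_ne_zero h
  exact ⟨f, left_ne_zero_of_mul h, right_ne_zero_of_mul h⟩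

theorem coef_single_mul (e f : σ → ℤ) (r : K) (a : Laurent K σ) :
    coef e (single f r * a) = r * coef (e - f) a := by
  refine (AddMonoidAlgebra.coeff_single_mul_apply (R := K) (G := σ → ℤ) a r f e).trans ?_
  rw [sub_eq_neg_add]
  rfl

theorem algebraMap_monomial (u : σ →₀ ℕ) (r : K) :
    algebraMap (MvPolynomial σ K) (Laurent K σ) (monomial u r) = single (expo u) r :=
  AddMonoidAlgebra.mapDomain_single

theorem coef_algebraMap_expo (u : σ →₀ ℕ) (s : MvPolynomial σ K) :
    coef (expo u) (algebraMap (MvPolynomial σ K) (Laurent K σ) s) = s.coeff u :=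
  Finsupp.mapDomain_apply expo_injective _ _

theorem exists_expo_of_coef_ne_zero {e : σ → ℤ} {s : MvPolynomial σ K}
    (h : coef e (algebraMap (MvPolynomial σ K) (Laurent K σ) s) ≠ 0) :
    ∃ u, expo u = e ∧ s.coeff u ≠ 0 := by
  by_cases he : e ∈ Set.range (expo : (σ →₀ ℕ) → σ → ℤ)
  · obtain ⟨u, rfl⟩ := he
    rw [coef_algebraMap_expo] at h
    exact ⟨u, rfl, h⟩
  · exact absurd (Finsupp.mapDomain_of_notMem_range _ _ he) h

theorem algebraMap_injective :
    Function.Injective (algebraMap (MvPolynomial σ K) (Laurent K σ)) := fun s s' h =>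
  MvPolynomial.ext _ _ fun u => by rw [← coef_algebraMap_expo, h, coef_algebraMap_expo]

theorem coef_smul (s : MvPolynomial σ K) (a : Laurent K σ) (e : σ → ℤ) :
    coef e (s • a) = ∑ u ∈ s.support, s.coeff u * coef (e - expo u) a := by
  conv_lhs => rw [s.as_sum, Finset.sum_smul, map_sum]
  refine Finset.sum_congr rfl fun u _ => ?_
  rw [Algebra.smul_def, algebraMap_monomial, coef_single_mul]

theorem coef_monomial_smul (u : σ →₀ ℕ) (a : Laurent K σ) (e : σ → ℤ) :
    coef e ((monomial u (1 : K) : MvPolynomial σ K) • a) = coef (e - expo u) a := by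
  rw [Algebra.smul_def, algebraMap_monomial, coef_single_mul, one_mul]

theorem exists_of_coef_smul_ne_zero {s : MvPolynomial σ K} {a : Laurent K σ} {e : σ → ℤ}
    (h : coef e (s • a) ≠ 0) : ∃ u, s.coeff u ≠ 0 ∧ coef (e - expo u) a ≠ 0 := by
  rw [coef_smul] at h
  obtain ⟨u, hu, h⟩ := Finset.exists_ne_zero_of_sum_ne_zero h
  exact ⟨u, left_ne_zero_of_mul h, right_ne_zero_of_mul h⟩

theorem monomial_smul_injective (u : σ →₀ ℕ) : Function.Injective
    fun a : Laurent K σ => (monomial u (1 : K) : MvPolynomial σ K) • a := fun a b h => by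
  ext e
  have := congrArg (coef (e + expo u)) h
  simpa [coef_monomial_smul] using this

/-- Division by a monomial. -/
theorem monomial_smul_single_mul (u : σ →₀ ℕ) (a : Laurent K σ) :
    (monomial u (1 : K) : MvPolynomial σ K) • (single (-expo u) 1 * a) = a := by
  ext e
  rw [coef_monomial_smul, coef_single_mul, one_mul]
  congr 2
  abel

theorem exists_algebraMap_eq [Finite σ] (a : Laurent K σ) (ha : ∀ e, coef e a ≠ 0 → 0 ≤ e) :
    ∃ s, algebraMap (MvPolynomial σ K) (Laurent K σ) s = a := by
  have : Fintype σ := Fintype.ofFinite σ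
  let nat : (σ → ℤ) → σ →₀ ℕ := fun e => Finsupp.equivFunOnFinite.symm fun v => (e v).toNat
  have hnat : ∀ e, 0 ≤ e → expo (nat e) = e := fun e he => funext fun v => Int.toNat_of_nonneg (he v)
  refine ⟨∑ e ∈ a.finite_support.toFinset, monomial (nat e) (coef e a), ?_⟩
  rw [map_sum]
  ext f
  rw [map_sum]
  have : ∀ e ∈ a.finite_support.toFinset,
      coef f (algebraMap (MvPolynomial σ K) (Laurent K σ) (monomial (nat e) (coef e a))) =
        if e = f then coef e a else 0 := by
    intro e he
    rw [algebraMap_monomial, hnat e (ha e (by simpa using he)), coef_single]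
    split_ifs <;> rfl
  rw [Finset.sum_congr rfl this, Finset.sum_ite_eq']
  split_ifs with h
  · rfl
  · simpa [eq_comm] using h

open Classical in
/-- The part of a Laurent polynomial with exponents in `Q`. -/
def restrict (Q : Set (σ → ℤ)) : Laurent K σ →ₗ[K] Laurent K σ where
  toFun a := AddMonoidAlgebra.ofCoeff
    ((AddMonoidAlgebra.coeff (R := K) (M := σ → ℤ) a).filter (· ∈ Q))
  map_add' _ _ := congrArg AddMonoidAlgebra.ofCoeff Finsupp.filter_add
  map_smul' _ _ := congrArg AddMonoidAlgebra.ofCoeff Finsupp.filter_smul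

theorem coef_restrict_of_mem {Q : Set (σ → ℤ)} {e : σ → ℤ} (he : e ∈ Q) (a : Laurent K σ) :
    coef e (restrict Q a) = coef e a := by
  classical exact Finsupp.filter_apply_pos _ _ he

theorem coef_restrict_of_notMem {Q : Set (σ → ℤ)} {e : σ → ℤ} (he : e ∉ Q) (a : Laurent K σ) :
    coef e (restrict Q a) = 0 := by
  classical exact Finsupp.filter_apply_neg _ _ he

theorem of_coef_restrict_ne_zero {Q : Set (σ → ℤ)} {e : σ → ℤ} {a : Laurent K σ}
    (h : coef e (restrict Q a) ≠ 0) : e ∈ Q ∧ coef e a ≠ 0 := by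
  by_cases he : e ∈ Q
  · exact ⟨he, by rwa [coef_restrict_of_mem he] at h⟩
  · exact absurd (coef_restrict_of_notMem he a) h

theorem restrict_eq_self {Q : Set (σ → ℤ)} {a : Laurent K σ} (h : ∀ e, coef e a ≠ 0 → e ∈ Q) :
    restrict Q a = a := by
  ext e
  by_cases he : e ∈ Q
  · exact coef_restrict_of_mem he a
  · rw [coef_restrict_of_notMem he, eq_comm]
    by_contra h'
    exact he (h e h')

theorem restrict_smul {Q Q' : Set (σ → ℤ)} {s : MvPolynomial σ K}
    (h : ∀ u, s.coeff u ≠ 0 → ∀ e, e ∈ Q' ↔ e - expo u ∈ Q) (a : Laurent K σ) :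
    restrict Q' (s • a) = s • restrict Q a := by
  ext e
  by_cases he : e ∈ Q'
  · rw [coef_restrict_of_mem he, coef_smul, coef_smul]
    refine Finset.sum_congr rfl fun u hu => ?_
    rw [coef_restrict_of_mem ((h u (mem_support_iff.1 hu) e).1 he)]
  · rw [coef_restrict_of_notMem he, coef_smul, eq_comm]
    refine Finset.sum_eq_zero fun u hu => ?_
    rw [coef_restrict_of_notMem fun h' => he ((h u (mem_support_iff.1 hu) e).2 h'), mul_zero]

section Weight

variable [Fintype σ] {Γ : Type*} [AddCommGroup Γ] (w : σ → Γ)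

/-- The degree of a Laurent monomial. -/
def wdeg : (σ → ℤ) →+ Γ where
  toFun e := ∑ v, e v • w v
  map_zero' := by simp
  map_add' e f := by simp [add_smul, Finset.sum_add_distrib]

theorem wdeg_apply (e : σ → ℤ) : wdeg w e = ∑ v, e v • w v := rfl

theorem wdeg_expo (u : σ →₀ ℕ) : wdeg w (expo u) = Finsupp.weight w u := by
  rw [wdeg_apply, Finsupp.weight_apply, Finsupp.sum_fintype _ _ (by simp)]
  exact Finset.sum_congr rfl fun v _ => natCast_zsmul _ _

theorem mem_weightedHomogeneousSubmodule_iff {s : MvPolynomial σ K} {δ : Γ} :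
    s ∈ weightedHomogeneousSubmodule K w δ ↔ ∀ u, s.coeff u ≠ 0 → wdeg w (expo u) = δ := by
  simp_rw [wdeg_expo]
  rfl

theorem restrict_weight_smul {s : MvPolynomial σ K} {δ γ γ' : Γ}
    (hs : s ∈ weightedHomogeneousSubmodule K w δ) (h : γ' = δ + γ) (a : Laurent K σ) :
    restrict {e | wdeg w e = γ'} (s • a) = s • restrict {e | wdeg w e = γ} a := by
  refine restrict_smul (fun u hu e => ?_) a
  rw [mem_weightedHomogeneousSubmodule_iff] at hs
  rw [Set.mem_ofPred_eq, Set.mem_ofPred_eq, map_sub, hs u hu, sub_eq_iff_eq_add', h]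

end Weight

end Laurent

end

end GradedLC


namespace GradedLC

open MvPolynomial Laurent

noncomputable section

section Simplex

/-! ### The augmented cochain complex of a simplex -/

/-- The number of elements of `B` below `b`. -/
abbrev below {N : ℕ} (B : Finset (Fin N)) (b : Fin N) : ℕ := (B.filter (· < b)).card

theorem below_erase {N : ℕ} {B : Finset (Fin N)} {b c : Fin N} (hb : b ∈ B) :
    below (B.erase b) c + (if b < c then 1 else 0) = below B c := by
  rw [below, below, Finset.filter_erase]
  split_ifs with h
  · rw [Finset.card_erase_add_one (Finset.mem_filter.2 ⟨hb, h⟩)]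
  · rw [Finset.erase_eq_of_notMem (by simp [h]), add_zero]

variable (K : Type*) {M : Type*} [Field K] [AddCommGroup M] [Module K M] {N : ℕ}

/-- The differential `(d c)_B = ∑_{b ∈ B} ± c_{B \ b}`. -/
def simplexD : (Finset (Fin N) → M) →ₗ[K] (Finset (Fin N) → M) :=
  LinearMap.pi fun B => ∑ b ∈ B, ((-1 : K) ^ below B b) • LinearMap.proj (B.erase b)

/-- The contraction of the complex of a simplex to the vertex `b`. -/
def simplexH (b : Fin N) : (Finset (Fin N) → M) →ₗ[K] (Finset (Fin N) → M) :=
  LinearMap.pi fun B =>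
    if b ∈ B then 0 else ((-1 : K) ^ below B b) • LinearMap.proj (insert b B)

variable {K}

theorem simplexD_apply (c : Finset (Fin N) → M) (B : Finset (Fin N)) :
    simplexD K c B = ∑ b ∈ B, ((-1 : K) ^ below B b) • c (B.erase b) := by
  simp [simplexD]

theorem simplexH_apply_of_mem (c : Finset (Fin N) → M) {b : Fin N} {B : Finset (Fin N)}
    (h : b ∈ B) : simplexH K b c B = 0 := by
  simp [simplexH, h]

theorem simplexH_apply_of_notMem (c : Finset (Fin N) → M) {b : Fin N} {B : Finset (Fin N)}
    (h : b ∉ B) : simplexH K b c B = ((-1 : K) ^ below B b) • c (insert b B) := by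
  simp [simplexH, h]

theorem sign_mul_sign_erase {B : Finset (Fin N)} {b c : Fin N} (hb : b ∈ B) (hc : c ∈ B)
    (hbc : b ≠ c) : (-1 : K) ^ below B b * (-1) ^ below (B.erase b) c =
      -((-1) ^ below B c * (-1) ^ below (B.erase c) b) := by
  have h₁ := below_erase (c := c) hb
  have h₂ := below_erase (c := b) hc
  obtain h | h := lt_or_gt_of_ne hbc
  · rw [if_pos h] at h₁
    rw [if_neg h.le.not_gt] at h₂
    rw [← h₁, ← h₂, add_zero]
    ring
  · rw [if_pos h] at h₂
    rw [if_neg h.le.not_gt] at h₁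
    rw [← h₁, ← h₂, add_zero]
    ring

theorem simplexD_simplexD (c : Finset (Fin N) → M) : simplexD K (simplexD K c) = 0 := by
  funext B
  rw [simplexD_apply, Pi.zero_apply]
  simp_rw [simplexD_apply, Finset.smul_sum, smul_smul]
  rw [Finset.sum_sigma']
  -- The terms that remove b and b' in the two possible orders cancel.
  refine Finset.sum_involution (fun x _ => ⟨x.2, x.1⟩) ?_ ?_ ?_ ?_
  · rintro ⟨b, b'⟩ h
    simp only [Finset.mem_sigma, Finset.mem_erase] at h
    rw [sign_mul_sign_erase h.1 h.2.2 h.2.1.symm, Finset.erase_right_comm, neg_smul,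
      neg_add_cancel]
  · rintro ⟨b, b'⟩ h _ h'
    simp only [Finset.mem_sigma, Finset.mem_erase] at h
    exact h.2.1 (congrArg Sigma.fst h')
  · rintro ⟨b, b'⟩ h
    simp only [Finset.mem_sigma, Finset.mem_erase] at h ⊢
    exact ⟨h.2.2, h.2.1.symm, h.1⟩
  · rintro ⟨b, b'⟩ _
    rfl

/-- A simplex is a cone over each of its vertices, so its augmented cochain complex is contractible.
-/
theorem simplexD_simplexH {c : Finset (Fin N) → M} (hc : simplexD K c = 0) (b : Fin N) :
    simplexD K (simplexH K b c) = c := by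
  funext B
  rw [simplexD_apply]
  by_cases hb : b ∈ B
  · rw [Finset.sum_eq_single b, simplexH_apply_of_notMem _ (Finset.notMem_erase b B), smul_smul,
      Finset.insert_erase hb]
    · have h := below_erase (c := b) hb
      rw [if_neg (lt_irrefl b), add_zero] at h
      rw [h, ← mul_pow, neg_one_mul, neg_neg, one_pow, one_smul]
    · intro b' hb' hbb'
      rw [simplexH_apply_of_mem _ (Finset.mem_erase.2 ⟨hbb'.symm, hb⟩), smul_zero]
    · exact fun h => absurd hb h
  -- For b ∉ B the term c_B is recovered from the cocycle condition on the larger set.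
  · have h := congrFun hc (insert b B)
    rw [simplexD_apply, Finset.sum_insert hb, Finset.erase_insert hb, Pi.zero_apply] at h
    rw [← sub_eq_zero, ← smul_eq_zero_iff_right (pow_ne_zero (below (insert b B) b)
      (neg_ne_zero.2 (one_ne_zero (α := K)))), smul_sub, sub_eq_zero, ← sub_eq_zero,
      eq_neg_of_add_eq_zero_left h, sub_neg_eq_add, Finset.smul_sum, ← Finset.sum_add_distrib]
    refine Finset.sum_eq_zero fun b' hb' => ?_
    have hbb' : b' ≠ b := fun h => hb (h ▸ hb')
    have hb'' : b ∉ B.erase b' := fun h => hb (Finset.mem_of_mem_erase h)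
    have he : (insert b B).erase b = B := Finset.erase_insert hb
    have he' : (insert b B).erase b' = insert b (B.erase b') :=
      Finset.erase_insert_of_ne hbb'.symm
    have hs := sign_mul_sign_erase (K := K) (Finset.mem_insert_self b B)
      (Finset.mem_insert_of_mem hb') hbb'.symm
    rw [he, he'] at hs
    have h' := below_erase (c := b) (Finset.mem_insert_self b (B.erase b'))
    rw [if_neg (lt_irrefl b), add_zero, Finset.erase_insert hb''] at h'
    rw [← h'] at hs
    rw [simplexH_apply_of_notMem _ hb'', smul_smul, he', smul_smul, hs, neg_mul, neg_smul,
      mul_assoc, ← mul_pow, neg_one_mul, neg_neg, one_pow, mul_one, neg_add_cancel]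

theorem simplexD_comp {M' : Type*} [AddCommGroup M'] [Module K M'] (φ : M →ₗ[K] M')
    (c : Finset (Fin N) → M) (B : Finset (Fin N)) :
    simplexD K (fun B => φ (c B)) B = φ (simplexD K c B) := by
  simp_rw [simplexD_apply, map_sum, map_smul]

end Simplex

end

end GradedLC


/-! ### The Čech double complex of a complex of free modules. -/

namespace GradedLC

open MvPolynomial Laurent

noncomputable section

/-- A graded complex of free modules over a polynomial ring, given by sparse matrices: the basis
element `i` has position `pos i` and weight `wt i`, and the differential sends the family `z` of
coordinates to the family `i ↦ ∑ j, coeff i j • z (src i j)`. -/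
structure FreeComplex (K : Type*) [Field K] {σ Γ : Type*} [AddCommGroup Γ] (w : σ → Γ) where
  ι : Type
  pos : ι → ℤ
  wt : ι → Γ
  cols : ι → ℕ
  src : ∀ i, Fin (cols i) → ι
  coeff : ∀ i, Fin (cols i) → MvPolynomial σ K
  pos_src : ∀ i j, pos (src i j) + 1 = pos i
  coeff_mem : ∀ i j, coeff i j ∈ weightedHomogeneousSubmodule K w (wt i - wt (src i j))
  finite_pos : ∀ q, {i | pos i = q}.Finite
  d_d : ∀ (z : ι → Laurent K σ) i,
    ∑ j, coeff i j • ∑ k, coeff (src i j) k • z (src (src i j) k) = 0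

namespace FreeComplex

variable {K σ Γ : Type*} [Field K] [AddCommGroup Γ] {w : σ → Γ} (C : FreeComplex K w)

/-- The differential, for coordinates in a module over the polynomial ring. -/
def d (M : Type*) [AddCommGroup M] [Module (MvPolynomial σ K) M] :
    (C.ι → M) →ₗ[MvPolynomial σ K] (C.ι → M) :=
  LinearMap.pi fun i => ∑ j, C.coeff i j • LinearMap.proj (C.src i j)

section

variable {M : Type*} [AddCommGroup M] [Module (MvPolynomial σ K) M]

theorem d_apply (z : C.ι → M) (i : C.ι) : C.d M z i = ∑ j, C.coeff i j • z (C.src i j) := by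
  simp [d]

theorem d_map {M' : Type*} [AddCommGroup M'] [Module (MvPolynomial σ K) M']
    (φ : M →ₗ[MvPolynomial σ K] M') (z : C.ι → M) :
    C.d M' (fun i => φ (z i)) = fun i => φ (C.d M z i) := by
  funext i
  simp_rw [d_apply, map_sum, map_smul]

end

theorem d_mul (x : Laurent K σ) (z : C.ι → Laurent K σ) :
    C.d _ (fun i => x * z i) = fun i => x * C.d _ z i := by
  funext i
  simp_rw [d_apply, Finset.mul_sum, mul_smul_comm]

theorem d_algebraMap (z : C.ι → MvPolynomial σ K) :
    C.d _ (fun i => algebraMap _ (Laurent K σ) (z i)) =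
      fun i => algebraMap _ (Laurent K σ) (C.d _ z i) :=
  C.d_map (Algebra.linearMap (MvPolynomial σ K) (Laurent K σ)) z

variable {N : ℕ} (ε : Fin N → σ)

/-- The ambient space of the Čech double complex. -/
abbrev Cochain (N : ℕ) : Type _ := Finset (Fin N) → C.ι → Laurent K σ

/-- The exponents that occur in the localization that inverts the variables `ε b`, `b ∈ B`. -/
def IsLocalExponent (B : Finset (Fin N)) (e : σ → ℤ) : Prop := ∀ x, e x < 0 → ∃ b ∈ B, ε b = x

variable {N : ℕ}

/-- The cochains all of whose monomials satisfy the condition `P`. -/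
def supported (P : Finset (Fin N) → C.ι → (σ → ℤ) → Prop) : Submodule K (C.Cochain N) where
  carrier := {a | ∀ B i e, coef e (a B i) ≠ 0 → P B i e}
  zero_mem' := fun B i e h => absurd (map_zero (coef (K := K) e)) h
  add_mem' := fun {a b} ha hb B i e h => by
    by_cases h' : coef e (a B i) = 0
    · refine hb B i e fun h'' => h ?_
      rw [Pi.add_apply, Pi.add_apply, map_add, h', h'', add_zero]
    · exact ha B i e h'
  smul_mem' := fun c a ha B i e h => ha B i e fun h' => h (by
    rw [Pi.smul_apply, Pi.smul_apply, map_smul, h', smul_zero])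

variable (N) in
/-- The horizontal differential of the Čech double complex. -/
def horizontal : C.Cochain N →ₗ[K] C.Cochain N := simplexD K

variable (N) in
/-- The vertical differential of the Čech double complex. -/
def vertical : C.Cochain N →ₗ[K] C.Cochain N :=
  LinearMap.pi fun B => ((C.d (Laurent K σ)).restrictScalars K).comp (LinearMap.proj B)

theorem vertical_apply (a : C.Cochain N) (B : Finset (Fin N)) :
    C.vertical N a B = C.d _ (a B) := rfl

theorem horizontal_apply (a : C.Cochain N) (B : Finset (Fin N)) (i : C.ι) :
    C.horizontal N a B i = ∑ b ∈ B, ((-1 : K) ^ below B b) • a (B.erase b) i := by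
  rw [horizontal, simplexD_apply, Finset.sum_apply]
  rfl

theorem horizontal_horizontal (a : C.Cochain N) : C.horizontal N (C.horizontal N a) = 0 :=
  simplexD_simplexD a

theorem vertical_vertical (a : C.Cochain N) : C.vertical N (C.vertical N a) = 0 := by
  funext B i
  simp_rw [vertical_apply, d_apply]
  exact C.d_d (a B) i

theorem horizontal_vertical (a : C.Cochain N) :
    C.horizontal N (C.vertical N a) = C.vertical N (C.horizontal N a) :=
  funext fun B => simplexD_comp ((C.d (Laurent K σ)).restrictScalars K) a B

theorem exists_of_coef_horizontal_ne_zero {a : C.Cochain N} {B : Finset (Fin N)} {i : C.ι}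
    {e : σ → ℤ} (h : coef e (C.horizontal N a B i) ≠ 0) :
    ∃ b ∈ B, coef e (a (B.erase b) i) ≠ 0 := by
  rw [horizontal_apply, map_sum] at h
  obtain ⟨b, hb, h⟩ := Finset.exists_ne_zero_of_sum_ne_zero h
  rw [map_smul] at h
  exact ⟨b, hb, right_ne_zero_of_smul h⟩

theorem exists_of_coef_vertical_ne_zero {a : C.Cochain N} {B : Finset (Fin N)} {i : C.ι}
    {e : σ → ℤ} (h : coef e (C.vertical N a B i) ≠ 0) :
    ∃ j u, (C.coeff i j).coeff u ≠ 0 ∧ coef (e - expo u) (a B (C.src i j)) ≠ 0 := by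
  rw [vertical_apply, d_apply, map_sum] at h
  obtain ⟨j, -, h⟩ := Finset.exists_ne_zero_of_sum_ne_zero h
  obtain ⟨u, hu⟩ := exists_of_coef_smul_ne_zero h
  exact ⟨j, u, hu⟩

variable {N : ℕ} (ε : Fin N → σ)

/-- The term of bidegree `(p, q)` of the Čech double complex, without homogeneity condition. -/
def cechTerm (p q : ℤ) : Submodule K (C.Cochain N) :=
  C.supported fun B i e => ((B.card : ℤ) = p ∧ C.pos i = q) ∧ IsLocalExponent ε B e

theorem horizontal_mem_cechTerm {p q : ℤ} {a : C.Cochain N} (ha : a ∈ C.cechTerm ε p q) :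
    C.horizontal N a ∈ C.cechTerm ε (p + 1) q := by
  intro B i e h
  obtain ⟨b, hb, h⟩ := C.exists_of_coef_horizontal_ne_zero h
  obtain ⟨⟨hp, hq⟩, he⟩ := ha _ i e h
  refine ⟨⟨?_, hq⟩, fun x hx => ?_⟩
  · rw [← hp, ← Finset.card_erase_add_one hb]
    push_cast
    rfl
  · obtain ⟨b', hb', h'⟩ := he x hx
    exact ⟨b', Finset.mem_of_mem_erase hb', h'⟩

theorem isLocalExponent_of_sub {B : Finset (Fin N)} {e : σ → ℤ} {u : σ →₀ ℕ}
    (h : IsLocalExponent ε B (e - expo u)) : IsLocalExponent ε B e := fun x hx =>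
  h x (by
    rw [Pi.sub_apply, expo_apply]
    omega)

theorem vertical_mem_cechTerm {p q : ℤ} {a : C.Cochain N} (ha : a ∈ C.cechTerm ε p q) :
    C.vertical N a ∈ C.cechTerm ε p (q + 1) := by
  intro B i e h
  obtain ⟨j, u, -, h⟩ := C.exists_of_coef_vertical_ne_zero h
  obtain ⟨⟨hp, hq⟩, he⟩ := ha _ _ _ h
  exact ⟨⟨hp, by rw [← C.pos_src i j, hq]⟩, isLocalExponent_of_sub ε he⟩

variable [Fintype σ]

/-- The homogeneous cochains of degree `γ`. -/
def homogeneous (N : ℕ) (γ : Γ) : Submodule K (C.Cochain N) :=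
  C.supported fun _ i e => wdeg w e = γ + C.wt i

theorem horizontal_mem_homogeneous {γ : Γ} {a : C.Cochain N} (ha : a ∈ C.homogeneous N γ) :
    C.horizontal N a ∈ C.homogeneous N γ := by
  intro B i e h
  obtain ⟨b, hb, h⟩ := C.exists_of_coef_horizontal_ne_zero h
  exact ha _ i e h

theorem vertical_mem_homogeneous {γ : Γ} {a : C.Cochain N} (ha : a ∈ C.homogeneous N γ) :
    C.vertical N a ∈ C.homogeneous N γ := by
  intro B i e h
  obtain ⟨j, u, hu, h⟩ := C.exists_of_coef_vertical_ne_zero h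
  have h₁ : wdeg w (e - expo u) = γ + C.wt (C.src i j) := ha _ _ _ h
  have h₂ := (mem_weightedHomogeneousSubmodule_iff w).1 (C.coeff_mem i j) u hu
  rw [map_sub, h₂] at h₁
  rw [eq_add_of_sub_eq h₁]
  abel

/-- The homogeneous component of degree `γ` of a cochain. -/
def proj (N : ℕ) (γ : Γ) : C.Cochain N →ₗ[K] C.Cochain N :=
  LinearMap.pi fun B => LinearMap.pi fun i =>
    restrict {e | wdeg w e = γ + C.wt i} ∘ₗ LinearMap.proj i ∘ₗ LinearMap.proj B

theorem proj_apply (γ : Γ) (a : C.Cochain N) (B : Finset (Fin N)) (i : C.ι) :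
    C.proj N γ a B i = restrict {e | wdeg w e = γ + C.wt i} (a B i) := rfl

theorem proj_mem_homogeneous (γ : Γ) (a : C.Cochain N) : C.proj N γ a ∈ C.homogeneous N γ :=
  fun _ _ _ h => (of_coef_restrict_ne_zero h).1

theorem proj_mem_supported (γ : Γ) {P : Finset (Fin N) → C.ι → (σ → ℤ) → Prop} {a : C.Cochain N}
    (ha : a ∈ C.supported P) : C.proj N γ a ∈ C.supported P :=
  fun B i e h => ha B i e (of_coef_restrict_ne_zero h).2

theorem proj_eq_self {γ : Γ} {a : C.Cochain N} (ha : a ∈ C.homogeneous N γ) :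
    C.proj N γ a = a :=
  funext fun B => funext fun i => restrict_eq_self fun e h => ha B i e h

theorem proj_horizontal (γ : Γ) (a : C.Cochain N) :
    C.proj N γ (C.horizontal N a) = C.horizontal N (C.proj N γ a) :=
  funext fun B => (simplexD_comp (LinearMap.pi fun i =>
    restrict {e | wdeg w e = γ + C.wt i} ∘ₗ LinearMap.proj i) a B).symm

theorem proj_vertical (γ : Γ) (a : C.Cochain N) :
    C.proj N γ (C.vertical N a) = C.vertical N (C.proj N γ a) := by
  funext B i
  simp_rw [proj_apply, vertical_apply, d_apply, map_sum, proj_apply]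
  refine Finset.sum_congr rfl fun j _ => restrict_weight_smul w (C.coeff_mem i j) ?_ _
  abel

/-- The homogeneous part of degree `γ` of the Čech double complex, with respect to the variables
`ε b`, `b < N`, of a complex of free modules. -/
def cech (γ : Γ) : DoubleComplex K (C.Cochain N) where
  X p q := C.cechTerm ε p q ⊓ C.homogeneous N γ
  h := C.horizontal N
  v := C.vertical N
  h_h := C.horizontal_horizontal
  v_v := C.vertical_vertical
  h_v := C.horizontal_vertical
  h_mem := fun ha => ⟨C.horizontal_mem_cechTerm ε ha.1, C.horizontal_mem_homogeneous ha.2⟩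
  v_mem := fun ha => ⟨C.vertical_mem_cechTerm ε ha.1, C.vertical_mem_homogeneous ha.2⟩

theorem proj_mem_cech_X {γ : Γ} {p q : ℤ} {a : C.Cochain N} (ha : a ∈ C.cechTerm ε p q) :
    C.proj N γ a ∈ (C.cech ε γ).X p q :=
  ⟨C.proj_mem_supported γ ha, C.proj_mem_homogeneous γ a⟩

omit [Fintype σ] in
theorem cechTerm_eq_bot {p : ℤ} (q : ℤ) (hp : p < 0 ∨ (N : ℤ) < p) : C.cechTerm ε p q = ⊥ := by
  refine (Submodule.eq_bot_iff _).2 fun a ha => funext fun B => funext fun i => Laurent.ext fun e => ?_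
  by_contra h
  have h₁ := (ha B i e h).1.1
  have h₂ := card_finset_fin_le B
  omega

theorem cech_X_eq_bot {γ : Γ} {p : ℤ} (q : ℤ) (hp : p < 0 ∨ (N : ℤ) < p) :
    (C.cech ε γ).X p q = ⊥ := by
  change C.cechTerm ε p q ⊓ _ = ⊥
  rw [C.cechTerm_eq_bot ε q hp, bot_inf_eq]

section Row

variable {C}

/-- The monomials for which `b` is the chosen index with nonnegative exponent. -/
def chosen (b : Fin N) : Set (σ → ℤ) :=
  {e | ∃ h : ∃ b, 0 ≤ e (ε b), Classical.choose h = b}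

omit [Fintype σ] in
theorem nonneg_of_mem_chosen {b : Fin N} {e : σ → ℤ} (h : e ∈ chosen ε b) : 0 ≤ e (ε b) := by
  obtain ⟨h, rfl⟩ := h
  exact Classical.choose_spec h

omit [Fintype σ] in
theorem sum_restrict_chosen {a : Laurent K σ} (ha : ∀ e, coef e a ≠ 0 → ∃ b, 0 ≤ e (ε b)) :
    ∑ b, restrict (chosen ε b) a = a := by
  ext e
  rw [map_sum]
  by_cases h : coef e a = 0
  · rw [h]
    refine Finset.sum_eq_zero fun b _ => ?_
    by_contra h'
    exact (of_coef_restrict_ne_zero h').2 h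
  · rw [Finset.sum_eq_single (Classical.choose (ha e h)), coef_restrict_of_mem (show e ∈ chosen ε _ from ⟨ha e h, rfl⟩)]
    · intro b _ hb
      exact coef_restrict_of_notMem (by rintro ⟨_, h'⟩; exact hb h'.symm) a
    · exact fun h => absurd (Finset.mem_univ _) h

/-- The horizontal differential does not change exponents, so the cochain can be split according to
a variable ε b with nonnegative exponent. Each part is contracted to its vertex b. -/
theorem exists_horizontal_eq {γ : Γ} {p q : ℤ} {a : C.Cochain N} (ha : a ∈ (C.cech ε γ).X p q)
    (hd : C.horizontal N a = 0)
    (hnonneg : ∀ B i e, coef e (a B i) ≠ 0 → ∃ b, 0 ≤ e (ε b)) :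
    ∃ b ∈ (C.cech ε γ).X (p - 1) q, C.horizontal N b = a := by
  let r : Fin N → C.Cochain N →ₗ[K] C.Cochain N := fun b =>
    LinearMap.pi fun B => LinearMap.pi fun i =>
      restrict (chosen ε b) ∘ₗ LinearMap.proj i ∘ₗ LinearMap.proj B
  have hr : ∀ b, C.horizontal N (r b a) = 0 := fun b => by
    rw [← map_zero (r b), ← hd]
    exact funext fun B => simplexD_comp (LinearMap.pi fun i =>
      restrict (chosen ε b) ∘ₗ LinearMap.proj i) a B
  refine ⟨∑ b, simplexH K b (r b a), Submodule.sum_mem _ fun b _ => ?_, ?_⟩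
  · have hcoef : ∀ B i e, coef e (simplexH K b (r b a) B i) ≠ 0 →
        b ∉ B ∧ e ∈ chosen ε b ∧ coef e (a (insert b B) i) ≠ 0 := by
      intro B i e h
      by_cases hb : b ∈ B
      · rw [simplexH_apply_of_mem _ hb] at h
        exact absurd (map_zero _) h
      · rw [simplexH_apply_of_notMem _ hb, Pi.smul_apply, map_smul] at h
        exact ⟨hb, of_coef_restrict_ne_zero (right_ne_zero_of_smul h)⟩
    refine ⟨fun B i e h => ?_, fun B i e h => ha.2 _ i e (hcoef B i e h).2.2⟩
    obtain ⟨hb, he, h⟩ := hcoef B i e h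
    obtain ⟨⟨hp, hq⟩, hloc⟩ := ha.1 _ i e h
    refine ⟨⟨?_, hq⟩, fun x hx => ?_⟩
    · rw [← hp, Finset.card_insert_of_notMem hb]
      push_cast
      ring
    · obtain ⟨b', hb', rfl⟩ := hloc x hx
      -- Removing b from the index set is harmless: on this part ε b has nonnegative exponent, so it
      -- need not be inverted.
      refine ⟨b', (Finset.mem_insert.1 hb').resolve_left ?_, rfl⟩
      rintro rfl
      exact (nonneg_of_mem_chosen ε he).not_gt hx
  · rw [map_sum]
    refine (Finset.sum_congr rfl fun b _ => simplexD_simplexH (hr b) b).trans ?_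
    funext B i
    rw [Finset.sum_apply, Finset.sum_apply]
    exact sum_restrict_chosen ε (hnonneg B i)

/-- A monomial whose exponents at all ε b are negative occurs only for the full index set, that is,
in the last column. -/
theorem rowExact_cech (hε : Function.Injective ε) (γ : Γ) : (C.cech ε γ).RowExact N := by
  intro p q a hp ha hd
  refine exists_horizontal_eq ε ha hd fun B i e h => ?_
  obtain ⟨⟨hp', -⟩, hloc⟩ := ha.1 B i e h
  by_contra! hneg
  have hB : B = Finset.univ := Finset.eq_univ_of_forall fun b => by
    obtain ⟨b', hb', h'⟩ := hloc (ε b) (hneg b)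
    rwa [← hε h']
  rw [hB, Finset.card_univ, Fintype.card_fin] at hp'
  omega

end Row

section Column

variable {C}

/-- A monomial in the variables `ε b`, `b ∈ B`. -/
def IsDenominator (B : Finset (Fin N)) (u : σ →₀ ℕ) : Prop := ∀ x, u x ≠ 0 → ∃ b ∈ B, ε b = x

theorem exists_denominator {ι : Type*} (B : Finset (Fin N)) (v : ι → Laurent K σ)
    (hv : {i | v i ≠ 0}.Finite) (hB : ∀ i e, coef e (v i) ≠ 0 → IsLocalExponent ε B e) :
    ∃ u, IsDenominator ε B u ∧ ∃ z : ι → MvPolynomial σ K,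
      ∀ i, algebraMap _ (Laurent K σ) (z i) = (monomial u (1 : K) : MvPolynomial σ K) • v i := by
  have hfin : (⋃ i ∈ {i | v i ≠ 0}, {e | coef e (v i) ≠ 0}).Finite :=
    hv.biUnion fun i _ => finite_support (v i)
  let u : σ →₀ ℕ := Finsupp.equivFunOnFinite.symm fun x =>
    hfin.toFinset.sup fun e => (-e x).toNat
  have hu : ∀ i e, coef e (v i) ≠ 0 → 0 ≤ e + expo u := by
    intro i e h x
    have hmem : e ∈ hfin.toFinset := hfin.mem_toFinset.2
      (Set.mem_biUnion (show v i ≠ 0 from fun h' => h (by rw [h', map_zero])) h)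
    have h' : (-e x).toNat ≤ u x := Finset.le_sup (f := fun e : σ → ℤ => (-e x).toNat) hmem
    rw [Pi.zero_apply, Pi.add_apply, expo_apply]
    have h₁ := Int.self_le_toNat (-e x)
    have h₂ : ((-e x).toNat : ℤ) ≤ u x := by exact_mod_cast h'
    linarith
  refine ⟨u, fun x hx => ?_, ?_⟩
  · by_contra h
    refine hx (le_antisymm (Finset.sup_le fun e he => ?_) (Nat.zero_le _))
    obtain ⟨i, -, hi⟩ := Set.mem_iUnion₂.1 (hfin.mem_toFinset.1 he)
    by_contra h'
    exact h (hB i e hi x (by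
      simp only [nonpos_iff_eq_zero, Int.toNat_eq_zero, not_le] at h'
      omega))
  · choose z hz using fun i => exists_algebraMap_eq
      ((monomial u (1 : K) : MvPolynomial σ K) • v i) (fun e he => by
        rw [coef_monomial_smul] at he
        simpa using hu i _ he)
    exact ⟨z, hz⟩

variable (C) in
/-- The localization of the complex at the variables `ε b`, `b ∈ B`, is exact in degree `q`. -/
def LocallyExact (B : Finset (Fin N)) (q : ℤ) : Prop :=
  ∀ z : C.ι → MvPolynomial σ K, (∀ i, z i ≠ 0 → C.pos i = q) → C.d _ z = 0 →
    ∃ u, IsDenominator ε B u ∧ ∃ y : C.ι → MvPolynomial σ K,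
      (∀ i, y i ≠ 0 → C.pos i = q - 1) ∧ C.d _ y = (monomial u (1 : K) : MvPolynomial σ K) • z

omit [Fintype σ] in
theorem eq_zero_of_pos_ne {p q : ℤ} {a : C.Cochain N} (ha : a ∈ C.cechTerm ε p q)
    {B : Finset (Fin N)} {i : C.ι} (hi : a B i ≠ 0) : (B.card : ℤ) = p ∧ C.pos i = q := by
  by_contra h
  exact hi (Laurent.ext fun e => by
    by_contra h'
    exact h (ha B i e h').1)

omit [Fintype σ] in
theorem isLocalExponent_single_mul {B : Finset (Fin N)} {u : σ →₀ ℕ} (hu : IsDenominator ε B u)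
    {s : MvPolynomial σ K} {e : σ → ℤ}
    (h : coef e (single (-expo u) 1 * algebraMap _ (Laurent K σ) s) ≠ 0) :
    IsLocalExponent ε B e := by
  intro x hx
  rw [coef_single_mul, one_mul] at h
  obtain ⟨u', hu', -⟩ := exists_expo_of_coef_ne_zero h
  have := congrFun hu' x
  rw [Pi.sub_apply, Pi.neg_apply, expo_apply, expo_apply] at this
  exact hu x (by omega)

/-- Exactness of the localizations gives exactness of the columns, before homogeneous components
are taken. -/
theorem exists_vertical_eq_of_locallyExact {p q : ℤ}
    (hC : ∀ B : Finset (Fin N), (B.card : ℤ) = p → C.LocallyExact ε B q) {a : C.Cochain N}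
    (ha : a ∈ C.cechTerm ε p q) (hd : C.vertical N a = 0) :
    ∃ b ∈ C.cechTerm ε p (q - 1), C.vertical N b = a := by
  have key : ∀ B, ∃ y : C.ι → Laurent K σ, C.d _ y = a B ∧ ∀ i e, coef e (y i) ≠ 0 →
      ((B.card : ℤ) = p ∧ C.pos i = q - 1) ∧ IsLocalExponent ε B e := by
    intro B
    by_cases hB : (B.card : ℤ) = p
    · obtain ⟨u, hu, z, hz⟩ := exists_denominator ε B (a B)
        ((C.finite_pos q).subset fun i hi => (eq_zero_of_pos_ne ε ha hi).2)
        (fun i e h => (ha B i e h).2)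
      obtain ⟨u', hu', y, hy, hyz⟩ := hC B hB z (fun i hi => by
          refine (eq_zero_of_pos_ne ε ha (B := B) fun h => hi (algebraMap_injective (σ := σ) ?_)).2
          rw [hz, h, smul_zero, map_zero]) (by
        funext i
        refine algebraMap_injective (σ := σ) ?_
        rw [Pi.zero_apply, map_zero, ← congrFun (C.d_algebraMap z) i, funext hz]
        change C.d _ ((monomial u (1 : K) : MvPolynomial σ K) • a B) i = 0
        rw [map_smul, ← C.vertical_apply, hd]
        exact smul_zero (M := MvPolynomial σ K) (A := Laurent K σ) _)
      have huu : IsDenominator ε B (u' + u) := fun x hx => by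
        by_cases h : u x = 0
        · exact hu' x (by simpa [h] using hx)
        · exact hu x h
      refine ⟨fun i => single (-expo (u' + u)) 1 * algebraMap _ _ (y i), ?_, fun i e h =>
        ⟨⟨hB, hy i fun h' => h (by
          change coef e (_ * algebraMap _ _ (y i)) = 0
          rw [h', map_zero, mul_zero, map_zero])⟩,
          isLocalExponent_single_mul ε huu h⟩⟩
      rw [d_mul, d_algebraMap, hyz]
      funext i
      refine monomial_smul_injective (K := K) (u' + u) ?_
      change _ • (_ * algebraMap _ (Laurent K σ) ((monomial u' (1 : K)) * z i)) =
        (monomial _ (1 : K) : MvPolynomial σ K) • a B i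
      rw [monomial_smul_single_mul, map_mul, hz, ← Algebra.smul_def,
        smul_smul, monomial_mul, one_mul]
    · refine ⟨0, ?_, fun i e h => absurd (map_zero _) h⟩
      rw [map_zero, eq_comm]
      funext i
      by_contra h
      exact hB (eq_zero_of_pos_ne ε ha h).1
  choose y hy hsupp using key
  exact ⟨y, fun B i e h => hsupp B i e h, funext hy⟩

/-- The vertical differential commutes with taking homogeneous components, so a primitive can be
replaced by its component of degree γ. -/
theorem exists_vertical_eq {γ : Γ} {p q : ℤ}
    (hC : ∀ B : Finset (Fin N), (B.card : ℤ) = p → C.LocallyExact ε B q) {a : C.Cochain N}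
    (ha : a ∈ (C.cech ε γ).X p q) (hd : C.vertical N a = 0) :
    ∃ b ∈ (C.cech ε γ).X p (q - 1), C.vertical N b = a := by
  obtain ⟨b, hb, rfl⟩ := exists_vertical_eq_of_locallyExact ε hC ha.1 hd
  exact ⟨C.proj N γ b, C.proj_mem_cech_X ε hb, by
    rw [← proj_vertical, C.proj_eq_self ha.2]⟩

end Column

end FreeComplex

end

end GradedLC


/-! ### Homology of a free complex and localizations of the module it represents. -/

namespace GradedLC

open MvPolynomial Laurent

noncomputable section

namespace FreeComplex

variable {K σ Γ : Type*} [Field K] [AddCommGroup Γ] {w : σ → Γ} [Fintype σ]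
  (C : FreeComplex K w)

/-- The cycles at position `c` whose weights lie in a given class modulo `Θ`. -/
structure IsCycle (c : ℤ) (Θ : AddSubgroup Γ) (κ : Γ) (z : C.ι → MvPolynomial σ K) : Prop where
  pos_eq : ∀ i, z i ≠ 0 → C.pos i = c
  d_eq_zero : C.d _ z = 0
  weight_mem : ∀ i u, (z i).coeff u ≠ 0 → wdeg w (expo u) - (κ + C.wt i) ∈ Θ

variable {C} {c : ℤ} {Θ : AddSubgroup Γ} {κ : Γ}

theorem IsCycle.zero : C.IsCycle c Θ κ 0 where
  pos_eq := fun _ h => absurd rfl h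
  d_eq_zero := map_zero _
  weight_mem := fun _ _ h => absurd (coeff_zero _) h

theorem IsCycle.add {z z' : C.ι → MvPolynomial σ K} (h : C.IsCycle c Θ κ z)
    (h' : C.IsCycle c Θ κ z') : C.IsCycle c Θ κ (z + z') where
  pos_eq := fun i hi => by
    by_cases hz : z i = 0
    · exact h'.pos_eq i fun hz' => hi (by rw [Pi.add_apply, hz, hz', add_zero])
    · exact h.pos_eq i hz
  d_eq_zero := by rw [map_add, h.d_eq_zero, h'.d_eq_zero, add_zero]
  weight_mem := fun i u hi => by
    by_cases hz : (z i).coeff u = 0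
    · exact h'.weight_mem i u fun hz' => hi (by rw [Pi.add_apply, coeff_add, hz, hz', add_zero])
    · exact h.weight_mem i u hz

theorem IsCycle.smul {z : C.ι → MvPolynomial σ K} (h : C.IsCycle c Θ κ z) {s : MvPolynomial σ K}
    (hs : ∀ u, s.coeff u ≠ 0 → wdeg w (expo u) ∈ Θ) : C.IsCycle c Θ κ (s • z) where
  pos_eq := fun i hi => h.pos_eq i fun h' => hi (by rw [Pi.smul_apply, h', smul_zero])
  d_eq_zero := by rw [map_smul, h.d_eq_zero, smul_zero]
  weight_mem := fun i u hi => by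
    classical
    rw [Pi.smul_apply, smul_eq_mul, coeff_mul] at hi
    obtain ⟨⟨u₁, u₂⟩, hu, hi⟩ := Finset.exists_ne_zero_of_sum_ne_zero hi
    rw [← Finset.HasAntidiagonal.mem_antidiagonal.1 hu, map_add, map_add, add_sub_assoc]
    exact Θ.add_mem (hs u₁ (left_ne_zero_of_mul hi)) (h.weight_mem i u₂ (right_ne_zero_of_mul hi))

variable (C) in
/-- The coordinates of a homogeneous element of degree `γ`. -/
def IsHomogeneousFamily (γ : Γ) (z : C.ι → MvPolynomial σ K) : Prop :=
  ∀ i u, (z i).coeff u ≠ 0 → wdeg w (expo u) = γ + C.wt i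

variable {N : ℕ} {A M Λ : Type*} [CommRing A] [Algebra K A] [AddCommGroup M] [Module A M]
  [Module K M] [AddCommGroup Λ]

variable (C c) in
/-- The data that identify the homology at position `c` of a graded complex of free modules over
a polynomial ring with a graded module `M` over a ring `A`. The ring `A` maps to the polynomial
ring by `ψ`, the elements `y b` going to the variables `ε b`. -/
structure Augmentation (ε : Fin N → σ) (y : Fin N → A) (𝒜 : Λ → Submodule K A)
    (𝓜 : Λ → Submodule K M) where
  ψ : A →ₐ[K] MvPolynomial σ K
  ψ_y : ∀ b, ψ (y b) = X (ε b)
  -- The subgroup cuts a strand out of the complex. For I^k it consists of the bidegrees with second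
  -- component zero, and κ = (0, k); for ω_R it is everything.
  Θ : AddSubgroup Γ
  κ : Γ
  lin : Λ →+ Γ
  lin_mem : ∀ μ, lin μ ∈ Θ
  weight_mem : ∀ a u, (ψ a).coeff u ≠ 0 → wdeg w (expo u) ∈ Θ
  ψ_mem : ∀ {δ a}, a ∈ 𝒜 δ → ψ a ∈ weightedHomogeneousSubmodule K w (lin δ)
  denominators_mem : ∀ {B s}, s ∈ denominators y B → ∃ δ, s ∈ 𝒜 δ
  π : (C.ι → MvPolynomial σ K) → M
  π_add : ∀ {z z'}, C.IsCycle c Θ κ z → C.IsCycle c Θ κ z' → π (z + z') = π z + π z'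
  π_smul : ∀ {z} a, C.IsCycle c Θ κ z → π (ψ a • z) = a • π z
  exists_π_eq : ∀ x, ∃ z, C.IsCycle c Θ κ z ∧ π z = x
  π_eq_zero_iff : ∀ {z}, C.IsCycle c Θ κ z →
    (π z = 0 ↔ ∃ x, (∀ i, x i ≠ 0 → C.pos i = c - 1) ∧ C.d _ x = z)
  exists_π_eq_of_mem : ∀ {μ x}, x ∈ 𝓜 μ →
    ∃ z, C.IsCycle c Θ κ z ∧ C.IsHomogeneousFamily (κ + lin μ) z ∧ π z = x
  π_mem : ∀ {μ z}, C.IsCycle c Θ κ z → C.IsHomogeneousFamily (κ + lin μ) z → π z ∈ 𝓜 μ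

namespace Augmentation

variable {ε : Fin N → σ} {y : Fin N → A} {𝒜 : Λ → Submodule K A} {𝓜 : Λ → Submodule K M}
  (P : C.Augmentation c ε y 𝒜 𝓜)

theorem π_zero : P.π 0 = 0 := by
  have := P.π_add IsCycle.zero IsCycle.zero
  rwa [add_zero, left_eq_add] at this

theorem isCycle_smul {z : C.ι → MvPolynomial σ K} (h : C.IsCycle c P.Θ P.κ z) (a : A) :
    C.IsCycle c P.Θ P.κ (P.ψ a • z) :=
  h.smul (P.weight_mem a)

theorem exists_monomial_of_mem_denominators {B : Finset (Fin N)} {s : A}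
    (hs : s ∈ denominators y B) : ∃ u, IsDenominator ε B u ∧ P.ψ s = monomial u 1 := by
  induction hs using Submonoid.closure_induction with
  | mem s hs =>
    obtain ⟨b, hb, rfl⟩ := hs
    refine ⟨Finsupp.single (ε b) 1, fun x hx => ⟨b, hb, ?_⟩, P.ψ_y b⟩
    by_contra h
    exact hx (Finsupp.single_eq_of_ne (Ne.symm h))
  | one => exact ⟨0, fun x hx => absurd rfl hx, map_one _⟩
  | mul s t _ _ hs ht =>
    obtain ⟨u, hu, hus⟩ := hs
    obtain ⟨v, hv, hvt⟩ := ht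
    refine ⟨u + v, fun x hx => ?_, by rw [map_mul, hus, hvt, monomial_mul, one_mul]⟩
    by_cases h : u x = 0
    · exact hv x (by simpa [h] using hx)
    · exact hu x h

theorem exists_mem_denominators {B : Finset (Fin N)} {u : σ →₀ ℕ} (hu : IsDenominator ε B u) :
    ∃ s ∈ denominators y B, P.ψ s = monomial u 1 := by
  have h : ∀ x, ∃ s ∈ denominators y B, P.ψ s = X x ^ u x := by
    intro x
    by_cases hx : u x = 0
    · exact ⟨1, one_mem _, by rw [hx, pow_zero, map_one]⟩
    · obtain ⟨b, hb, rfl⟩ := hu x hx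
      exact ⟨y b ^ u (ε b), pow_mem (Submonoid.subset_closure (Set.mem_image_of_mem y hb)) _, by
        rw [map_pow, P.ψ_y]⟩
  choose s hs hsu using h
  refine ⟨∏ x, s x, prod_mem fun x _ => hs x, ?_⟩
  rw [map_prod, monomial_eq, C_1, one_mul, Finsupp.prod_fintype _ _ (by simp)]
  exact Finset.prod_congr rfl fun x _ => hsu x

/-- Multiplication by `ψ a` on families of Laurent polynomials. -/
def mulψ (a : A) : (C.ι → Laurent K σ) →ₗ[K] (C.ι → Laurent K σ) :=
  DistribSMul.toLinearMap K (C.ι → Laurent K σ) (P.ψ a)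

theorem mulψ_apply (a : A) (v : C.ι → Laurent K σ) (i : C.ι) : P.mulψ a v i = P.ψ a • v i := rfl

theorem mulψ_injective {B : Finset (Fin N)} {s : A} (hs : s ∈ denominators y B) :
    Function.Injective (P.mulψ s) := by
  obtain ⟨u, -, hu⟩ := P.exists_monomial_of_mem_denominators hs
  intro v v' h
  funext i
  have := congrFun h i
  rw [mulψ_apply, mulψ_apply, hu] at this
  exact monomial_smul_injective u this

theorem mulψ_mul (a b : A) (v : C.ι → Laurent K σ) :
    P.mulψ (a * b) v = P.mulψ a (P.mulψ b v) := by
  funext i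
  simp_rw [mulψ_apply, map_mul, mul_smul]

/-- A family of polynomials as a family of Laurent polynomials. -/
def toLaurent (C : FreeComplex K w) : (C.ι → MvPolynomial σ K) →+ (C.ι → Laurent K σ) where
  toFun z i := algebraMap _ _ (z i)
  map_zero' := funext fun _ => map_zero _
  map_add' _ _ := funext fun _ => map_add _ _ _

omit [Fintype σ] in
theorem toLaurent_injective : Function.Injective (toLaurent C) := fun _ _ h =>
  funext fun i => algebraMap_injective (congrFun h i)

theorem toLaurent_smul (a : A) (z : C.ι → MvPolynomial σ K) :
    toLaurent C (P.ψ a • z) = P.mulψ a (toLaurent C z) := by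
  funext i
  change algebraMap _ _ (P.ψ a * z i) = _
  rw [map_mul, ← Algebra.smul_def]
  rfl

omit [Fintype σ] in
theorem d_toLaurent (z : C.ι → MvPolynomial σ K) :
    C.d _ (toLaurent C z) = toLaurent C (C.d _ z) := C.d_algebraMap z

theorem d_mulψ (a : A) (v : C.ι → Laurent K σ) : C.d _ (P.mulψ a v) = P.mulψ a (C.d _ v) :=
  map_smul (C.d _) (P.ψ a) v

/-- The relation between families of Laurent polynomials and elements of the localization of `M`:
the fraction `z / s` is related to the fraction `π z / s`. -/
def locRel (B : Finset (Fin N)) (v : C.ι → Laurent K σ) (x : CechLoc y M B) : Prop :=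
  ∃ (s : denominators y B) (z : C.ι → MvPolynomial σ K), C.IsCycle c P.Θ P.κ z ∧
    toLaurent C z = P.mulψ s v ∧ x = LocalizedModule.mk (P.π z) s

variable {P} {B : Finset (Fin N)}

theorem locRel_zero : P.locRel B 0 0 :=
  ⟨1, 0, IsCycle.zero, by rw [map_zero, map_zero], by rw [π_zero, LocalizedModule.zero_mk]⟩

theorem locRel.smul {v : C.ι → Laurent K σ} {x : CechLoc y M B} (h : P.locRel B v x) (a : A) :
    P.locRel B (P.mulψ a v) (a • x) := by
  obtain ⟨s, z, hz, hzv, rfl⟩ := h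
  refine ⟨s, P.ψ a • z, P.isCycle_smul hz a, ?_, ?_⟩
  · rw [toLaurent_smul, hzv, ← mulψ_mul, ← mulψ_mul, mul_comm]
  · rw [P.π_smul a hz, LocalizedModule.smul'_mk]

theorem locRel.add {v v' : C.ι → Laurent K σ} {x x' : CechLoc y M B} (h : P.locRel B v x)
    (h' : P.locRel B v' x') : P.locRel B (v + v') (x + x') := by
  obtain ⟨s, z, hz, hzv, rfl⟩ := h
  obtain ⟨s', z', hz', hzv', rfl⟩ := h'
  refine ⟨s * s', P.ψ s' • z + P.ψ s • z', (P.isCycle_smul hz _).add (P.isCycle_smul hz' _), ?_, ?_⟩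
  · rw [map_add, toLaurent_smul, toLaurent_smul, hzv, hzv', map_add, ← mulψ_mul, ← mulψ_mul,
      mul_comm (s' : A), Submonoid.coe_mul]
  · rw [P.π_add (P.isCycle_smul hz _) (P.isCycle_smul hz' _), P.π_smul _ hz, P.π_smul _ hz',
      LocalizedModule.mk_add_mk]
    rfl

theorem locRel.smul_field [IsScalarTower K A M] {v : C.ι → Laurent K σ} {x : CechLoc y M B} (h : P.locRel B v x)
    (r : K) : P.locRel B (r • v) (r • x) := by
  have := h.smul (algebraMap K A r)
  rw [algebraMap_smul] at this
  convert this using 1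
  funext i
  rw [mulψ_apply, AlgHom.commutes, algebraMap_smul, Pi.smul_apply]

theorem locRel.sum {ι : Type*} (t : Finset ι) {v : ι → C.ι → Laurent K σ} {x : ι → CechLoc y M B}
    (h : ∀ j ∈ t, P.locRel B (v j) (x j)) : P.locRel B (∑ j ∈ t, v j) (∑ j ∈ t, x j) := by
  classical
  induction t using Finset.induction_on with
  | empty => exact locRel_zero
  | insert j t hj ih =>
    rw [Finset.sum_insert hj, Finset.sum_insert hj]
    exact (h j (Finset.mem_insert_self _ _)).add (ih fun j' hj' => h j' (Finset.mem_insert_of_mem hj'))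

theorem locRel.res {B' : Finset (Fin N)} (hB : B ⊆ B') {v : C.ι → Laurent K σ}
    {x : CechLoc y M B} (h : P.locRel B v x) : P.locRel B' v (cechRes y M hB x) := by
  obtain ⟨s, z, hz, hzv, rfl⟩ := h
  exact ⟨⟨s, denominators_mono y hB s.2⟩, z, hz, hzv, by
    rw [cechRes, IsLocalizedModule.mk_eq_mk', IsLocalizedModule.liftOfLE_mk',
      ← IsLocalizedModule.mk_eq_mk']⟩

theorem locRel.d_eq_zero {v : C.ι → Laurent K σ} {x : CechLoc y M B} (h : P.locRel B v x) :
    C.d _ v = 0 := by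
  obtain ⟨s, z, hz, hzv, rfl⟩ := h
  refine P.mulψ_injective s.2 ?_
  rw [← d_mulψ, ← hzv, d_toLaurent, hz.d_eq_zero, map_zero, map_zero]

/-- Division of a family of polynomials by a denominator. -/
theorem exists_mulψ_eq {s : A} (hs : s ∈ denominators y B) (z : C.ι → MvPolynomial σ K) :
    ∃ v, P.mulψ s v = toLaurent C z ∧ (∀ i e, coef e (v i) ≠ 0 → IsLocalExponent ε B e) ∧
      ∀ i, v i ≠ 0 → z i ≠ 0 := by
  obtain ⟨u, hu, hus⟩ := P.exists_monomial_of_mem_denominators hs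
  refine ⟨fun i => single (-expo u) 1 * algebraMap _ _ (z i), ?_, fun i e h =>
    isLocalExponent_single_mul ε hu h, fun i h h' => h (by
      change _ * algebraMap _ _ (z i) = _
      rw [h', map_zero, mul_zero])⟩
  funext i
  rw [mulψ_apply, hus, monomial_smul_single_mul]
  rfl

theorem locRel.of_ne_zero {v : C.ι → Laurent K σ} {x : CechLoc y M B} (h : P.locRel B v x)
    {i : C.ι} (hi : v i ≠ 0) : C.pos i = c := by
  obtain ⟨s, z, hz, hzv, rfl⟩ := h
  refine hz.pos_eq i fun h' => hi ?_
  obtain ⟨v', hv', -, hv''⟩ := exists_mulψ_eq (P := P) s.2 z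
  obtain rfl := P.mulψ_injective s.2 (hv'.trans hzv)
  by_contra hi
  exact hv'' i hi h'

theorem locRel.isLocalExponent {v : C.ι → Laurent K σ} {x : CechLoc y M B} (h : P.locRel B v x)
    {i : C.ι} {e : σ → ℤ} (he : coef e (v i) ≠ 0) : IsLocalExponent ε B e := by
  obtain ⟨s, z, hz, hzv, rfl⟩ := h
  obtain ⟨v', hv', hv'', -⟩ := exists_mulψ_eq (P := P) s.2 z
  obtain rfl := P.mulψ_injective s.2 (hv'.trans hzv)
  exact hv'' i e he

variable (P) in
theorem exists_locRel_left (x : CechLoc y M B) : ∃ v, P.locRel B v x := by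
  induction x using LocalizedModule.induction_on with
  | h m s =>
    obtain ⟨z, hz, rfl⟩ := P.exists_π_eq m
    obtain ⟨v, hv, -⟩ := exists_mulψ_eq (P := P) s.2 z
    exact ⟨v, s, z, hz, hv.symm, rfl⟩

theorem exists_clear {v : C.ι → Laurent K σ} {q : ℤ} (hpos : ∀ i, v i ≠ 0 → C.pos i = q)
    (hloc : ∀ i e, coef e (v i) ≠ 0 → IsLocalExponent ε B e) :
    ∃ s ∈ denominators y B, ∃ z, toLaurent C z = P.mulψ s v := by
  obtain ⟨u, hu, z, hz⟩ := exists_denominator ε B v ((C.finite_pos q).subset hpos) hloc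
  obtain ⟨s, hs, hsu⟩ := P.exists_mem_denominators hu
  exact ⟨s, hs, z, funext fun i => by rw [mulψ_apply, hsu, ← hz i]; rfl⟩

theorem of_toLaurent_eq {v : C.ι → Laurent K σ} {s : A} {z : C.ι → MvPolynomial σ K}
    (hzv : toLaurent C z = P.mulψ s v) {i : C.ι} {u : σ →₀ ℕ} (hu : (z i).coeff u ≠ 0) :
    ∃ u', (P.ψ s).coeff u' ≠ 0 ∧ coef (expo u - expo u') (v i) ≠ 0 := by
  rw [← coef_algebraMap_expo] at hu
  have : algebraMap _ (Laurent K σ) (z i) = P.ψ s • v i := congrFun hzv i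
  rw [this] at hu
  exact exists_of_coef_smul_ne_zero hu

-- Clearing denominators gives a cycle of polynomials; homogeneity of v together with `weight_mem`
-- keeps its weights in the strand κ + Θ.
variable (P) in
theorem exists_locRel_right {γ : Γ} (hγ : γ - P.κ ∈ P.Θ) {v : C.ι → Laurent K σ}
    (hpos : ∀ i, v i ≠ 0 → C.pos i = c)
    (hloc : ∀ i e, coef e (v i) ≠ 0 → IsLocalExponent ε B e)
    (hwt : ∀ i e, coef e (v i) ≠ 0 → wdeg w e = γ + C.wt i) (hd : C.d _ v = 0) :
    ∃ x, P.locRel B v x := by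
  obtain ⟨s, hs, z, hz⟩ := exists_clear (P := P) hpos hloc
  refine ⟨LocalizedModule.mk (P.π z) ⟨s, hs⟩, ⟨s, hs⟩, z, ⟨fun i hi => hpos i fun h => hi ?_, ?_, ?_⟩,
    hz, rfl⟩
  · refine algebraMap_injective (K := K) (σ := σ) ?_
    have := congrFun hz i
    rw [mulψ_apply, h, smul_zero] at this
    rw [map_zero]
    exact this
  · refine toLaurent_injective ?_
    rw [← d_toLaurent, hz, d_mulψ, hd, map_zero, map_zero]
  · intro i u hu
    obtain ⟨u', hu', h⟩ := of_toLaurent_eq hz hu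
    have h₁ := hwt i _ h
    rw [map_sub, sub_eq_iff_eq_add] at h₁
    rw [h₁, show γ + C.wt i + wdeg w (expo u') - (P.κ + C.wt i) =
      (γ - P.κ) + wdeg w (expo u') by abel]
    exact P.Θ.add_mem hγ (P.weight_mem s u' hu')

/-- If π z / s = 0, some denominator t kills π z, so ψ(t) z is a boundary over the polynomial ring.
Dividing its primitive by ts gives a primitive of v. -/
theorem locRel.exists_d_eq {v : C.ι → Laurent K σ} (h : P.locRel B v 0) :
    ∃ x, C.d _ x = v ∧ (∀ i, x i ≠ 0 → C.pos i = c - 1) ∧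
      ∀ i e, coef e (x i) ≠ 0 → IsLocalExponent ε B e := by
  obtain ⟨s, z, hz, hzv, h⟩ := h
  rw [← LocalizedModule.zero_mk 1, LocalizedModule.mk_eq] at h
  obtain ⟨t, ht⟩ := h
  have ht' : P.π (P.ψ t • z) = 0 := by
    rw [P.π_smul _ hz]
    simpa [Submonoid.smul_def] using ht.symm
  obtain ⟨x, hx, hxz⟩ := (P.π_eq_zero_iff (P.isCycle_smul hz t)).1 ht'
  obtain ⟨x', hx', hloc, hne⟩ := exists_mulψ_eq (P := P) (t * s).2 x
  refine ⟨x', ?_, fun i hi => hx i (hne i hi), hloc⟩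
  refine P.mulψ_injective (t * s).2 ?_
  rw [← d_mulψ, hx', d_toLaurent, hxz, toLaurent_smul, hzv, ← mulψ_mul, Submonoid.coe_mul]

theorem locRel.eq_zero {x : C.ι → Laurent K σ} {m : CechLoc y M B}
    (h : P.locRel B (C.d _ x) m) (hpos : ∀ i, x i ≠ 0 → C.pos i = c - 1)
    (hloc : ∀ i e, coef e (x i) ≠ 0 → IsLocalExponent ε B e) : m = 0 := by
  obtain ⟨s, z, hz, hzv, rfl⟩ := h
  obtain ⟨t, ht, x', hx'⟩ := exists_clear (P := P) hpos hloc
  rw [← LocalizedModule.zero_mk 1, LocalizedModule.mk_eq]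
  refine ⟨⟨t, ht⟩, ?_⟩
  have : P.π (P.ψ t • z) = 0 := by
    refine (P.π_eq_zero_iff (P.isCycle_smul hz t)).2 ⟨P.ψ s • x', fun i hi => hpos i fun h => ?_, ?_⟩
    · refine hi ?_
      rw [Pi.smul_apply, show x' i = 0 from algebraMap_injective (K := K) (σ := σ) ?_, smul_zero]
      have := congrFun hx' i
      rw [mulψ_apply, h, smul_zero] at this
      rw [map_zero]
      exact this
    · refine toLaurent_injective ?_
      rw [map_smul, toLaurent_smul, ← d_toLaurent, hx', toLaurent_smul, hzv, d_mulψ, ← mulψ_mul,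
        ← mulψ_mul, mul_comm]
  rw [P.π_smul _ hz] at this
  simpa [Submonoid.smul_def] using this

variable [IsScalarTower K A M]

theorem locRel.sub {v v' : C.ι → Laurent K σ} {x x' : CechLoc y M B} (h : P.locRel B v x)
    (h' : P.locRel B v' x') : P.locRel B (v - v') (x - x') := by
  have := h.add (h'.smul_field (-1))
  rwa [neg_one_smul, neg_one_smul, ← sub_eq_add_neg, ← sub_eq_add_neg] at this

theorem locRel.mem_cechLocPiece {v : C.ι → Laurent K σ} {x : CechLoc y M B} (h : P.locRel B v x)
    {μ : Λ} (hwt : ∀ i e, coef e (v i) ≠ 0 → wdeg w e = P.κ + P.lin μ + C.wt i) :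
    x ∈ cechLocPiece y 𝒜 𝓜 B μ := by
  obtain ⟨s, z, hz, hzv, rfl⟩ := h
  obtain ⟨δ, hδ⟩ := P.denominators_mem s.2
  refine Submodule.subset_span ⟨δ, s, _, hδ, P.π_mem hz fun i u hu => ?_, rfl⟩
  obtain ⟨u', hu', h⟩ := of_toLaurent_eq hzv hu
  have h₁ := hwt i _ h
  rw [map_sub, (mem_weightedHomogeneousSubmodule_iff w).1 (P.ψ_mem hδ) u' hu',
    sub_eq_iff_eq_add] at h₁
  rw [h₁, map_add]
  abel

variable (P) in
theorem exists_locRel_of_mem_cechLocPiece {μ : Λ} {x : CechLoc y M B}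
    (hx : x ∈ cechLocPiece y 𝒜 𝓜 B μ) : ∃ v, P.locRel B v x ∧
      ∀ i e, coef e (v i) ≠ 0 → wdeg w e = P.κ + P.lin μ + C.wt i := by
  induction hx using Submodule.span_induction with
  | mem x hx =>
    obtain ⟨δ, s, m, hs, hm, rfl⟩ := hx
    obtain ⟨z, hz, hhom, rfl⟩ := P.exists_π_eq_of_mem hm
    obtain ⟨v, hv, -⟩ := exists_mulψ_eq (P := P) s.2 z
    refine ⟨v, ⟨s, z, hz, hv.symm, rfl⟩, fun i e he => ?_⟩
    obtain ⟨u, -, hus⟩ := P.exists_monomial_of_mem_denominators s.2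
    have h₁ : wdeg w (expo u) = P.lin δ :=
      (mem_weightedHomogeneousSubmodule_iff w).1 (P.ψ_mem hs) u (by
        classical
        rw [hus, coeff_monomial, if_pos rfl]
        exact one_ne_zero)
    have h₂ : coef (e + expo u) (algebraMap _ (Laurent K σ) (z i)) ≠ 0 := by
      have : algebraMap _ (Laurent K σ) (z i) = P.ψ s • v i := (congrFun hv i).symm
      rwa [this, hus, coef_monomial_smul, add_sub_cancel_right]
    obtain ⟨u', hu', hz'⟩ := exists_expo_of_coef_ne_zero h₂
    have h₃ := hhom i u' hz'
    rw [hu', map_add, h₁, map_add] at h₃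
    rw [eq_sub_of_add_eq h₃]
    abel
  | zero => exact ⟨0, locRel_zero, fun i e he => absurd (map_zero _) he⟩
  | add x x' _ _ hx hx' =>
    obtain ⟨v, hv, hwt⟩ := hx
    obtain ⟨v', hv', hwt'⟩ := hx'
    refine ⟨v + v', hv.add hv', fun i e he => ?_⟩
    by_cases h : coef e (v i) = 0
    · exact hwt' i e fun h' => he (by rw [Pi.add_apply, map_add, h, h', add_zero])
    · exact hwt i e h
  | smul r x _ hx =>
    obtain ⟨v, hv, hwt⟩ := hx
    refine ⟨r • v, hv.smul_field r, fun i e he => hwt i e fun h' => he ?_⟩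
    rw [Pi.smul_apply, map_smul, h', smul_zero]

end Augmentation

end FreeComplex

end

end GradedLC


/-! ### Vertical cohomology of the Čech double complex as local cohomology. -/

namespace GradedLC

open MvPolynomial Laurent

noncomputable section

namespace FreeComplex

variable {K σ Γ : Type*} [Field K] [AddCommGroup Γ] {w : σ → Γ} [Fintype σ]
  {C : FreeComplex K w} {c : ℤ}
  {N : ℕ} {A M Λ : Type*} [CommRing A] [Algebra K A] [AddCommGroup M] [Module A M]
  [Module K M] [AddCommGroup Λ]

namespace Augmentation

variable {ε : Fin N → σ} {y : Fin N → A} {𝒜 : Λ → Submodule K A} {𝓜 : Λ → Submodule K M}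
  {P : C.Augmentation c ε y 𝒜 𝓜}

variable (P) in
/-- The relation between Čech cochains of the complex at position `c` and Čech cochains of `M`. -/
def cochainRel (a : C.Cochain N) (x : CechCochain y M) : Prop := ∀ B, P.locRel B (a B) (x B)

theorem cochainRel.mem_cechTerm {a : C.Cochain N} {x : CechCochain y M} (h : P.cochainRel a x)
    {p : ℤ} (hp : ∀ B : Finset (Fin N), (B.card : ℤ) ≠ p → a B = 0) :
    a ∈ C.cechTerm ε p c := by
  intro B i e he
  refine ⟨⟨?_, (h B).of_ne_zero fun h' => he (by rw [h', map_zero])⟩, (h B).isLocalExponent he⟩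
  by_contra hB
  exact he (by rw [hp B hB]; exact map_zero _)

theorem cochainRel.vertical_eq_zero {a : C.Cochain N} {x : CechCochain y M}
    (h : P.cochainRel a x) : C.vertical N a = 0 :=
  funext fun B => (h B).d_eq_zero

theorem exists_vertical_eq_of_cochainRel {a : C.Cochain N} (h : P.cochainRel a 0) {p : ℤ}
    (ha : a ∈ C.cechTerm ε p c) : ∃ b ∈ C.cechTerm ε p (c - 1), C.vertical N b = a := by
  have key : ∀ B, ∃ x : C.ι → Laurent K σ, C.d _ x = a B ∧ ∀ i e, coef e (x i) ≠ 0 →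
      ((B.card : ℤ) = p ∧ C.pos i = c - 1) ∧ IsLocalExponent ε B e := by
    intro B
    by_cases hB : (B.card : ℤ) = p
    · obtain ⟨x, hx, hpos, hloc⟩ := (h B).exists_d_eq
      exact ⟨x, hx, fun i e he => ⟨⟨hB, hpos i fun h' => he (by rw [h', map_zero])⟩, hloc i e he⟩⟩
    · refine ⟨0, ?_, fun i e he => absurd (map_zero _) he⟩
      rw [map_zero, eq_comm]
      funext i
      by_contra h
      exact hB (eq_zero_of_pos_ne ε ha h).1
  choose x hx hsupp using key
  exact ⟨x, fun B i e he => hsupp B i e he, funext hx⟩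

theorem cochainRel.eq_zero_of_vertical {b : C.Cochain N} {x : CechCochain y M}
    (h : P.cochainRel (C.vertical N b) x) {p : ℤ} (hb : b ∈ C.cechTerm ε p (c - 1)) : x = 0 :=
  funext fun B => (h B).eq_zero (fun _ hi => (eq_zero_of_pos_ne ε hb hi).2)
    fun i e he => (hb B i e he).2

variable (P) in
theorem exists_cochainRel_right {p : ℤ} {μ : Λ} {a : C.Cochain N}
    (ha : a ∈ (C.cech ε (P.κ + P.lin μ)).X p c) (hv : C.vertical N a = 0) :
    ∃ x ∈ cechDegree y M p, P.cochainRel a x := by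
  have key : ∀ B, ∃ x : CechLoc y M B, P.locRel B (a B) x ∧ ((B.card : ℤ) ≠ p → x = 0) := by
    intro B
    by_cases hB : (B.card : ℤ) = p
    · obtain ⟨x, hx⟩ := P.exists_locRel_right (B := B) (γ := P.κ + P.lin μ)
        (by rw [add_sub_cancel_left]; exact P.lin_mem μ) (v := a B)
        (fun i hi => (eq_zero_of_pos_ne ε ha.1 hi).2) (fun i e he => (ha.1 B i e he).2)
        (fun i e he => ha.2 B i e he) (congrFun hv B)
      exact ⟨x, hx, fun h => absurd hB h⟩
    · have : a B = 0 := funext fun i => by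
        by_contra h
        exact hB (eq_zero_of_pos_ne ε ha.1 h).1
      exact ⟨0, by rw [this]; exact locRel_zero, fun _ => rfl⟩
  choose x hx hx' using key
  exact ⟨x, hx', hx⟩

variable (P) in
theorem exists_cochainRel_left {p : ℤ} {x : CechCochain y M} (hx : x ∈ cechDegree y M p) :
    ∃ a ∈ C.cechTerm ε p c, P.cochainRel a x := by
  have key : ∀ B, ∃ v, P.locRel B v (x B) ∧ ((B.card : ℤ) ≠ p → v = 0) := by
    intro B
    by_cases hB : (B.card : ℤ) = p
    · obtain ⟨v, hv⟩ := P.exists_locRel_left (x B)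
      exact ⟨v, hv, fun h => absurd hB h⟩
    · exact ⟨0, by rw [hx B hB]; exact locRel_zero, fun _ => rfl⟩
  choose a ha ha' using key
  exact ⟨a, cochainRel.mem_cechTerm (P := P) (x := x) ha ha', ha⟩

variable [IsScalarTower K A M]

theorem cochainRel.mem_cechCochainPiece {a : C.Cochain N} {x : CechCochain y M}
    (h : P.cochainRel a x) {μ : Λ} (ha : a ∈ C.homogeneous N (P.κ + P.lin μ)) :
    x ∈ cechCochainPiece y 𝒜 𝓜 μ :=
  fun B _ => (h B).mem_cechLocPiece fun i e he => ha B i e he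

theorem cochainRel.horizontal {a : C.Cochain N} {x : CechCochain y M} (h : P.cochainRel a x) :
    P.cochainRel (C.horizontal N a) (cechD y M x) := by
  intro B
  have h₁ : C.horizontal N a B = ∑ b ∈ B, ((-1 : K) ^ below B b) • a (B.erase b) :=
    simplexD_apply a B
  have h₂ : cechD y M x B = ∑ b ∈ B, ((-1 : K) ^ below B b) •
      cechRes y M (B.erase_subset b) (x (B.erase b)) := by
    rw [cechD, LinearMap.pi_apply, LinearMap.sum_apply]
    refine Finset.sum_congr rfl fun b _ => ?_
    rw [LinearMap.smul_apply, ← algebraMap_smul A ((-1 : K) ^ below B b), map_pow, map_neg, map_one]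
    rfl
  rw [h₁, h₂]
  exact locRel.sum B fun b hb => ((h (B.erase b)).res (B.erase_subset b)).smul_field _

theorem cochainRel.sub {a a' : C.Cochain N} {x x' : CechCochain y M} (h : P.cochainRel a x)
    (h' : P.cochainRel a' x') : P.cochainRel (a - a') (x - x') := fun B => (h B).sub (h' B)

variable (P) in
theorem exists_cochainRel_of_mem {p : ℤ} {μ : Λ} {x : CechCochain y M}
    (hx : x ∈ cechDegree y M p) (hx' : x ∈ cechCochainPiece y 𝒜 𝓜 μ) :
    ∃ a ∈ (C.cech ε (P.κ + P.lin μ)).X p c, P.cochainRel a x := by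
  have key : ∀ B, ∃ v : C.ι → Laurent K σ, P.locRel B v (x B) ∧
      (∀ i e, coef e (v i) ≠ 0 → wdeg w e = P.κ + P.lin μ + C.wt i) ∧
      ((B.card : ℤ) ≠ p → v = 0) := by
    intro B
    by_cases hB : (B.card : ℤ) = p
    · obtain ⟨v, hv, hwt⟩ := P.exists_locRel_of_mem_cechLocPiece (hx' B trivial)
      exact ⟨v, hv, hwt, fun h => absurd hB h⟩
    · exact ⟨0, by rw [hx B hB]; exact locRel_zero, fun i e he => absurd (map_zero _) he,
        fun _ => rfl⟩
  choose a ha hwt ha' using key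
  exact ⟨a, ⟨cochainRel.mem_cechTerm (P := P) (x := x) ha ha', fun B i e he => hwt B i e he⟩, ha⟩

variable (P) in
/-- The relation between vertical cohomology at position `c` and the graded pieces of the local
cohomology of `M`. -/
def classRel (p : ℤ) (μ : Λ) :
    Submodule K (C.Cochain N × localCohomologyPiece y 𝒜 𝓜 p μ) where
  carrier := {a | a.1 ∈ (C.cech ε (P.κ + P.lin μ)).X p c ∧ ∃ x : cechCocycles y M p,
    P.cochainRel a.1 x ∧ Submodule.Quotient.mk x = (a.2 : LocalCohomology y M p)}
  zero_mem' := ⟨zero_mem _, 0, fun _ => locRel_zero, rfl⟩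
  add_mem' := fun ⟨ha, x, hx, hxa⟩ ⟨hb, x', hx', hxb⟩ => ⟨add_mem ha hb, x + x',
    fun B => (hx B).add (hx' B), by
      rw [Submodule.Quotient.mk_add, hxa, hxb]; rfl⟩
  smul_mem' := fun r _ ⟨ha, x, hx, hxa⟩ => ⟨Submodule.smul_mem _ r ha, r • x,
    fun B => (hx B).smul_field r, by
      rw [Submodule.Quotient.mk_smul, hxa]; rfl⟩

/-- Localization is exact, so the vertical cohomology at position c is the Čech complex of M. The
relation respects the horizontal differentials, hence it passes to cohomology. -/
theorem classRel_isCorrespondence (p : ℤ) (μ : Λ) :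
    IsCorrespondence (P.classRel p μ) ((C.cech ε (P.κ + P.lin μ)).colCocycles p c)
      ((C.cech ε (P.κ + P.lin μ)).colCoboundaries p c) ⊤ ⊥ where
  left_mem := fun {a h} ⟨ha, x, hx, hxh⟩ => by
    refine ⟨⟨ha, hx.vertical_eq_zero⟩, ?_⟩
    have h₁ := hx.horizontal
    rw [show cechD y M x = 0 from x.2.2] at h₁
    obtain ⟨b, hb, hba⟩ := exists_vertical_eq_of_cochainRel h₁
      (C.horizontal_mem_cechTerm ε ha.1)
    refine ⟨C.proj N _ b, C.proj_mem_cech_X ε hb, ?_⟩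
    change C.vertical N _ = C.horizontal N a
    rw [← proj_vertical, hba, C.proj_eq_self (C.horizontal_mem_homogeneous ha.2)]
  right_mem := fun _ => trivial
  exists_right := fun a ⟨⟨ha, hv⟩, b, hb, hba⟩ => by
    obtain ⟨x, hx, hax⟩ := P.exists_cochainRel_right ha hv
    have h₁ := hax.horizontal
    rw [show C.horizontal N a = C.vertical N b from hba.symm] at h₁
    have hxc : x ∈ cechCocycles y M p := ⟨hx, h₁.eq_zero_of_vertical hb.1⟩
    exact ⟨⟨Submodule.Quotient.mk ⟨x, hxc⟩, ⟨x, hxc⟩, cochainRel.mem_cechCochainPiece hax ha.2, rfl⟩,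
      ha, ⟨x, hxc⟩, hax, rfl⟩
  exists_left := fun ⟨h, x, hx, hxh⟩ _ => by
    obtain ⟨a, ha, hax⟩ := P.exists_cochainRel_of_mem x.2.1 hx
    exact ⟨a, ha, x, hax, hxh⟩
  mem_iff := fun {a h} ⟨ha, x, hx, hxh⟩ => by
    rw [Submodule.mem_bot, ← Submodule.coe_eq_zero, ← hxh, Submodule.Quotient.mk_eq_zero,
      DoubleComplex.mem_colCoboundaries]
    change _ ↔ (x : CechCochain y M) ∈ cechCoboundaries y M p
    constructor
    · rintro ⟨u, hu, hvu, b, hb, rfl⟩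
      obtain ⟨x', hx', hux⟩ := P.exists_cochainRel_right hu hvu
      have h₁ := hx.sub hux.horizontal
      rw [show (C.cech ε (P.κ + P.lin μ)).h u = C.horizontal N u from rfl,
        add_sub_cancel_left] at h₁
      exact ⟨x', hx', (sub_eq_zero.1 (h₁.eq_zero_of_vertical hb.1)).symm⟩
    · rintro ⟨x', hx', hxx⟩
      obtain ⟨u, hu, hux⟩ := P.exists_cochainRel_left hx'
      have h₁ := hx.sub hux.horizontal
      rw [hxx, sub_self] at h₁
      have hhu := C.horizontal_mem_cechTerm ε hu
      rw [sub_add_cancel] at hhu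
      obtain ⟨b, hb, hba⟩ := exists_vertical_eq_of_cochainRel h₁ (sub_mem ha.1 hhu)
      -- The coboundary in local cohomology need not come from a homogeneous cochain; since a is
      -- homogeneous, the components of degree γ of u and b still work.
      refine ⟨C.proj N _ u, C.proj_mem_cech_X ε hu, ?_, C.proj N _ b, C.proj_mem_cech_X ε hb, ?_⟩
      · change C.vertical N _ = 0
        rw [← proj_vertical, hux.vertical_eq_zero, map_zero]
      · change C.horizontal N _ + C.vertical N _ = a
        rw [← proj_horizontal, ← proj_vertical, ← map_add, hba, add_sub_cancel,
          C.proj_eq_self ha.2]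

/-- The relation is compatible with multiplication by homogeneous elements. -/
theorem smul_mem_classRel {p : ℤ} {μ μ' δ : Λ} (hμ : δ + μ = μ') {r : A} (hr : r ∈ 𝒜 δ)
    {a : C.Cochain N} {h : localCohomologyPiece y 𝒜 𝓜 p μ}
    (hah : (a, h) ∈ P.classRel p μ) (h' : localCohomologyPiece y 𝒜 𝓜 p μ')
    (hh' : (h' : LocalCohomology y M p) = r • (h : LocalCohomology y M p)) :
    ((fun B => P.mulψ r (a B)), h') ∈ P.classRel p μ' := by
  obtain ⟨ha, x, hx, hxh⟩ := hah
  refine ⟨⟨?_, ?_⟩, r • x, fun B => (hx B).smul r, ?_⟩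
  · intro B i e he
    obtain ⟨u, hu, he⟩ := exists_of_coef_smul_ne_zero he
    obtain ⟨h₁, h₂⟩ := ha.1 B i _ he
    exact ⟨h₁, isLocalExponent_of_sub ε h₂⟩
  · intro B i e he
    obtain ⟨u, hu, he⟩ := exists_of_coef_smul_ne_zero he
    have h₁ : wdeg w (e - expo u) = _ := ha.2 B i _ he
    rw [map_sub, (mem_weightedHomogeneousSubmodule_iff w).1 (P.ψ_mem hr) u hu,
      sub_eq_iff_eq_add] at h₁
    rw [h₁, ← hμ, map_add]
    abel
  · rw [Submodule.Quotient.mk_smul, hxh, hh']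

end Augmentation

end FreeComplex

end

end GradedLC


/-! ### The resolution of R and its dual as complexes of free modules. -/

namespace GradedLC

open MvPolynomial Laurent

universe u

noncomputable section

namespace GradedFreeResolution

variable {K : Type u} [Field K] {m n : ℕ} {d : Fin n → ℕ} {f : Fin n → PolyT K m}
  (F : GradedFreeResolution (gradingS K m d) (gradingRees f))

theorem mat_mul_mat (r : ℕ) : F.mat r * F.mat (r + 1) = 0 := by
  refine Matrix.ext_iff_mulVec.2 fun v => ?_
  have : (F.mat (r + 1)).mulVecLin v ∈ LinearMap.ker (F.mat r).mulVecLin := by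
    rw [F.exact_succ]; exact ⟨v, rfl⟩
  rw [Matrix.zero_mulVec, ← Matrix.mulVec_mulVec]
  exact this

theorem sum_smul_sum_smul {R V ι κ : Type*} [CommRing R] [AddCommGroup V] [Module R V] [Fintype ι]
    [Fintype κ] (a : ι → R) (b : κ → ι → R) (h : ∀ k, ∑ i, b k i * a i = 0) (z : κ → V) :
    ∑ i, a i • ∑ k, b k i • z k = 0 := by
  simp_rw [Finset.smul_sum]
  rw [Finset.sum_comm]
  refine Finset.sum_eq_zero fun k _ => ?_
  simp_rw [smul_smul, ← Finset.sum_smul, mul_comm (a _), h, zero_smul]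

theorem finite_sigma_fst (s : Set ℕ) (hs : s.Finite) :
    {i : Σ r, Fin (F.rank r) | i.1 ∈ s}.Finite := by
  refine (hs.biUnion fun r _ => Set.finite_range fun i : Fin (F.rank r) =>
    (⟨r, i⟩ : Σ r, Fin (F.rank r))).subset fun i hi => ?_
  exact Set.mem_biUnion hi ⟨i.2, rfl⟩

theorem sum_mat_smul {V : Type*} [AddCommGroup V] [Module (PolyS K m n) V] (r : ℕ)
    (i : Fin (F.rank r)) (z : Fin (F.rank (r + 1 + 1)) → V) :
    ∑ j, F.mat r i j • ∑ k, F.mat (r + 1) j k • z k = 0 := by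
  refine sum_smul_sum_smul (F.mat r i) (fun k j => F.mat (r + 1) j k) (fun k => ?_) z
  have := congrFun (congrFun (F.mat_mul_mat r) i) k
  rw [Matrix.mul_apply] at this
  rw [← Matrix.zero_apply (α := PolyS K m n) i k, ← this]
  exact Finset.sum_congr rfl fun j _ => mul_comm _ _

theorem sum_mat_transpose_smul {V : Type*} [AddCommGroup V] [Module (PolyS K m n) V] (r : ℕ)
    (i : Fin (F.rank (r + 1 + 1))) (z : Fin (F.rank r) → V) :
    ∑ j, F.mat (r + 1) j i • ∑ k, F.mat r k j • z k = 0 := by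
  refine sum_smul_sum_smul (fun j => F.mat (r + 1) j i) (F.mat r) (fun k => ?_) z
  have := congrFun (congrFun (F.mat_mul_mat r) k) i
  rwa [Matrix.mul_apply] at this

/-- The resolution as a complex of free modules, in nonpositive positions. -/
abbrev chainComplex : FreeComplex K (bidegree (n := n) m d) where
  ι := Σ r, Fin (F.rank r)
  pos i := -(i.1 : ℤ)
  wt i := -F.deg i.1 i.2
  cols i := F.rank (i.1 + 1)
  src i j := ⟨i.1 + 1, j⟩
  coeff i j := F.mat i.1 i.2 j
  pos_src i j := by push_cast; ring
  coeff_mem i j := by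
    have := F.mat_mem i.1 i.2 j
    rwa [show F.deg (i.1 + 1) j - F.deg i.1 i.2 = -F.deg i.1 i.2 - -F.deg (i.1 + 1) j by abel]
      at this
  finite_pos q := (F.finite_sigma_fst {q.natAbs} (Set.finite_singleton _)).subset fun i hi => by
    rw [Set.mem_ofPred_eq] at hi
    rw [Set.mem_ofPred_eq, Set.mem_singleton_iff]
    omega
  d_d z i := F.sum_mat_smul i.1 i.2 fun k => z ⟨i.1 + 1 + 1, k⟩

/-- The dual of the resolution as a complex of free modules, in nonnegative positions, with
weights shifted by `σ`. -/
abbrev dualComplex : FreeComplex K (bidegree (n := n) m d) where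
  ι := Σ r, Fin (F.rank r)
  pos i := i.1
  wt i := F.deg i.1 i.2 - sigma m d
  cols := fun
    | ⟨0, _⟩ => 0
    | ⟨r + 1, _⟩ => F.rank r
  src := fun
    | ⟨0, _⟩, j => j.elim0
    | ⟨r + 1, _⟩, j => ⟨r, j⟩
  coeff := fun
    | ⟨0, _⟩, j => j.elim0
    | ⟨r + 1, i⟩, j => F.mat r j i
  pos_src := fun
    | ⟨0, _⟩, j => j.elim0
    | ⟨r + 1, _⟩, j => by push_cast; rfl
  coeff_mem := fun
    | ⟨0, _⟩, j => j.elim0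
    | ⟨r + 1, i⟩, j => by
      have := F.mat_mem r j i
      rwa [show F.deg (r + 1) i - F.deg r j =
        (F.deg (r + 1) i - sigma m d) - (F.deg r j - sigma m d) by abel] at this
  finite_pos q := (F.finite_sigma_fst {q.natAbs} (Set.finite_singleton _)).subset fun i hi => by
    rw [Set.mem_ofPred_eq] at hi
    rw [Set.mem_ofPred_eq, Set.mem_singleton_iff]
    omega
  d_d z := fun
    | ⟨0, _⟩ => rfl
    | ⟨1, _⟩ => Finset.sum_eq_zero fun _ _ => smul_zero _
    | ⟨r + 1 + 1, i⟩ => F.sum_mat_transpose_smul r i fun k => z ⟨r, k⟩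

/-- Extension by zero of a family of coordinates at position `r`. -/
def extend {V : Type*} [Zero V] (r : ℕ) (z : Fin (F.rank r) → V) :
    (Σ r, Fin (F.rank r)) → V :=
  fun i => if h : i.1 = r then z (Fin.cast (congrArg F.rank h) i.2) else 0

section Extend

variable {F} {V : Type*}

theorem extend_mk [Zero V] (r : ℕ) (z : Fin (F.rank r) → V) (i : Fin (F.rank r)) :
    F.extend r z ⟨r, i⟩ = z i := by
  simp [extend]

theorem extend_of_ne [Zero V] {r : ℕ} (z : Fin (F.rank r) → V) {i : Σ r, Fin (F.rank r)}
    (h : i.1 ≠ r) : F.extend r z i = 0 := by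
  simp [extend, h]

theorem extend_eq [Zero V] {r : ℕ} {z : (Σ r, Fin (F.rank r)) → V}
    (hz : ∀ i, z i ≠ 0 → i.1 = r) : F.extend r (fun i => z ⟨r, i⟩) = z := by
  funext ⟨r', i⟩
  by_cases h : r' = r
  · subst h
    exact extend_mk _ _ _
  · rw [extend_of_ne _ h, eq_comm]
    by_contra h'
    exact h (hz _ h')

theorem extend_eq_zero_iff {r : ℕ} [Zero V] {z : Fin (F.rank r) → V} :
    F.extend r z = 0 ↔ z = 0 := by
  constructor
  · intro h
    funext i
    rw [← extend_mk r z i, h]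
    rfl
  · rintro rfl
    funext i
    simp [extend]

variable [AddCommGroup V] [Module (PolyS K m n) V]

theorem chainComplex_d_apply (z : F.chainComplex.ι → V) (r : ℕ) (i : Fin (F.rank r)) :
    F.chainComplex.d V z ⟨r, i⟩ = ∑ j, F.mat r i j • z ⟨r + 1, j⟩ :=
  F.chainComplex.d_apply z _

theorem dualComplex_d_zero (z : F.dualComplex.ι → V) (i : Fin (F.rank 0)) :
    F.dualComplex.d V z ⟨0, i⟩ = 0 :=
  F.dualComplex.d_apply z _

theorem dualComplex_d_succ (z : F.dualComplex.ι → V) (r : ℕ) (i : Fin (F.rank (r + 1))) :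
    F.dualComplex.d V z ⟨r + 1, i⟩ = ∑ j, F.mat r j i • z ⟨r, j⟩ :=
  F.dualComplex.d_apply z _

theorem chainComplex_d_extend (r : ℕ) (z : Fin (F.rank (r + 1)) → PolyS K m n) :
    F.chainComplex.d (PolyS K m n) (F.extend (r + 1) z) =
      F.extend r ((F.mat r).mulVecLin z) := by
  funext ⟨r', i⟩
  rw [chainComplex_d_apply]
  by_cases h : r' = r
  · subst h
    rw [extend_mk]
    simp_rw [extend_mk]
    rfl
  · rw [extend_of_ne _ h]
    refine Finset.sum_eq_zero fun j _ => ?_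
    rw [extend_of_ne _ (by simpa using h), smul_zero]

theorem dualComplex_d_extend (r : ℕ) (z : DualTerm F r) :
    F.dualComplex.d (PolyS K m n) (F.extend r z) = F.extend (r + 1) (dualD F r z) := by
  funext ⟨r', i⟩
  cases r' with
  | zero => rw [dualComplex_d_zero, extend_of_ne _ (by simp)]
  | succ r' =>
    rw [dualComplex_d_succ]
    by_cases h : r' = r
    · subst h
      rw [extend_mk]
      simp_rw [extend_mk]
      rfl
    · rw [extend_of_ne _ (by simpa using h)]
      refine Finset.sum_eq_zero fun j _ => ?_
      rw [extend_of_ne _ h, smul_zero]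

theorem mem_extCocycles_iff {r : ℕ} {z : DualTerm F r} :
    z ∈ extCocycles F r ↔ F.dualComplex.d (PolyS K m n) (F.extend r z) = 0 := by
  rw [dualComplex_d_extend, extend_eq_zero_iff]
  rfl

theorem mem_extCoboundaries_iff {r : ℕ} {z : DualTerm F r} :
    z ∈ extCoboundaries F r ↔ ∃ x : F.dualComplex.ι → PolyS K m n,
      (∀ i, x i ≠ 0 → F.dualComplex.pos i = r - 1) ∧
        F.dualComplex.d (PolyS K m n) x = F.extend r z := by
  cases r with
  | zero =>
    constructor
    · intro h
      obtain rfl : z = 0 := h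
      exact ⟨0, fun i hi => absurd rfl hi, by rw [map_zero, eq_comm, extend_eq_zero_iff]⟩
    -- There is nothing at position -1, which matches the convention that the coboundaries of degree
    -- 0 are zero.
    · rintro ⟨x, hx, hxz⟩
      have : x = 0 := funext fun i => by
        by_contra h
        have h' : (i.1 : ℤ) = (0 : ℕ) - 1 := hx i h
        omega
      rw [this, map_zero, eq_comm, extend_eq_zero_iff] at hxz
      exact hxz
  | succ r =>
    constructor
    · rintro ⟨x, rfl⟩
      refine ⟨F.extend r x, fun i hi => ?_, dualComplex_d_extend r x⟩
      by_contra h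
      refine hi (extend_of_ne _ fun h' => h ?_)
      change (i.1 : ℤ) = _
      rw [h']
      push_cast
      ring
    · rintro ⟨x, hx, hxz⟩
      refine ⟨fun i => x ⟨r, i⟩, ?_⟩
      have hx' : F.extend r (fun i => x ⟨r, i⟩) = x := extend_eq fun i hi => by
        have h' : (i.1 : ℤ) = (r + 1 : ℕ) - 1 := hx i hi
        push_cast at h'
        omega
      rw [← hx', dualComplex_d_extend] at hxz
      funext i
      have := congrFun hxz ⟨r + 1, i⟩
      rwa [extend_mk, extend_mk] at this

end Extend

theorem locallyExact_chainComplex {N : ℕ} (ε : Fin N → Fin m ⊕ Fin n) (B : Finset (Fin N)) {q : ℤ}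
    (hq : q ≠ 0) : F.chainComplex.LocallyExact ε B q := by
  intro z hz hd
  -- No denominator is needed: the resolution is already exact away from position 0.
  refine ⟨0, fun x hx => absurd rfl hx, ?_⟩
  rw [show monomial 0 (1 : K) = (1 : PolyS K m n) from rfl, one_smul]
  by_cases h : 0 < q
  · have : z = 0 := funext fun i => by
      by_contra h'
      have : -(i.1 : ℤ) = q := hz i h'
      omega
    exact ⟨0, fun i hi => absurd rfl hi, by rw [this, map_zero]⟩
  obtain ⟨r, rfl⟩ : ∃ r : ℕ, q = -((r + 1 : ℕ) : ℤ) := ⟨q.natAbs - 1, by omega⟩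
  have hz' : F.extend (r + 1) (fun i => z ⟨r + 1, i⟩) = z := extend_eq fun i hi => by
    have : -(i.1 : ℤ) = _ := hz i hi
    omega
  have hker : (fun i => z ⟨r + 1, i⟩) ∈ LinearMap.ker (F.mat r).mulVecLin := by
    rw [← hz', chainComplex_d_extend, extend_eq_zero_iff] at hd
    exact hd
  rw [F.exact_succ] at hker
  obtain ⟨y, hy⟩ := hker
  refine ⟨F.extend (r + 2) y, fun i hi => ?_, ?_⟩
  · by_contra h
    refine hi (extend_of_ne _ fun h' => h ?_)
    change -(i.1 : ℤ) = _
    rw [h']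
    push_cast
    ring
  · rw [chainComplex_d_extend, hy, hz']

/-- A power of a single y_b with b ∈ B kills each class outside degree n - 1, and such a power is an
admissible denominator. This fails to say anything for B = ∅, which is treated by degree reasons
instead. -/
theorem locallyExact_dualComplex (hI : genIdeal f ≠ ⊥)
    (hCM : ∀ (p : Ideal (Rees f)) [p.IsPrime], p ≠ reesMaximal f →
      IsCohenMacaulayLocal (Localization.AtPrime p)) {B : Finset (Fin n)} (hB : B.Nonempty) {q : ℤ}
    (hq : q ≠ (n - 1 : ℕ)) : F.dualComplex.LocallyExact Sum.inr B q := by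
  intro z hz hd
  by_cases h : q < 0
  · have : z = 0 := funext fun i => by
      by_contra h'
      have : (i.1 : ℤ) = q := hz i h'
      omega
    exact ⟨0, fun x hx => absurd rfl hx, 0, fun i hi => absurd rfl hi, by
      rw [this, map_zero, smul_zero]⟩
  lift q to ℕ using by omega
  have hz' : F.extend q (fun i => z ⟨q, i⟩) = z := extend_eq fun i hi => by
    have : (i.1 : ℤ) = _ := hz i hi
    omega
  obtain ⟨b, hb⟩ := hB
  obtain ⟨t, ht⟩ := exists_pow_smul_mem_extCoboundaries hI hCM F (by exact_mod_cast hq) b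
    (z := fun i => z ⟨q, i⟩) (by rw [mem_extCocycles_iff, hz', hd])
  obtain ⟨x, hx, hxz⟩ := mem_extCoboundaries_iff.1 ht
  refine ⟨Finsupp.single (Sum.inr b) t, fun x hx => ⟨b, hb, ?_⟩, x, hx, ?_⟩
  · by_contra h
    exact hx (Finsupp.single_eq_of_ne (Ne.symm h))
  · rw [hxz, ← X_pow_eq_monomial]
    funext ⟨r, i⟩
    by_cases h : r = q
    · subst h
      rw [extend_mk]
      rfl
    · rw [extend_of_ne _ h, Pi.smul_apply, ← hz', extend_of_ne _ h, smul_zero]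

end GradedFreeResolution

end

end GradedLC


/-! ### Bihomogeneity in the Rees algebra. -/

namespace GradedLC

open MvPolynomial Laurent

universe u

noncomputable section

theorem exists_mem_of_mem_denominators {K σ Γ : Type*} [Field K] [AddCommGroup Γ] (w : σ → Γ)
    {N : ℕ} (ε : Fin N → σ) {B : Finset (Fin N)} {s : MvPolynomial σ K}
    (hs : s ∈ denominators (fun b => X (ε b)) B) :
    ∃ δ, s ∈ weightedHomogeneousSubmodule K w δ := by
  induction hs using Submonoid.closure_induction with
  | mem s hs =>
    obtain ⟨b, -, rfl⟩ := hs
    exact ⟨_, isWeightedHomogeneous_X K w (ε b)⟩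
  | one => exact ⟨0, isWeightedHomogeneous_one K w⟩
  | mul s t _ _ hs ht =>
    obtain ⟨δ, hs⟩ := hs
    obtain ⟨δ', ht⟩ := ht
    exact ⟨δ + δ', IsWeightedHomogeneous.mul hs ht⟩

section Truncation

variable {K σ : Type*} [Field K]

open Classical in
/-- The part of a polynomial whose monomials lie in a given set. -/
def truncate (Q : Set (σ →₀ ℕ)) (s : MvPolynomial σ K) : MvPolynomial σ K :=
  ∑ u ∈ s.support with u ∈ Q, monomial u (s.coeff u)

theorem of_coeff_truncate_ne_zero {Q : Set (σ →₀ ℕ)} {s : MvPolynomial σ K} {u : σ →₀ ℕ}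
    (h : (truncate Q s).coeff u ≠ 0) : u ∈ Q := by
  classical
  rw [truncate, coeff_sum] at h
  obtain ⟨u', hu', h⟩ := Finset.exists_ne_zero_of_sum_ne_zero h
  rw [coeff_monomial] at h
  obtain rfl : u' = u := by
    by_contra h'
    exact h (if_neg h')
  exact (Finset.mem_filter.1 hu').2

theorem truncate_add (Q : Set (σ →₀ ℕ)) (s : MvPolynomial σ K) :
    truncate Q s + truncate Qᶜ s = s := by
  classical
  conv_rhs => rw [s.as_sum, ← Finset.sum_filter_add_sum_filter_not _ (· ∈ Q)]
  simp only [truncate, Set.mem_compl_iff]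

end Truncation

section Rees

variable {K : Type u} [Field K] {m n : ℕ} {d : Fin n → ℕ} {f : Fin n → PolyT K m}

/-- Elements of bidegree `γ` of `T[t]`. -/
def IsBihomogeneous (γ : ℤ × ℤ) (p : Polynomial (PolyT K m)) : Prop :=
  ∀ e : ℕ, p.coeff e ∈ gradingT K m γ.1 ∧ ((e : ℤ) ≠ γ.2 → p.coeff e = 0)

theorem isBihomogeneous_monomial {k : ℕ} {δ : ℤ} {a : PolyT K m} (ha : a ∈ gradingT K m δ) :
    IsBihomogeneous (δ, k) (Polynomial.monomial k a) := by
  intro e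
  rw [Polynomial.coeff_monomial]
  split_ifs with h
  · exact ⟨ha, fun h' => absurd (congrArg Nat.cast h.symm) h'⟩
  · exact ⟨Submodule.zero_mem _, fun _ => rfl⟩

theorem IsBihomogeneous.mul {γ δ : ℤ × ℤ} {p q : Polynomial (PolyT K m)}
    (hp : IsBihomogeneous γ p) (hq : IsBihomogeneous δ q) : IsBihomogeneous (γ + δ) (p * q) := by
  intro e
  rw [Polynomial.coeff_mul]
  refine ⟨Submodule.sum_mem _ fun x _ => IsWeightedHomogeneous.mul (hp x.1).1 (hq x.2).1,
    fun he => Finset.sum_eq_zero fun x hx => ?_⟩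
  by_cases h : (x.1 : ℤ) = γ.2
  · rw [(hq x.2).2, mul_zero]
    intro h'
    refine he ?_
    rw [← Finset.HasAntidiagonal.mem_antidiagonal.1 hx, Prod.snd_add, ← h, ← h']
    push_cast
    rfl
  · rw [(hp x.1).2 h, zero_mul]

/-- It suffices to look at variables, then at monomials. The homogeneity of f_j in degree d_j enters
through y_j ↦ f_j t. -/
theorem isBihomogeneous_toPolynomial (hf : ∀ j, (f j).IsHomogeneous (d j)) {γ : ℤ × ℤ}
    {s : PolyS K m n} (hs : s ∈ gradingS K m d γ) : IsBihomogeneous γ (toPolynomial f s) := by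
  have hX : ∀ v, IsBihomogeneous (bidegree m d v) (toPolynomial f (X v)) := by
    rintro (i | j)
    · rw [← rename_X (R := K) Sum.inl i, toPolynomial_rename]
      exact isBihomogeneous_monomial (k := 0) (X_mem_gradingT i)
    · rw [toPolynomial_X_inr]
      refine isBihomogeneous_monomial (k := 1) (δ := d j) ?_
      intro u hu
      have := hf j hu
      rw [Finsupp.weight_apply, Finsupp.sum_fintype _ _ (by simp)] at this ⊢
      rw [← this]
      push_cast
      exact Finset.sum_congr rfl fun i _ => by simp
  have hmon : ∀ u : Fin m ⊕ Fin n →₀ ℕ, IsBihomogeneous (Finsupp.weight (bidegree m d) u)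
      (toPolynomial f (monomial u 1)) := by
    intro u
    induction u using Finsupp.induction_linear with
    | zero =>
      rw [map_zero, monomial_zero', C_1, map_one]
      exact isBihomogeneous_monomial (k := 0) (isWeightedHomogeneous_one K _)
    | add u v hu hv =>
      rw [map_add, ← one_mul (1 : K), ← monomial_mul, map_mul]
      exact hu.mul hv
    | single v k =>
      rw [← X_pow_eq_monomial, map_pow, Finsupp.weight_single]
      induction k with
      | zero =>
        rw [zero_smul, pow_zero]
        exact isBihomogeneous_monomial (k := 0) (isWeightedHomogeneous_one K _)
      | succ k ih =>
        rw [succ_nsmul, pow_succ]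
        exact ih.mul (hX v)
  rw [s.as_sum, map_sum]
  intro e
  rw [Polynomial.finsetSum_coeff]
  have key : ∀ u ∈ s.support, IsBihomogeneous γ (toPolynomial f (monomial u (s.coeff u))) := by
    intro u hu
    have hu' : Finsupp.weight (bidegree m d) u = γ := hs (mem_support_iff.1 hu)
    rw [← hu', ← mul_one (s.coeff u), ← C_mul_monomial, map_mul, ← zero_add (Finsupp.weight _ u),
      ← rename_C Sum.inl, toPolynomial_rename]
    exact (isBihomogeneous_monomial (k := 0) (isWeightedHomogeneous_C _ _)).mul (hmon u)
  exact ⟨Submodule.sum_mem _ fun u hu => (key u hu e).1,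
    fun he => Finset.sum_eq_zero fun u hu => (key u hu e).2 he⟩

theorem toPoly_smul (s : PolyS K m n) (r : ReesModule f) :
    (s • r).toPoly = toPolynomial f s * r.toPoly := rfl

theorem smul_mem_gradingRees (hf : ∀ j, (f j).IsHomogeneous (d j)) {α γ : ℤ × ℤ} {s : PolyS K m n}
    {r : ReesModule f} (hs : s ∈ gradingS K m d α) (hr : r ∈ gradingRees f γ) :
    s • r ∈ gradingRees f (α + γ) :=
  (isBihomogeneous_toPolynomial hf hs).mul hr

/-- The coefficient at `t ^ k` of an element of the Rees algebra. -/
def reesCoeff (k : ℕ) : ReesModule f →ₗ[K] PolyT K m where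
  toFun r := r.toPoly.coeff k
  map_add' r s := Polynomial.coeff_add r.toPoly s.toPoly k
  map_smul' a r := Polynomial.coeff_smul a r.toPoly k

theorem reesCoeff_apply (k : ℕ) (r : ReesModule f) : reesCoeff k r = r.toPoly.coeff k := rfl

theorem reesCoeff_mem (k : ℕ) (r : ReesModule f) : reesCoeff k r ∈ genIdeal f ^ k :=
  (mem_reesAlgebra_iff _ _).1 (Subtype.prop (p := fun q => q ∈ reesAlgebra (genIdeal f)) r) k

theorem reesCoeff_rename_smul (k : ℕ) (a : PolyT K m) (r : ReesModule f) :
    reesCoeff k ((rename Sum.inl a : PolyS K m n) • r) = a * reesCoeff k r := by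
  rw [reesCoeff_apply, toPoly_smul, toPolynomial_rename, Polynomial.coeff_C_mul]
  rfl

end Rees

end

end GradedLC


/-! ### The canonical module as cohomology of the dual complex. -/

namespace GradedLC

open MvPolynomial Laurent

universe u

noncomputable section

namespace GradedFreeResolution

variable {K : Type u} [Field K] {m n : ℕ} {d : Fin n → ℕ} {f : Fin n → PolyT K m}
  (F : GradedFreeResolution (gradingS K m d) (gradingRees f))

open Classical in
/-- The class in the canonical module of a family of coordinates. -/
def canonicalClass (z : F.dualComplex.ι → PolyS K m n) : CanonicalModule F :=
  -- The value 0 off the cocycles is a mere default; the axioms of an `Augmentation` involve cycles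
  -- only.
  if h : (fun i => z ⟨n - 1, i⟩) ∈ extCocycles F (n - 1) then Submodule.Quotient.mk ⟨_, h⟩ else 0

variable {F}

theorem extend_eq_of_isCycle {Θ : AddSubgroup (ℤ × ℤ)} {κ : ℤ × ℤ} {q : ℕ}
    {z : F.dualComplex.ι → PolyS K m n} (hz : F.dualComplex.IsCycle q Θ κ z) :
    F.extend q (fun i => z ⟨q, i⟩) = z :=
  extend_eq fun i hi => by
    have : (i.1 : ℤ) = _ := hz.pos_eq i hi
    omega

theorem mem_extCocycles_of_isCycle {Θ : AddSubgroup (ℤ × ℤ)} {κ : ℤ × ℤ} {q : ℕ}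
    {z : F.dualComplex.ι → PolyS K m n} (hz : F.dualComplex.IsCycle q Θ κ z) :
    (fun i => z ⟨q, i⟩) ∈ extCocycles F q := by
  rw [mem_extCocycles_iff, extend_eq_of_isCycle hz, hz.d_eq_zero]

theorem isCycle_extend {q : ℕ} {z : DualTerm F q} (hz : z ∈ extCocycles F q) (κ : ℤ × ℤ) :
    F.dualComplex.IsCycle q ⊤ κ (F.extend q z) where
  pos_eq := fun i hi => by
    by_contra h
    exact hi (extend_of_ne _ fun h' => h (congrArg Nat.cast h'))
  d_eq_zero := mem_extCocycles_iff.1 hz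
  weight_mem := fun _ _ _ => AddSubgroup.mem_top _

theorem canonicalClass_eq {z : F.dualComplex.ι → PolyS K m n}
    (hz : (fun i => z ⟨n - 1, i⟩) ∈ extCocycles F (n - 1)) :
    F.canonicalClass z = Submodule.Quotient.mk ⟨_, hz⟩ := dif_pos hz

theorem canonicalClass_extend {z : DualTerm F (n - 1)} (hz : z ∈ extCocycles F (n - 1)) :
    F.canonicalClass (F.extend (n - 1) z) = Submodule.Quotient.mk ⟨z, hz⟩ := by
  have h : (fun i => F.extend (n - 1) z ⟨n - 1, i⟩) = z := funext (extend_mk _ _)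
  rw [canonicalClass_eq (by rwa [h])]
  congr 2

theorem extend_isHomogeneousFamily {γ : ℤ × ℤ} {q : ℕ} {z : DualTerm F q}
    (hz : z ∈ dualPiece F (sigma m d) q γ) :
    F.dualComplex.IsHomogeneousFamily γ (F.extend q z) := by
  rintro ⟨r, i⟩ u hu
  by_cases h : r = q
  · subst h
    rw [extend_mk] at hu
    have := (mem_weightedHomogeneousSubmodule_iff _).1 (hz i (Set.mem_univ i)) u hu
    rw [this, add_sub_assoc]
  · rw [extend_of_ne _ h] at hu
    exact absurd (coeff_zero _) hu

variable (F) in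
/-- The canonical module as the cohomology of the dual of the resolution. -/
def canonicalAugmentation : F.dualComplex.Augmentation (n - 1 : ℕ) Sum.inr
    (fun b : Fin n => (X (Sum.inr b) : PolyS K m n)) (gradingS K m d) (canonicalPiece F) where
  ψ := AlgHom.id K _
  ψ_y _ := rfl
  Θ := ⊤
  κ := 0
  lin := AddMonoidHom.id _
  lin_mem _ := AddSubgroup.mem_top _
  weight_mem _ _ _ := AddSubgroup.mem_top _
  ψ_mem h := h
  denominators_mem hs := exists_mem_of_mem_denominators _ _ hs
  π := F.canonicalClass
  π_add hz hz' := by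
    rw [canonicalClass_eq (mem_extCocycles_of_isCycle hz),
      canonicalClass_eq (mem_extCocycles_of_isCycle hz'),
      canonicalClass_eq (mem_extCocycles_of_isCycle (hz.add hz'))]
    rfl
  π_smul a hz := by
    rw [canonicalClass_eq (mem_extCocycles_of_isCycle hz), canonicalClass_eq
      (mem_extCocycles_of_isCycle (hz.smul fun _ _ => AddSubgroup.mem_top _))]
    rfl
  exists_π_eq x := by
    obtain ⟨⟨z, hz⟩, rfl⟩ := Submodule.Quotient.mk_surjective _ x
    exact ⟨_, isCycle_extend hz _, canonicalClass_extend hz⟩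
  π_eq_zero_iff {z} hz := by
    rw [canonicalClass_eq (mem_extCocycles_of_isCycle hz), Submodule.Quotient.mk_eq_zero]
    change (fun i => z ⟨n - 1, i⟩) ∈ extCoboundaries F (n - 1) ↔ _
    rw [mem_extCoboundaries_iff, extend_eq_of_isCycle hz]
  exists_π_eq_of_mem h := by
    obtain ⟨⟨z, hz⟩, hzμ, rfl⟩ := h
    exact ⟨_, isCycle_extend hz _, by
      rw [zero_add]; exact extend_isHomogeneousFamily hzμ, canonicalClass_extend hz⟩
  π_mem {μ z} hz hzμ := by
    rw [canonicalClass_eq (mem_extCocycles_of_isCycle hz)]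
    refine ⟨⟨_, mem_extCocycles_of_isCycle hz⟩, fun i _ => ?_, rfl⟩
    refine (mem_weightedHomogeneousSubmodule_iff _).2 fun u hu => ?_
    refine (hzμ ⟨n - 1, i⟩ u hu).trans ?_
    rw [zero_add, add_sub_assoc]
    rfl

end GradedFreeResolution

end

end GradedLC


/-! ### The powers of I as strands of the resolution. -/

namespace GradedLC

open MvPolynomial Laurent

universe u

noncomputable section

namespace GradedFreeResolution

variable {K : Type u} [Field K] {m n : ℕ} {d : Fin n → ℕ} {f : Fin n → PolyT K m}
  (F : GradedFreeResolution (gradingS K m d) (gradingRees f))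

/-- The image in the Rees algebra of a family of coordinates. -/
def reesSum : (Fin (F.rank 0) → PolyS K m n) →ₗ[PolyS K m n] ReesModule f :=
  Fintype.linearCombination (PolyS K m n) F.gen

variable {F}

theorem reesSum_apply (z : Fin (F.rank 0) → PolyS K m n) :
    F.reesSum z = ∑ i, z i • F.gen i := Fintype.linearCombination_apply ..

theorem smul_gen_mem (hf : ∀ j, (f j).IsHomogeneous (d j)) (i : Fin (F.rank 0))
    (u : Fin m ⊕ Fin n →₀ ℕ) (c : K) : (monomial u c : PolyS K m n) • F.gen i ∈
      gradingRees f (wdeg (bidegree m d) (expo u) + F.deg 0 i) := by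
  refine smul_mem_gradingRees hf ?_ (F.gen_mem i)
  rw [wdeg_expo]
  exact isWeightedHomogeneous_monomial _ _ _ rfl

theorem reesSum_mem (hf : ∀ j, (f j).IsHomogeneous (d j)) {z : Fin (F.rank 0) → PolyS K m n}
    {γ : ℤ × ℤ}
    (hz : ∀ i u, (z i).coeff u ≠ 0 → wdeg (bidegree m d) (expo u) + F.deg 0 i = γ) :
    F.reesSum z ∈ gradingRees f γ := by
  rw [reesSum_apply]
  refine Submodule.sum_mem _ fun i _ => ?_
  rw [(z i).as_sum, Finset.sum_smul]
  refine Submodule.sum_mem _ fun u hu => ?_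
  rw [← hz i u (mem_support_iff.1 hu)]
  exact smul_gen_mem hf i u _

section Additive

variable {V : Type*} [AddCommGroup V] {Φ : ReesModule f →+ V} {Q : Set (ℤ × ℤ)}

theorem map_reesSum_eq_zero (hf : ∀ j, (f j).IsHomogeneous (d j))
    (hΦ : ∀ γ ∉ Q, ∀ r ∈ gradingRees f γ, Φ r = 0) {z : Fin (F.rank 0) → PolyS K m n}
    (hz : ∀ i u, (z i).coeff u ≠ 0 → wdeg (bidegree m d) (expo u) + F.deg 0 i ∉ Q) :
    Φ (F.reesSum z) = 0 := by
  rw [reesSum_apply, map_sum]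
  refine Finset.sum_eq_zero fun i _ => ?_
  rw [(z i).as_sum, Finset.sum_smul, map_sum]
  exact Finset.sum_eq_zero fun u hu =>
    hΦ _ (hz i u (mem_support_iff.1 hu)) _ (smul_gen_mem hf i u _)

variable (F Q) in
/-- The part of a family of coordinates whose degrees lie in `Q`. -/
def truncateFamily (z : Fin (F.rank 0) → PolyS K m n) : Fin (F.rank 0) → PolyS K m n :=
  fun i => truncate {u | wdeg (bidegree m d) (expo u) + F.deg 0 i ∈ Q} (z i)

theorem of_coeff_truncateFamily_ne_zero {z : Fin (F.rank 0) → PolyS K m n} {i : Fin (F.rank 0)}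
    {u : Fin m ⊕ Fin n →₀ ℕ} (h : (F.truncateFamily Q z i).coeff u ≠ 0) :
    wdeg (bidegree m d) (expo u) + F.deg 0 i ∈ Q := of_coeff_truncate_ne_zero h

/-- Terms of degree outside Q are invisible to Φ. This makes a preimage in F₀ homogeneous without
changing the coefficient of interest. -/
theorem map_reesSum_truncateFamily (hf : ∀ j, (f j).IsHomogeneous (d j))
    (hΦ : ∀ γ ∉ Q, ∀ r ∈ gradingRees f γ, Φ r = 0) (z : Fin (F.rank 0) → PolyS K m n) :
    Φ (F.reesSum (F.truncateFamily Q z)) = Φ (F.reesSum z) := by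
  have h : z = F.truncateFamily Q z +
      fun i => truncate {u | wdeg (bidegree m d) (expo u) + F.deg 0 i ∈ Q}ᶜ (z i) :=
    funext fun i => (truncate_add _ _).symm
  conv_rhs => rw [h, map_add, map_add]
  rw [left_eq_add]
  exact map_reesSum_eq_zero hf hΦ fun i u hu => of_coeff_truncate_ne_zero hu

end Additive

theorem reesCoeff_eq_zero {k : ℕ} {γ : ℤ × ℤ} (hγ : γ.2 ≠ k) {r : ReesModule f}
    (hr : r ∈ gradingRees f γ) : reesCoeff k r = 0 := (hr k).2 hγ.symm

variable (F) in
/-- The class in `I ^ k` of a family of coordinates. -/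
def powClass (k : ℕ) (z : F.chainComplex.ι → PolyS K m n) : ↥(genIdeal f ^ k) :=
  ⟨reesCoeff k (F.reesSum fun i => z ⟨0, i⟩), reesCoeff_mem k _⟩

theorem exists_reesSum_eq (k : ℕ) (x : ↥(genIdeal f ^ k)) :
    ∃ z, (F.reesSum z).toPoly = Polynomial.monomial k (x : PolyT K m) := by
  have h : (show ReesModule f from
      (⟨Polynomial.monomial k x.1, reesAlgebra.monomial_mem.2 x.2⟩ : Rees f)) ∈
      LinearMap.range F.reesSum := by
    rw [reesSum, F.gen_surjective]
    exact Submodule.mem_top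
  obtain ⟨z, hz⟩ := h
  exact ⟨z, congrArg ReesModule.toPoly hz⟩

/-- The bidegrees whose second component is zero. -/
def sndKer : AddSubgroup (ℤ × ℤ) := (AddMonoidHom.snd ℤ ℤ).ker

theorem mem_sndKer {γ : ℤ × ℤ} : γ ∈ sndKer ↔ γ.2 = 0 := Iff.rfl

theorem isCycle_chain_extend {k : ℕ} {z : Fin (F.rank 0) → PolyS K m n}
    (hz : ∀ i u, (z i).coeff u ≠ 0 → (wdeg (bidegree m d) (expo u) + F.deg 0 i).2 = k) :
    F.chainComplex.IsCycle 0 sndKer (0, k) (F.extend 0 z) where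
  pos_eq := fun i hi => by
    by_contra h
    refine hi (extend_of_ne _ fun h' => h ?_)
    change -(i.1 : ℤ) = 0
    rw [h', Nat.cast_zero, neg_zero]
  d_eq_zero := by
    funext ⟨r, i⟩
    rw [chainComplex_d_apply]
    refine Finset.sum_eq_zero fun j _ => ?_
    rw [extend_of_ne _ (by simp), smul_zero]
  weight_mem := by
    rintro ⟨r, i⟩ u hu
    by_cases h : r = 0
    · subst h
      rw [extend_mk] at hu
      have := hz i u hu
      rw [Prod.snd_add] at this
      rw [mem_sndKer]
      change _ - ((k : ℤ) + -(F.deg 0 i).2) = 0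
      linarith
    · rw [extend_of_ne _ h] at hu
      exact absurd (coeff_zero _) hu

theorem powClass_extend (k : ℕ) (z : Fin (F.rank 0) → PolyS K m n) :
    (F.powClass k (F.extend 0 z) : PolyT K m) = reesCoeff k (F.reesSum z) := by
  have : (fun i => F.extend 0 z ⟨0, i⟩) = z := funext (extend_mk _ _)
  rw [← this]
  rfl

theorem chain_extend_eq_of_isCycle {Θ : AddSubgroup (ℤ × ℤ)} {κ : ℤ × ℤ}
    {z : F.chainComplex.ι → PolyS K m n} (hz : F.chainComplex.IsCycle 0 Θ κ z) :
    F.extend 0 (fun i => z ⟨0, i⟩) = z :=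
  extend_eq fun i hi => by
    have : -(i.1 : ℤ) = 0 := hz.pos_eq i hi
    omega

theorem snd_eq_of_isCycle {k : ℕ} {z : F.chainComplex.ι → PolyS K m n}
    (hz : F.chainComplex.IsCycle 0 sndKer (0, k) z) (i : Fin (F.rank 0)) (u : Fin m ⊕ Fin n →₀ ℕ)
    (hu : (z ⟨0, i⟩).coeff u ≠ 0) :
    (wdeg (bidegree m d) (expo u) + F.deg 0 i).2 = k := by
  have : _ - ((k : ℤ) + -(F.deg 0 i).2) = 0 := hz.weight_mem ⟨0, i⟩ u hu
  rw [Prod.snd_add]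
  linarith

theorem reesSum_eq_zero_iff (z : Fin (F.rank 0) → PolyS K m n) :
    F.reesSum z = 0 ↔ ∃ x : F.chainComplex.ι → PolyS K m n,
      (∀ i, x i ≠ 0 → F.chainComplex.pos i = 0 - 1) ∧
        F.chainComplex.d (PolyS K m n) x = F.extend 0 z := by
  rw [← LinearMap.mem_ker, reesSum, F.exact_zero]
  constructor
  · rintro ⟨x, rfl⟩
    refine ⟨F.extend 1 x, fun i hi => ?_, chainComplex_d_extend 0 x⟩
    by_contra h
    refine hi (extend_of_ne _ fun h' => h ?_)
    change -(i.1 : ℤ) = _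
    rw [h']
    norm_num
  · rintro ⟨x, hx, hxz⟩
    refine ⟨fun i => x ⟨1, i⟩, ?_⟩
    have hx' : F.extend 1 (fun i => x ⟨1, i⟩) = x := extend_eq fun i hi => by
      have : -(i.1 : ℤ) = _ := hx i hi
      omega
    rw [← hx', chainComplex_d_extend 0] at hxz
    funext i
    have := congrFun hxz ⟨0, i⟩
    rwa [extend_mk, extend_mk] at this

/-- Coordinates in the strand of y-degree k have image in I^k t^k, so the coefficient at t^k
determines the image. -/
theorem powClass_eq_zero_iff (hf : ∀ j, (f j).IsHomogeneous (d j)) {k : ℕ}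
    {z : F.chainComplex.ι → PolyS K m n} (hz : F.chainComplex.IsCycle 0 sndKer (0, k) z) :
    F.powClass k z = 0 ↔ F.reesSum (fun i => z ⟨0, i⟩) = 0 := by
  constructor
  · intro h
    refine Subtype.ext (Polynomial.ext fun e => ?_)
    change reesCoeff e (F.reesSum _) = 0
    by_cases he : e = k
    · rw [he]
      exact congrArg Subtype.val h
    · refine map_reesSum_eq_zero (Φ := (reesCoeff e).toAddMonoidHom) (Q := {γ | γ.2 = (e : ℤ)}) hf
        (fun γ hγ r hr => reesCoeff_eq_zero hγ hr) fun i u hu => ?_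
      rw [Set.mem_ofPred_eq, snd_eq_of_isCycle hz i u hu]
      omega
  · intro h
    refine Subtype.ext ?_
    change reesCoeff k (F.reesSum _) = 0
    rw [h, map_zero]

theorem weight_mapDomain_inl (d : Fin n → ℕ) (v : Fin m →₀ ℕ) :
    Finsupp.weight (bidegree m d) (v.mapDomain Sum.inl) =
      (Finsupp.weight (fun _ => (1 : ℤ)) v, 0) := by
  induction v using Finsupp.induction_linear with
  | zero => rw [Finsupp.mapDomain_zero, map_zero, map_zero]; rfl
  | add u v hu hv => rw [Finsupp.mapDomain_add, map_add, hu, hv, map_add, Prod.mk_add_mk, add_zero]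
  | single i c => simp [Finsupp.mapDomain_single, Finsupp.weight_single, bidegree]

variable (F) in
/-- The power `I ^ k` as the homology of the resolution. -/
def powAugmentation (hf : ∀ j, (f j).IsHomogeneous (d j)) (k : ℕ) :
    F.chainComplex.Augmentation 0 Sum.inl (X : Fin m → PolyT K m) (gradingT K m)
      (gradingPow f k) where
  ψ := rename Sum.inl
  ψ_y _ := rename_X _ _
  Θ := sndKer
  κ := (0, k)
  lin := AddMonoidHom.inl ℤ ℤ
  lin_mem _ := rfl
  weight_mem a u hu := by
    obtain ⟨v, rfl, -⟩ := coeff_rename_ne_zero _ _ _ hu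
    rw [mem_sndKer, wdeg_expo, weight_mapDomain_inl]
  ψ_mem {δ a} h := by
    refine (mem_weightedHomogeneousSubmodule_iff _).2 fun u hu => ?_
    obtain ⟨v, rfl, hv⟩ := coeff_rename_ne_zero _ _ _ hu
    rw [wdeg_expo, weight_mapDomain_inl, h hv]
    rfl
  denominators_mem hs := exists_mem_of_mem_denominators (fun _ => (1 : ℤ)) id hs
  π := F.powClass k
  π_add {z z'} _ _ := Subtype.ext <| by
    change reesCoeff k (F.reesSum ((fun i => z ⟨0, i⟩) + fun i => z' ⟨0, i⟩)) = _
    rw [map_add, map_add]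
    rfl
  π_smul {z} a _ := Subtype.ext <| by
    change reesCoeff k (F.reesSum ((rename Sum.inl a : PolyS K m n) • fun i => z ⟨0, i⟩)) = _
    rw [map_smul, reesCoeff_rename_smul]
    rfl
  exists_π_eq x := by
    obtain ⟨z, hz⟩ := F.exists_reesSum_eq k x
    refine ⟨F.extend 0 (F.truncateFamily {γ | γ.2 = (k : ℤ)} z),
      isCycle_chain_extend fun i u hu => of_coeff_truncateFamily_ne_zero hu, Subtype.ext ?_⟩
    rw [powClass_extend]
    refine (map_reesSum_truncateFamily (Φ := (reesCoeff k).toAddMonoidHom) hf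
      (fun γ hγ r hr => reesCoeff_eq_zero hγ hr) z).trans ?_
    change (F.reesSum z).toPoly.coeff k = _
    rw [hz, Polynomial.coeff_monomial, if_pos rfl]
  π_eq_zero_iff {z} hz := by
    rw [powClass_eq_zero_iff hf hz, reesSum_eq_zero_iff, chain_extend_eq_of_isCycle hz]
  exists_π_eq_of_mem {j x} hx := by
    obtain ⟨z, hz⟩ := F.exists_reesSum_eq k x
    have hcoeff : reesCoeff k (F.reesSum z) = x := by
      rw [reesCoeff_apply, hz, Polynomial.coeff_monomial, if_pos rfl]
    have hQ : ∀ i u, (F.truncateFamily {(j, (k : ℤ))} z i).coeff u ≠ 0 →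
        wdeg (bidegree m d) (expo u) + F.deg 0 i = (j, (k : ℤ)) :=
      fun i u hu => of_coeff_truncateFamily_ne_zero hu
    refine ⟨F.extend 0 (F.truncateFamily {(j, (k : ℤ))} z),
      isCycle_chain_extend fun i u hu => by rw [hQ i u hu], ?_, Subtype.ext ?_⟩
    · rintro ⟨r, i⟩ u hu
      by_cases h : r = 0
      · subst h
        rw [extend_mk] at hu
        rw [eq_sub_of_add_eq (hQ i u hu), sub_eq_add_neg]
        congr 1
        simp
      · rw [extend_of_ne _ h] at hu
        exact absurd (coeff_zero _) hu
    · rw [powClass_extend]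
      -- The functional is the component of degree j of the coefficient at t^k; it vanishes on all
      -- bidegrees other than (j, k).
      have h := map_reesSum_truncateFamily (Φ := ((weightedHomogeneousComponent
        (fun _ : Fin m => (1 : ℤ)) j).comp (reesCoeff k)).toAddMonoidHom) (Q := {(j, (k : ℤ))}) hf
        (fun γ hγ r hr => ?_) z
      · have h' : reesCoeff k (F.reesSum (F.truncateFamily {(j, (k : ℤ))} z)) ∈ gradingT K m j :=
          (reesSum_mem hf hQ k).1
        change weightedHomogeneousComponent _ j (reesCoeff k _) =
          weightedHomogeneousComponent _ j (reesCoeff k _) at h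
        have hx' : (x : PolyT K m) ∈ gradingT K m j := hx
        rwa [hcoeff, weightedHomogeneousComponent_of_mem h', weightedHomogeneousComponent_of_mem hx',
          if_pos rfl, if_pos rfl] at h
      · change weightedHomogeneousComponent _ j (reesCoeff k r) = 0
        by_cases hγk : γ.2 = k
        · have hr' : reesCoeff k r ∈ gradingT K m γ.1 := (hr k).1
          rw [weightedHomogeneousComponent_of_mem hr', if_neg]
          rintro rfl
          exact hγ (Prod.ext rfl hγk)
        · rw [reesCoeff_eq_zero hγk hr, map_zero]
  π_mem {j z} hz hzj := by
    have : F.reesSum (fun i => z ⟨0, i⟩) ∈ gradingRees f (j, k) := by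
      refine reesSum_mem hf fun i u hu => ?_
      rw [hzj ⟨0, i⟩ u hu]
      change _ + -F.deg 0 i + F.deg 0 i = _
      rw [neg_add_cancel_right]
      simp
    exact (this k).1

end GradedFreeResolution

end

end GradedLC


/-! ### The edge isomorphisms of the two double complexes. -/

namespace GradedLC

open MvPolynomial Laurent

universe u

noncomputable section

namespace FreeComplex

variable {K σ Γ : Type*} [Field K] [AddCommGroup Γ] {w : σ → Γ}
  (C : FreeComplex K w) {N : ℕ} (ε : Fin N → σ)

variable (N) in
/-- Multiplication of cochains by a polynomial. -/
def mulCochain (s : MvPolynomial σ K) : C.Cochain N →ₗ[K] C.Cochain N :=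
  DistribSMul.toLinearMap K (C.Cochain N) s

variable {C}

theorem mulCochain_apply (s : MvPolynomial σ K) (a : C.Cochain N) (B : Finset (Fin N)) (i : C.ι) :
    C.mulCochain N s a B i = s • a B i := rfl

theorem horizontal_mulCochain (s : MvPolynomial σ K) (a : C.Cochain N) :
    C.horizontal N (C.mulCochain N s a) = C.mulCochain N s (C.horizontal N a) :=
  funext fun B => simplexD_comp (DistribSMul.toLinearMap K (C.ι → Laurent K σ) s) a B

theorem vertical_mulCochain (s : MvPolynomial σ K) (a : C.Cochain N) :
    C.vertical N (C.mulCochain N s a) = C.mulCochain N s (C.vertical N a) :=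
  funext fun B => (C.d (Laurent K σ)).map_smul s (a B)

variable [Fintype σ]

variable (C) in
theorem cech_X_eq_bot_of_pos {γ : Γ} (p : ℤ) {q : ℤ} (hq : ∀ i, C.pos i ≠ q) :
    (C.cech ε γ).X p q = ⊥ := by
  refine (Submodule.eq_bot_iff _).2 fun a ha => funext fun B => funext fun i => ?_
  by_contra h
  exact hq i (C.eq_zero_of_pos_ne ε ha.1 h).2

variable (C) in
theorem colExact_cech {γ : Γ} {q : ℤ} (hC : ∀ B, C.LocallyExact ε B q) :
    (C.cech ε γ).ColExact q := fun ha hd => C.exists_vertical_eq ε (fun B _ => hC B) ha hd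

theorem mulCochain_mem_cech_X {δ γ γ' : Γ} (hγ : γ' = δ + γ) {s : MvPolynomial σ K}
    (hs : s ∈ weightedHomogeneousSubmodule K w δ) {p q : ℤ} {a : C.Cochain N}
    (ha : a ∈ (C.cech ε γ).X p q) : C.mulCochain N s a ∈ (C.cech ε γ').X p q := by
  refine ⟨fun B i e he => ?_, fun B i e he => ?_⟩
  · obtain ⟨u, hu, he⟩ := exists_of_coef_smul_ne_zero he
    obtain ⟨h₁, h₂⟩ := ha.1 B i _ he
    exact ⟨h₁, isLocalExponent_of_sub ε h₂⟩
  · obtain ⟨u, hu, he⟩ := exists_of_coef_smul_ne_zero he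
    have h₁ : wdeg w (e - expo u) = _ := ha.2 B i _ he
    rw [map_sub, (mem_weightedHomogeneousSubmodule_iff w).1 hs u hu, sub_eq_iff_eq_add] at h₁
    rw [h₁, hγ]
    abel

theorem mulCochain_mem_edge {δ γ γ' : Γ} (hγ : γ' = δ + γ) {s : MvPolynomial σ K}
    (hs : s ∈ weightedHomogeneousSubmodule K w δ) {M q : ℤ} {t : ℕ} {a b : C.Cochain N}
    (h : (a, b) ∈ (C.cech ε γ).edge M q t) :
    (C.mulCochain N s a, C.mulCochain N s b) ∈ (C.cech ε γ').edge M q t :=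
  DoubleComplex.map_mem_edge (D := C.cech ε γ) (D' := C.cech ε γ') (θ := C.mulCochain N s)
    (fun a => horizontal_mulCochain s a) (fun a => vertical_mulCochain s a)
    (fun ha => mulCochain_mem_cech_X ε hγ hs ha) h

theorem mulCochain_mem_cocycles {δ γ γ' : Γ} (hγ : γ' = δ + γ) {s : MvPolynomial σ K}
    (hs : s ∈ weightedHomogeneousSubmodule K w δ) {p q : ℤ} {a : C.Cochain N}
    (h : a ∈ (C.cech ε γ).cocycles p q) : C.mulCochain N s a ∈ (C.cech ε γ').cocycles p q :=
  DoubleComplex.map_mem_cocycles (D := C.cech ε γ) (D' := C.cech ε γ') (θ := C.mulCochain N s)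
    (fun a => horizontal_mulCochain s a) (fun a => vertical_mulCochain s a)
    (fun ha => mulCochain_mem_cech_X ε hγ hs ha) h

section

variable {c : ℤ} {A V Λ : Type*} [CommRing A] [Algebra K A]
    [AddCommGroup V] [Module A V] [Module K V] [IsScalarTower K A V] [AddCommGroup Λ]
    {ε : Fin N → σ} {y : Fin N → A} {𝒜 : Λ → Submodule K A} {𝓜 : Λ → Submodule K V}
  (P : C.Augmentation c ε y 𝒜 𝓜)

namespace Augmentation

theorem relComp_isCorrespondence {γ : Γ} {μ : Λ} (hγ : P.κ + P.lin μ = γ) {p : ℤ}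
    {Δ : Submodule K (C.Cochain N × C.Cochain N)} {U U₀ : Submodule K (C.Cochain N)}
    (h : IsCorrespondence Δ U U₀ ((C.cech ε γ).colCocycles p c)
      ((C.cech ε γ).colCoboundaries p c)) :
    IsCorrespondence (relComp Δ (P.classRel p μ)) U U₀ ⊤ ⊥ := by
  subst hγ
  exact h.comp (P.classRel_isCorrespondence p μ)

theorem mul_mem_relComp {p : ℤ} {γ γ' : Γ} {μ μ' δ : Λ} (hμ : δ + μ = μ')
    (hγ : P.κ + P.lin μ = γ) (hγ' : P.κ + P.lin μ' = γ') {r : A} (hr : r ∈ 𝒜 δ)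
    {s : MvPolynomial σ K} (hs : P.ψ r = s) {M q : ℤ} {t : ℕ} {a : C.Cochain N} {h : localCohomologyPiece y 𝒜 𝓜 p μ}
    (hah : (a, h) ∈ relComp ((C.cech ε γ).edge M q t) (P.classRel p μ))
    (h' : localCohomologyPiece y 𝒜 𝓜 p μ')
    (hh' : (h' : LocalCohomology y V p) = r • (h : LocalCohomology y V p)) :
    (C.mulCochain N s a, h') ∈ relComp ((C.cech ε γ').edge M q t) (P.classRel p μ') := by
  subst hs
  obtain ⟨b, hab, hbh⟩ := hah
  refine ⟨C.mulCochain N (P.ψ r) b, mulCochain_mem_edge ε ?_ (P.ψ_mem hr) hab,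
    P.smul_mem_classRel hμ hr hbh h' hh'⟩
  rw [← hγ', ← hγ, ← hμ, map_add]
  abel

theorem subsingleton_localCohomologyPiece {γ : Γ} {μ : Λ} (hγ : P.κ + P.lin μ = γ) {p : ℤ}
    (hp : (C.cech ε γ).X p c = ⊥) : Subsingleton (localCohomologyPiece y 𝒜 𝓜 p μ) := by
  subst hγ
  refine subsingleton_of_forall_eq 0 fun x => ?_
  have h := P.classRel_isCorrespondence p μ
  obtain ⟨a, ha⟩ := h.exists_left x trivial
  refine (h.mem_iff ha).1 ?_
  have := (h.left_mem ha).1.1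
  rw [hp] at this
  rw [(Submodule.mem_bot K).1 this]
  exact zero_mem _

end Augmentation

end

end FreeComplex

/-- This presents vanishing cohomology as a correspondence with a zero space, so that the duality
theorem also yields the vanishing of the other side. -/
theorem isCorrespondence_prod_top {K E H : Type*} [Field K] [AddCommGroup E] [Module K E]
    [AddCommGroup H] [Module K H] [Subsingleton H] {A A₀ : Submodule K E} (hA : A = A₀) :
    IsCorrespondence (A.prod (⊤ : Submodule K H)) A A₀ ⊤ ⊥ where
  left_mem h := h.1
  right_mem h := h.2
  exists_right _ ha := ⟨0, ha, trivial⟩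
  exists_left _ _ := ⟨0, A.zero_mem, trivial⟩
  mem_iff {_ b} h := iff_of_true (hA ▸ h.1) (Subsingleton.elim b 0)

namespace GradedFreeResolution

variable {K : Type u} [Field K] {m n : ℕ} {d : Fin n → ℕ} {f : Fin n → PolyT K m}
  (F : GradedFreeResolution (gradingS K m d) (gradingRees f))

theorem chainComplex_X_eq_bot (γ : ℤ × ℤ) (p : ℤ) {q : ℤ} (hq : 0 < q) :
    (F.chainComplex.cech Sum.inl γ).X p q = ⊥ :=
  F.chainComplex.cech_X_eq_bot_of_pos _ _ fun i (hi : -(i.1 : ℤ) = q) => by omega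

theorem dualComplex_X_eq_bot_of_neg (γ : ℤ × ℤ) (p : ℤ) {q : ℤ} (hq : q < 0) :
    (F.dualComplex.cech Sum.inr γ).X p q = ⊥ :=
  F.dualComplex.cech_X_eq_bot_of_pos _ _ fun i (hi : (i.1 : ℤ) = q) => by omega

/-- All columns are exact except at position 0, and there is nothing above row 0, so cocycles lift
trivially. From (m, -q) it takes q steps to reach (m - q, 0). -/
theorem chain_edge_isCorrespondence (γ : ℤ × ℤ) {q i : ℤ} (hq : 0 ≤ q) (hi : m - q = i) :
    IsCorrespondence ((F.chainComplex.cech Sum.inl γ).edge m (-q) q.toNat)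
      ((F.chainComplex.cech Sum.inl γ).cocycles m (-q))
      ((F.chainComplex.cech Sum.inl γ).coboundaries m (-q))
      ((F.chainComplex.cech Sum.inl γ).colCocycles i 0)
      ((F.chainComplex.cech Sum.inl γ).colCoboundaries i 0) := by
  subst hi
  have ht : ((q.toNat : ℕ) : ℤ) = q := Int.toNat_of_nonneg hq
  have h := DoubleComplex.edge_isCorrespondence (q := -q)
    (F.chainComplex.rowExact_cech Sum.inl Sum.inl_injective γ)
    (fun q => F.chainComplex.cech_X_eq_bot Sum.inl q (Or.inr (lt_add_one (m : ℤ)))) q.toNat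
    (fun q' h₁ h₂ h₃ => F.chainComplex.colExact_cech _ fun B =>
      F.locallyExact_chainComplex _ B (by omega))
    (fun p _ => ⟨DoubleComplex.liftsCocycles_of_eq_bot (F.chainComplex_X_eq_bot γ p (by omega)),
      DoubleComplex.liftsCocycles_of_eq_bot (F.chainComplex_X_eq_bot γ p (by omega))⟩)
  rwa [ht, neg_add_cancel] at h

/-- Only B = ∅ occurs, so all exponents and hence the y-degree of a monomial are nonnegative, while
the finitely many basis elements up to position Q bound the weights. The resolution may be infinite,
hence the cutoff Q. -/
theorem exists_dualComplex_X_eq_bot (Q : ℤ) : ∃ k₀ : ℕ, ∀ γ : ℤ × ℤ, γ.2 ≤ -k₀ → ∀ p ≤ 0, ∀ q ≤ Q,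
    (F.dualComplex.cech Sum.inr γ).X p q = ⊥ := by
  have hfin : {i : Σ r, Fin (F.rank r) | i.1 ∈ Set.Iic Q.toNat}.Finite :=
    F.finite_sigma_fst _ (Set.finite_Iic _)
  obtain ⟨b, hb⟩ := (hfin.image fun i => (F.dualComplex.wt i).2).bddAbove
  refine ⟨b.toNat + 1, fun γ hγ p hp q hq => ?_⟩
  refine (Submodule.eq_bot_iff _).2 fun a ha => funext fun B => funext fun i => Laurent.ext fun e => ?_
  by_contra h
  obtain ⟨⟨hB, hi⟩, he⟩ := ha.1 B i e h
  have hw : wdeg _ e = _ := ha.2 B i e h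
  have hB0 : B = ∅ := Finset.card_eq_zero.1 (by omega)
  have hpos : 0 ≤ (wdeg (bidegree m d) e).2 := by
    rw [wdeg_apply, Prod.snd_sum]
    refine Finset.sum_nonneg fun v _ => ?_
    have hv : 0 ≤ e v := by
      by_contra hv
      obtain ⟨b, hb, -⟩ := he v (not_le.1 hv)
      rw [hB0] at hb
      exact Finset.notMem_empty _ hb
    cases v with
    | inl l => exact (mul_zero (e (Sum.inl l))).ge
    | inr l =>
      change 0 ≤ e (Sum.inr l) * 1
      rwa [mul_one]
  have hi' : (i.1 : ℤ) = q := hi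
  have hle : (F.dualComplex.wt i).2 ≤ b := hb ⟨i, by
    change i.1 ≤ Q.toNat
    omega, rfl⟩
  rw [hw, Prod.snd_add] at hpos
  push_cast at hγ
  omega

/-- The vanishing of the terms of nonpositive column index in the rows up to `Q`. -/
def VanishesUpTo (γ : ℤ × ℤ) (Q : ℤ) : Prop :=
  ∀ p ≤ 0, ∀ q ≤ Q, (F.dualComplex.cech Sum.inr γ).X p q = ⊥

section

variable {F} (hI : genIdeal f ≠ ⊥)
  (hCM : ∀ (p : Ideal (Rees f)) [p.IsPrime], p ≠ reesMaximal f →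
    IsCohenMacaulayLocal (Localization.AtPrime p)) {γ : ℤ × ℤ} {Q : ℤ} (hQ : F.VanishesUpTo γ Q)
include hI hCM hQ

/-- Columns with p ≤ 0 vanish by the choice of the degree; in the others some y_b is inverted and
the torsion theorem applies. -/
theorem dual_colExact {q : ℤ} (hqQ : q ≤ Q) (hq : q ≠ (n - 1 : ℕ)) :
    (F.dualComplex.cech Sum.inr γ).ColExact q := by
  intro p a ha hd
  by_cases hp : p ≤ 0
  · rw [hQ p hp q hqQ, Submodule.mem_bot] at ha
    exact ⟨0, zero_mem _, by rw [map_zero, ha]⟩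
  · refine F.dualComplex.exists_vertical_eq Sum.inr (fun B hB => ?_) ha hd
    exact F.locallyExact_dualComplex hI hCM (Finset.card_pos.1 (by omega)) hq

theorem dual_liftsCocycles {p q : ℤ} (hp : p < n) (hq : (n - 1 : ℕ) ≤ q) (hqQ : q ≤ Q)
    (hpQ : p + q ≤ Q) : (F.dualComplex.cech Sum.inr γ).LiftsCocycles p q :=
  DoubleComplex.liftsCocycles (c := (n - 1 : ℕ))
    (F.dualComplex.rowExact_cech Sum.inr Sum.inr_injective γ)
    (fun _ hq hqQ => dual_colExact hI hCM hQ hqQ hq.ne') hQ hp hq hqQ hpQ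

/-- The exceptional row is n - 1. Total degree n + q is preserved, so the zigzag ends in column q +
1. Lifting is used in columns p < n and rows n - 1 and n only, whence the bound 2n. -/
theorem dual_edge_isCorrespondence (hn : 1 ≤ n) (hQn : 2 * n ≤ Q) {q p : ℤ} (hq : q < n)
    (hp : q + 1 = p) :
    IsCorrespondence ((F.dualComplex.cech Sum.inr γ).edge n q (n - 1 - q).toNat)
      ((F.dualComplex.cech Sum.inr γ).cocycles n q)
      ((F.dualComplex.cech Sum.inr γ).coboundaries n q)
      ((F.dualComplex.cech Sum.inr γ).colCocycles p (n - 1 : ℕ))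
      ((F.dualComplex.cech Sum.inr γ).colCoboundaries p (n - 1 : ℕ)) := by
  subst hp
  have ht : (((n - 1 - q).toNat : ℕ) : ℤ) = n - 1 - q := Int.toNat_of_nonneg (by omega)
  have h := DoubleComplex.edge_isCorrespondence (q := q)
    (F.dualComplex.rowExact_cech Sum.inr Sum.inr_injective γ)
    (fun q => F.dualComplex.cech_X_eq_bot Sum.inr q (Or.inr (lt_add_one (n : ℤ))))
    (n - 1 - q).toNat
    (fun q' h₁ h₂ h₃ => dual_colExact hI hCM hQ (by omega) (by omega))
    (fun p' hp' => ⟨dual_liftsCocycles hI hCM hQ hp' (by omega) (by omega) (by omega),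
      dual_liftsCocycles hI hCM hQ hp' (by omega) (by omega) (by omega)⟩)
  rwa [ht, show (n : ℤ) - (n - 1 - q) = q + 1 by ring,
    show q + ((n : ℤ) - 1 - q) = (n - 1 : ℕ) by omega] at h

/-- Zigzags from rows q ≥ n only move upwards and never meet the exceptional row n - 1. -/
theorem dual_cocycles_eq_coboundaries (hn : 1 ≤ n) {q : ℤ} (hq : n ≤ q) (hqQ : n + q ≤ Q) :
    (F.dualComplex.cech Sum.inr γ).cocycles n q =
      (F.dualComplex.cech Sum.inr γ).coboundaries n q :=
  DoubleComplex.cocycles_eq_coboundaries (dual_colExact hI hCM hQ (by omega) (by omega))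
    (dual_colExact hI hCM hQ (by omega) (by omega))
    (dual_liftsCocycles hI hCM hQ (by omega) (by omega) (by omega) (by omega))

end

end GradedFreeResolution

end

end GradedLC


/-! ### The residue pairing. -/

namespace GradedLC

open MvPolynomial Laurent

universe u

noncomputable section

namespace Laurent

variable {K σ : Type*} [Field K]

theorem coef_sum_single_of_mem {S : Finset (σ → ℤ)} {e : σ → ℤ} (he : e ∈ S) (g : (σ → ℤ) → K) :
    coef e (∑ f ∈ S, single f (g f)) = g e := by
  classical
  rw [map_sum, Finset.sum_congr rfl fun f _ => coef_single e f (g f), Finset.sum_ite_eq', if_pos he]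

theorem coef_sum_single_of_notMem {S : Finset (σ → ℤ)} {e : σ → ℤ} (he : e ∉ S)
    (g : (σ → ℤ) → K) : coef e (∑ f ∈ S, single f (g f)) = 0 := by
  classical
  rw [map_sum, Finset.sum_congr rfl fun f _ => coef_single e f (g f), Finset.sum_ite_eq', if_neg he]

theorem sum_single_coef (a : Laurent K σ) :
    ∑ e ∈ a.finite_support.toFinset, single e (coef e a) = a := by
  ext e
  by_cases h : e ∈ a.finite_support.toFinset
  · exact coef_sum_single_of_mem h _
  · rw [coef_sum_single_of_notMem h]
    rw [Set.Finite.mem_toFinset, Set.mem_ofPred_eq, not_not] at h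
    exact h.symm

theorem smul_single_one (e : σ → ℤ) (c : K) : c • single e (1 : K) = single e c := by
  classical
  ext f
  rw [map_smul, coef_single, coef_single, smul_ite, smul_zero, smul_eq_mul, mul_one]

theorem exists_of_residue_mul_ne_zero {a b : Laurent K σ} (h : coef (-1) (a * b) ≠ 0) :
    ∃ e, coef e a ≠ 0 ∧ coef (-1 - e) b ≠ 0 := exists_of_coef_mul_ne_zero h

theorem residue_mul_single (a : Laurent K σ) (e : σ → ℤ) (r : K) :
    coef (-1) (a * single e r) = r * coef (-1 - e) a := by
  rw [mul_comm, coef_single_mul]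

end Laurent

namespace FreeComplex

variable {K σ Γ : Type*} [Field K] [AddCommGroup Γ] {w : σ → Γ} (C : FreeComplex K w) {N : ℕ}

open Classical in
/-- The cochains with a single coordinate. -/
def singleCochain (B : Finset (Fin N)) (i : C.ι) : Laurent K σ →ₗ[K] C.Cochain N where
  toFun a B' i' := if B' = B ∧ i' = i then a else 0
  map_add' a b := funext fun B' => funext fun i' => by
    rw [Pi.add_apply, Pi.add_apply]
    split_ifs
    · rfl
    · rw [add_zero]
  map_smul' c a := funext fun B' => funext fun i' => by
    rw [Pi.smul_apply, Pi.smul_apply]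
    split_ifs
    · rfl
    · rw [RingHom.id_apply, smul_zero]

variable {C}

theorem singleCochain_self (B : Finset (Fin N)) (i : C.ι) (a : Laurent K σ) :
    C.singleCochain B i a B i = a := if_pos ⟨rfl, rfl⟩

theorem singleCochain_of_ne {B B' : Finset (Fin N)} {i i' : C.ι} (a : Laurent K σ)
    (h : ¬(B' = B ∧ i' = i)) : C.singleCochain B i a B' i' = 0 := if_neg h

theorem eq_univ_of_card_eq {B : Finset (Fin N)} (hB : (B.card : ℤ) = N) : B = Finset.univ :=
  (Finset.card_eq_iff_eq_univ B).1 (by rw [Fintype.card_fin]; exact_mod_cast hB)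

theorem of_coef_singleCochain_ne_zero {B B' : Finset (Fin N)} {i i' : C.ι} {e e' : σ → ℤ} {r : K}
    (h : coef e' (C.singleCochain B i (single e r) B' i') ≠ 0) : (B' = B ∧ i' = i) ∧ e' = e := by
  classical
  have h₁ : B' = B ∧ i' = i := by
    by_contra h'
    rw [singleCochain_of_ne _ h'] at h
    exact h (map_zero _)
  refine ⟨h₁, ?_⟩
  rw [h₁.1, h₁.2, singleCochain_self, coef_single] at h
  by_contra h'
  exact h (if_neg (Ne.symm h'))

variable [Fintype σ] (ε : Fin N → σ)

theorem singleCochain_single_mem {γ : Γ} {e : σ → ℤ} (he : IsLocalExponent ε Finset.univ e)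
    {i : C.ι} (hw : wdeg w e = γ + C.wt i) (r : K) :
    C.singleCochain Finset.univ i (single e r) ∈ (C.cech ε γ).X N (C.pos i) := by
  refine ⟨fun B i' e' h => ?_, fun B i' e' h => ?_⟩
  · obtain ⟨⟨rfl, rfl⟩, rfl⟩ := of_coef_singleCochain_ne_zero h
    exact ⟨⟨by rw [Finset.card_univ, Fintype.card_fin], rfl⟩, he⟩
  · obtain ⟨⟨rfl, rfl⟩, rfl⟩ := of_coef_singleCochain_ne_zero h
    exact hw

end FreeComplex

/-- The bigraded components of H^m_{(x)}(S) are finite-dimensional: the second degree bounds the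
y-exponents, after which the first bounds the negative x-exponents. A representing Laurent
polynomial is therefore a finite sum. -/
theorem finite_exponents {m n : ℕ} (d : Fin n → ℕ) (γ : ℤ × ℤ) :
    {e : Fin m ⊕ Fin n → ℤ | (∀ l, e (Sum.inl l) < 0) ∧ (∀ b, 0 ≤ e (Sum.inr b)) ∧
      wdeg (bidegree m d) e = γ}.Finite := by
  refine (Set.finite_Icc (Sum.elim (fun _ : Fin m => γ.1 - ∑ b, (d b : ℤ) * γ.2)
    (fun _ : Fin n => 0)) (Sum.elim (fun _ => 0) fun _ => γ.2)).subset ?_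
  rintro e ⟨hl, hb, he⟩
  have h₁ : ∑ l, e (Sum.inl l) + ∑ b, e (Sum.inr b) * d b = γ.1 := by
    rw [← he, wdeg_apply, Prod.fst_sum, Fintype.sum_sum_type]
    simp [bidegree]
  have h₂ : ∑ b, e (Sum.inr b) = γ.2 := by
    rw [← he, wdeg_apply, Prod.snd_sum, Fintype.sum_sum_type]
    simp [bidegree]
  have hle : ∀ b, e (Sum.inr b) ≤ γ.2 := fun b => by
    rw [← h₂]
    exact Finset.single_le_sum (f := fun b => e (Sum.inr b)) (fun b _ => hb b) (Finset.mem_univ b)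
  have h₃ : ∑ b, e (Sum.inr b) * d b ≤ ∑ b, (d b : ℤ) * γ.2 :=
    Finset.sum_le_sum fun b _ => by
      rw [mul_comm]
      exact mul_le_mul_of_nonneg_left (hle b) (Nat.cast_nonneg _)
  refine ⟨?_, ?_⟩
  · rintro (l | b)
    · have : -e (Sum.inl l) ≤ ∑ l, -e (Sum.inl l) :=
        Finset.single_le_sum (f := fun l => -e (Sum.inl l)) (fun l _ => by linarith [hl l])
          (Finset.mem_univ l)
      rw [Finset.sum_neg_distrib] at this
      change γ.1 - ∑ b, (d b : ℤ) * γ.2 ≤ e (Sum.inl l)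
      linarith
    · exact hb b
  · rintro (l | b)
    · exact (hl l).le
    · exact hle b

/-- The monomial whose coefficient is the residue has degree -σ; the shift in ω_R compensates it
exactly. -/
theorem wdeg_neg_one {m n : ℕ} (d : Fin n → ℕ) :
    wdeg (bidegree (n := n) m d) (-1) = -sigma m d := by
  rw [wdeg_apply, sigma, ← Finset.sum_neg_distrib]
  exact Finset.sum_congr rfl fun v _ => by rw [Pi.neg_apply, Pi.one_apply, neg_one_smul]

namespace GradedFreeResolution

variable {K : Type u} [Field K] {m n : ℕ} {d : Fin n → ℕ} {f : Fin n → PolyT K m}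
  (F : GradedFreeResolution (gradingS K m d) (gradingRees f))

/-- The sum of the residues of the products of the coordinates at position `r`. -/
def residuePairingNat (r : ℕ) :
    F.chainComplex.Cochain m →ₗ[K] F.dualComplex.Cochain n →ₗ[K] K :=
  ∑ i : Fin (F.rank r), LinearMap.compl₁₂
    ((LinearMap.mul K (Laurent K (Fin m ⊕ Fin n))).compr₂ (coef (-1)))
    (LinearMap.proj (⟨r, i⟩ : Σ r, Fin (F.rank r)) ∘ₗ
      LinearMap.proj (R := K) (φ := fun _ : Finset (Fin m) => F.chainComplex.ι → Laurent K _)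
        Finset.univ)
    (LinearMap.proj (⟨r, i⟩ : Σ r, Fin (F.rank r)) ∘ₗ
      LinearMap.proj (R := K) (φ := fun _ : Finset (Fin n) => F.dualComplex.ι → Laurent K _)
        Finset.univ)

theorem residuePairingNat_apply (r : ℕ) (u : F.chainComplex.Cochain m)
    (v : F.dualComplex.Cochain n) : F.residuePairingNat r u v =
      ∑ i : Fin (F.rank r), coef (-1) (u Finset.univ ⟨r, i⟩ * v Finset.univ ⟨r, i⟩) := by
  rw [residuePairingNat, LinearMap.sum_apply, LinearMap.sum_apply]
  rfl

/-- The residue pairing between the last columns of the two Čech double complexes. -/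
def residuePairing : ℤ → F.chainComplex.Cochain m →ₗ[K] F.dualComplex.Cochain n →ₗ[K] K
  | Int.ofNat r => F.residuePairingNat r
  | Int.negSucc _ => 0

variable {F}

theorem residuePairing_natCast (r : ℕ) (u : F.chainComplex.Cochain m)
    (v : F.dualComplex.Cochain n) : F.residuePairing r u v =
      ∑ i : Fin (F.rank r), coef (-1) (u Finset.univ ⟨r, i⟩ * v Finset.univ ⟨r, i⟩) :=
  F.residuePairingNat_apply r u v

theorem residuePairing_of_neg {q : ℤ} (hq : q < 0) (u : F.chainComplex.Cochain m)
    (v : F.dualComplex.Cochain n) : F.residuePairing q u v = 0 := by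
  obtain ⟨k, rfl⟩ := Int.eq_negSucc_of_lt_zero hq
  rfl

theorem residuePairing_eq_zero {q : ℤ} {u : F.chainComplex.Cochain m}
    {v : F.dualComplex.Cochain n}
    (h : ∀ i e, coef e (u Finset.univ i) ≠ 0 → coef (-1 - e) (v Finset.univ i) ≠ 0 → False) :
    F.residuePairing q u v = 0 := by
  obtain hq | hq := lt_or_ge q 0
  · exact residuePairing_of_neg hq u v
  lift q to ℕ using hq
  rw [residuePairing_natCast]
  refine Finset.sum_eq_zero fun i _ => ?_
  by_contra h'
  obtain ⟨e, he, he'⟩ := exists_of_residue_mul_ne_zero h'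
  exact h _ e he he'

theorem residuePairing_mulCochain (q : ℤ) (s : PolyS K m n) (u : F.chainComplex.Cochain m)
    (v : F.dualComplex.Cochain n) : F.residuePairing q (F.chainComplex.mulCochain m s u) v =
      F.residuePairing q u (F.dualComplex.mulCochain n s v) := by
  obtain hq | hq := lt_or_ge q 0
  · rw [residuePairing_of_neg hq, residuePairing_of_neg hq]
  lift q to ℕ using hq
  rw [residuePairing_natCast, residuePairing_natCast]
  refine Finset.sum_congr rfl fun i _ => ?_
  rw [FreeComplex.mulCochain_apply, FreeComplex.mulCochain_apply, smul_mul_assoc, mul_smul_comm]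

theorem residuePairing_adjoint (q : ℤ) (u : F.chainComplex.Cochain m)
    (v : F.dualComplex.Cochain n) : F.residuePairing q (F.chainComplex.vertical m u) v =
      F.residuePairing (q + 1) u (F.dualComplex.vertical n v) := by
  obtain hq | hq := lt_or_ge q 0
  · rw [residuePairing_of_neg hq]
    obtain hq' | hq' := lt_or_ge (q + 1) 0
    · rw [residuePairing_of_neg hq']
    -- The pairing on the left is zero by convention, and the dual differential has no component at
    -- position 0.
    · obtain rfl : q = -1 := by omega
      rw [show (-1 + 1 : ℤ) = (0 : ℕ) by norm_num, residuePairing_natCast]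
      refine (Finset.sum_eq_zero fun i _ => ?_).symm
      rw [FreeComplex.vertical_apply, dualComplex_d_zero, mul_zero, map_zero]
  lift q to ℕ using hq
  rw [show (q : ℤ) + 1 = (q + 1 : ℕ) by push_cast; rfl, residuePairing_natCast,
    residuePairing_natCast]
  have h₁ : ∀ i, F.chainComplex.vertical m u Finset.univ ⟨q, i⟩ =
      ∑ j, F.mat q i j • u Finset.univ ⟨q + 1, j⟩ := fun i => chainComplex_d_apply _ _ _
  have h₂ : ∀ i, F.dualComplex.vertical n v Finset.univ ⟨q + 1, i⟩ =
      ∑ j, F.mat q j i • v Finset.univ ⟨q, j⟩ := fun i => dualComplex_d_succ _ _ _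
  simp_rw [h₁, h₂, Finset.sum_mul, Finset.mul_sum, map_sum, smul_mul_assoc, mul_smul_comm]
  exact Finset.sum_comm

variable {γ₁ γ₂ : ℤ × ℤ}

/-- The second factor has no negative x-exponents, so a contribution to the residue needs all
x-exponents of the first to be negative; a horizontal coboundary has no such monomial. -/
theorem residuePairing_horizontal_left (q : ℤ) {u : F.chainComplex.Cochain m}
    (hu : u ∈ (F.chainComplex.cech Sum.inl γ₁).X (m - 1) (-q)) {v : F.dualComplex.Cochain n}
    (hv : v ∈ (F.dualComplex.cech Sum.inr γ₂).X n q) :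
    F.residuePairing q (F.chainComplex.horizontal m u) v = 0 := by
  refine residuePairing_eq_zero fun i e he he' => ?_
  obtain ⟨b, -, he⟩ := F.chainComplex.exists_of_coef_horizontal_ne_zero he
  have h₁ : 0 ≤ e (Sum.inl b) := by
    by_contra h
    obtain ⟨b', hb', h'⟩ := (hu.1 _ i e he).2 _ (not_le.1 h)
    rw [Sum.inl_injective h'] at hb'
    exact Finset.notMem_erase _ _ hb'
  obtain ⟨b', -, h'⟩ := (hv.1 _ i _ he').2 (Sum.inl b) (by
    rw [Pi.sub_apply, Pi.neg_apply, Pi.one_apply]; omega)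
  exact Sum.inr_ne_inl h'

theorem residuePairing_horizontal_right (q : ℤ) {u : F.chainComplex.Cochain m}
    (hu : u ∈ (F.chainComplex.cech Sum.inl γ₁).X m (-q)) {v : F.dualComplex.Cochain n}
    (hv : v ∈ (F.dualComplex.cech Sum.inr γ₂).X (n - 1) q) :
    F.residuePairing q u (F.dualComplex.horizontal n v) = 0 := by
  refine residuePairing_eq_zero fun i e he he' => ?_
  obtain ⟨b, -, he'⟩ := F.dualComplex.exists_of_coef_horizontal_ne_zero he'
  have h₁ : 0 ≤ (-1 - e) (Sum.inr b) := by
    by_contra h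
    obtain ⟨b', hb', h'⟩ := (hv.1 _ i _ he').2 _ (not_le.1 h)
    rw [Sum.inr_injective h'] at hb'
    exact Finset.notMem_erase _ _ hb'
  rw [Pi.sub_apply, Pi.neg_apply, Pi.one_apply] at h₁
  obtain ⟨b', -, h'⟩ := (hu.1 _ i _ he).2 (Sum.inr b) (by omega)
  exact Sum.inl_ne_inr h'

theorem wdeg_neg_one_sub (hγ : γ₁ + γ₂ = 0) {e : Fin m ⊕ Fin n → ℤ} {i : Σ r, Fin (F.rank r)} :
    wdeg (bidegree m d) (-1 - e) = γ₂ + F.dualComplex.wt i ↔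
      wdeg (bidegree m d) e = γ₁ + F.chainComplex.wt i := by
  rw [map_sub, wdeg_neg_one, eq_neg_of_add_eq_zero_left hγ]
  change -sigma m d - _ = γ₂ + (F.deg i.1 i.2 - sigma m d) ↔ _ = -γ₂ + -F.deg i.1 i.2
  constructor <;> intro h
  · have h' : wdeg (bidegree m d) e = -sigma m d - (γ₂ + (F.deg i.1 i.2 - sigma m d)) := by
      rw [← h]
      abel
    rw [h']
    abel
  · rw [h]
    abel

theorem residuePairing_singleCochain {r : ℕ} (u : F.chainComplex.Cochain m) (i : Fin (F.rank r))
    (e : Fin m ⊕ Fin n → ℤ) (c : K) :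
    F.residuePairing r u (F.dualComplex.singleCochain Finset.univ ⟨r, i⟩ (single e c)) =
      c * coef (-1 - e) (u Finset.univ ⟨r, i⟩) := by
  rw [residuePairing_natCast, Finset.sum_eq_single i]
  · rw [FreeComplex.singleCochain_self, residue_mul_single]
  · intro i' _ hi'
    rw [FreeComplex.singleCochain_of_ne, mul_zero, map_zero]
    rintro ⟨-, h⟩
    exact hi' (by simpa using h)
  · exact fun h => absurd (Finset.mem_univ i) h

/-- A monomial e of u with all x-exponents negative would be detected by the complementary monomial
-1 - e of the other complex. So there is none, and the contraction of the rows applies. -/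
theorem residuePairing_nondegenerate (hγ : γ₁ + γ₂ = 0) (q : ℤ) {u : F.chainComplex.Cochain m}
    (hu : u ∈ (F.chainComplex.cech Sum.inl γ₁).X m (-q))
    (h : ∀ v ∈ (F.dualComplex.cech Sum.inr γ₂).X n q, F.residuePairing q u v = 0) :
    ∃ u' ∈ (F.chainComplex.cech Sum.inl γ₁).X (m - 1) (-q), F.chainComplex.horizontal m u' = u := by
  refine F.chainComplex.exists_horizontal_eq Sum.inl hu ?_ fun B i e he => ?_
  · have := (F.chainComplex.cech Sum.inl γ₁).h_mem hu
    rwa [F.chainComplex.cech_X_eq_bot Sum.inl _ (Or.inr (lt_add_one (m : ℤ)))] at this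
  · by_contra! hneg
    obtain ⟨⟨hB, hi⟩, hloc⟩ := hu.1 B i e he
    obtain rfl := FreeComplex.eq_univ_of_card_eq hB
    obtain ⟨r, i⟩ := i
    obtain rfl : (r : ℤ) = q := by
      have : -(r : ℤ) = -q := hi
      omega
    have hlocal : FreeComplex.IsLocalExponent Sum.inr (Finset.univ : Finset (Fin n)) (-1 - e) := by
      rintro (l | b) hx
      · rw [Pi.sub_apply, Pi.neg_apply, Pi.one_apply] at hx
        have := hneg l
        omega
      · exact ⟨b, Finset.mem_univ b, rfl⟩
    have := h _ (FreeComplex.singleCochain_single_mem (C := F.dualComplex) Sum.inr hlocal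
      (i := ⟨r, i⟩) ((wdeg_neg_one_sub hγ).2 (hu.2 _ _ e he)) 1)
    rw [residuePairing_singleCochain, one_mul, sub_sub_cancel] at this
    exact he this

theorem sum_singleCochain_eq {r : ℕ} {v : F.dualComplex.Cochain n}
    (hv : v ∈ (F.dualComplex.cech Sum.inr γ₂).X n r) :
    ∑ i : Fin (F.rank r), F.dualComplex.singleCochain Finset.univ ⟨r, i⟩
      (v Finset.univ ⟨r, i⟩) = v := by
  funext B ⟨r', i'⟩
  rw [Finset.sum_apply, Finset.sum_apply]
  by_cases h : B = Finset.univ ∧ r' = r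
  · obtain ⟨rfl, rfl⟩ := h
    rw [Finset.sum_eq_single i']
    · rw [FreeComplex.singleCochain_self]
    · intro i _ hi
      refine FreeComplex.singleCochain_of_ne _ ?_
      rintro ⟨-, h⟩
      exact hi (by simpa using h.symm)
    · exact fun h => absurd (Finset.mem_univ i') h
  · have hv0 : v B ⟨r', i'⟩ = 0 := by
      by_contra h'
      obtain ⟨h₁, h₂⟩ := F.dualComplex.eq_zero_of_pos_ne Sum.inr hv.1 h'
      exact h ⟨FreeComplex.eq_univ_of_card_eq h₁, Nat.cast_injective (R := ℤ) h₂⟩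
    rw [hv0]
    refine Finset.sum_eq_zero fun i _ => FreeComplex.singleCochain_of_ne _ ?_
    rintro ⟨h₁, h₂⟩
    exact h ⟨h₁, congrArg Sigma.fst h₂⟩

theorem residuePairing_representable (hγ : γ₁ + γ₂ = 0) (q : ℤ)
    (l : F.dualComplex.Cochain n →ₗ[K] K)
    (hl : ∀ v ∈ (F.dualComplex.cech Sum.inr γ₂).X (n - 1) q,
      l (F.dualComplex.horizontal n v) = 0) :
    ∃ u ∈ (F.chainComplex.cech Sum.inl γ₁).X m (-q),
      ∀ v ∈ (F.dualComplex.cech Sum.inr γ₂).X n q, F.residuePairing q u v = l v := by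
  obtain hq | hq := lt_or_ge q 0
  · refine ⟨0, zero_mem _, fun v hv => ?_⟩
    rw [F.dualComplex_X_eq_bot_of_neg γ₂ n hq, Submodule.mem_bot] at hv
    rw [hv, map_zero, map_zero]
  lift q to ℕ using hq
  -- The exponents of the basis of H^m_{(x)}(S) in the required degree; the coefficient of u at e is
  -- the value of l on the complementary monomial.
  let A : (Σ r, Fin (F.rank r)) → Finset (Fin m ⊕ Fin n → ℤ) := fun i =>
    (finite_exponents d (γ₁ + F.chainComplex.wt i)).toFinset
  let u : F.chainComplex.Cochain m := fun B i => if B = Finset.univ ∧ i.1 = q then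
    ∑ e ∈ A i, single e (l (F.dualComplex.singleCochain Finset.univ i (single (-1 - e) 1))) else 0
  have hu_eq : ∀ i : Fin (F.rank q), u Finset.univ ⟨q, i⟩ = ∑ e ∈ A ⟨q, i⟩, single e
      (l (F.dualComplex.singleCochain Finset.univ ⟨q, i⟩ (single (-1 - e) 1))) :=
    fun i => if_pos ⟨rfl, rfl⟩
  have hu : ∀ B i e, coef e (u B i) ≠ 0 → (B = Finset.univ ∧ i.1 = q) ∧ e ∈ A i := by
    intro B i e he
    have h : B = Finset.univ ∧ i.1 = q := by
      by_contra h
      have : u B i = 0 := if_neg h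
      exact he (by rw [this, map_zero])
    obtain ⟨r, i⟩ := i
    obtain ⟨rfl, rfl⟩ := h
    refine ⟨⟨rfl, rfl⟩, ?_⟩
    by_contra h'
    exact he (by rw [hu_eq, coef_sum_single_of_notMem h'])
  refine ⟨u, ⟨fun B i e he => ?_, fun B i e he => ?_⟩, fun v hv => ?_⟩
  · obtain ⟨⟨rfl, hi⟩, hA⟩ := hu B i e he
    obtain ⟨-, h₂, -⟩ := (Set.Finite.mem_toFinset _).1 hA
    refine ⟨⟨by rw [Finset.card_univ, Fintype.card_fin], congrArg (fun r : ℕ => -(r : ℤ)) hi⟩, ?_⟩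
    rintro (x | b) hx
    · exact ⟨x, Finset.mem_univ x, rfl⟩
    · exact absurd (h₂ b) (not_le.2 hx)
  · exact ((Set.Finite.mem_toFinset _).1 (hu B i e he).2).2.2
  rw [← sum_singleCochain_eq hv, map_sum, map_sum]
  refine Finset.sum_congr rfl fun i _ => ?_
  rw [← sum_single_coef (v Finset.univ ⟨q, i⟩), map_sum, map_sum, map_sum]
  refine Finset.sum_congr rfl fun e he => ?_
  have he : coef e (v Finset.univ ⟨q, i⟩) ≠ 0 := (Set.Finite.mem_toFinset _).1 he
  have hloc := (hv.1 _ _ _ he).2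
  have hwt : wdeg (bidegree m d) e = γ₂ + F.dualComplex.wt ⟨q, i⟩ := hv.2 _ _ _ he
  rw [residuePairing_singleCochain, hu_eq, ← smul_single_one, map_smul, map_smul, smul_eq_mul]
  congr 1
  by_cases hA : -1 - e ∈ A ⟨q, i⟩
  · rw [coef_sum_single_of_mem hA, sub_sub_cancel]
  · rw [coef_sum_single_of_notMem hA]
    -- A monomial whose complement is not in A has some nonnegative y-exponent, so it is a
    -- horizontal coboundary and l vanishes on it, as does the pairing with u.
    have hnonneg : ∃ b : Fin n, 0 ≤ e (Sum.inr b) := by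
      by_contra! hneg
      refine hA ((Set.Finite.mem_toFinset _).2 ⟨fun x => ?_, fun b => ?_, ?_⟩)
      · rw [Pi.sub_apply, Pi.neg_apply, Pi.one_apply]
        by_contra hx
        obtain ⟨b, -, hb⟩ := hloc (Sum.inl x) (by omega)
        exact Sum.inr_ne_inl hb
      · rw [Pi.sub_apply, Pi.neg_apply, Pi.one_apply]
        have := hneg b
        omega
      · rwa [← wdeg_neg_one_sub hγ, sub_sub_cancel]
    have hmem := FreeComplex.singleCochain_single_mem (C := F.dualComplex) Sum.inr
      (fun x hx => (hloc x hx).imp fun b hb => ⟨Finset.mem_univ b, hb.2⟩) hwt (1 : K)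
    obtain ⟨v', hv', hvv⟩ := F.dualComplex.exists_horizontal_eq Sum.inr hmem (by
      have := (F.dualComplex.cech Sum.inr γ₂).h_mem hmem
      rwa [F.dualComplex.cech_X_eq_bot Sum.inr _ (Or.inr (lt_add_one (n : ℤ)))] at this)
      (fun B i' e' h => by
        obtain ⟨b, hb⟩ := hnonneg
        refine ⟨b, ?_⟩
        rwa [(FreeComplex.of_coef_singleCochain_ne_zero h).2])
    rw [← hvv, hl v' hv']

theorem isPerfectPairing_residuePairing (hγ : γ₁ + γ₂ = 0) :
    DoubleComplex.IsPerfectPairing (F.chainComplex.cech Sum.inl γ₁)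
      (F.dualComplex.cech Sum.inr γ₂) m n F.residuePairing where
  h_left q _ hu _ hv := residuePairing_horizontal_left q hu hv
  h_right q _ hu _ hv := residuePairing_horizontal_right q hu hv
  adjoint := residuePairing_adjoint
  nondegenerate q _ hu h := residuePairing_nondegenerate hγ q hu h
  representable q l hl := residuePairing_representable hγ q l hl

end GradedFreeResolution

end

end GradedLC


/-! ### Graded duality and the final comparison. -/

namespace GradedLC

open MvPolynomial Laurent

universe u

noncomputable section

/-- The isomorphisms of the single degrees are all induced by the pairing, so adjointness of θ₁ and
θ₂ on representatives becomes compatibility with multiplication. -/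
theorem DoubleComplex.exists_graded_dual_equiv {K E₁ E₂ Λ : Type*} [Field K] [AddCommGroup E₁]
    [AddCommGroup E₂] [Module K E₁] [Module K E₂] {H G : ℤ → Type*} [∀ j, AddCommGroup (H j)]
    [∀ j, AddCommGroup (G j)] [∀ j, Module K (H j)] [∀ j, Module K (G j)]
    {D₁ : ℤ → DoubleComplex K E₁} {D₂ : ℤ → DoubleComplex K E₂} {M N : ℤ}
    {β : ℤ → E₁ →ₗ[K] E₂ →ₗ[K] K} (P : ∀ j, IsPerfectPairing (D₁ j) (D₂ j) M N β) (q : ℤ)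
    {Γ₁ : ∀ j, Submodule K (E₁ × H j)} {Γ₂ : ∀ j, Submodule K (E₂ × G j)}
    (h₁ : ∀ j, IsCorrespondence (Γ₁ j) ((D₁ j).cocycles M (-q)) ((D₁ j).coboundaries M (-q)) ⊤ ⊥)
    (h₂ : ∀ j, IsCorrespondence (Γ₂ j) ((D₂ j).cocycles N q) ((D₂ j).coboundaries N q) ⊤ ⊥)
    {θ₁ : Λ → E₁ → E₁} {θ₂ : Λ → E₂ → E₂} (hθ : ∀ l a b, β q (θ₁ l a) b = β q a (θ₂ l b))
    {μ₁ : ∀ j, Λ → H j → H (1 + j)} {μ₂ : ∀ j, Λ → G (1 + j) → G j}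
    (hμ₁ : ∀ j l a h, (a, h) ∈ Γ₁ j → (θ₁ l a, μ₁ j l h) ∈ Γ₁ (1 + j))
    (hμ₂ : ∀ j l b u, (b, u) ∈ Γ₂ (1 + j) → (θ₂ l b, μ₂ j l u) ∈ Γ₂ j) :
    ∃ φ : ∀ j, H j ≃ₗ[K] Module.Dual K (G j),
      ∀ j l h u, φ (1 + j) (μ₁ j l h) u = φ j h (μ₂ j l u) := by
  choose φ hφ using fun j => (P j).exists_dual_equiv q (h₁ j) (h₂ j)
  refine ⟨φ, fun j l h u => ?_⟩
  obtain ⟨a, ha⟩ := (h₁ j).exists_left h trivial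
  obtain ⟨b, hb⟩ := (h₂ (1 + j)).exists_left u trivial
  rw [hφ (1 + j) (hμ₁ j l a h ha) hb, hφ j ha (hμ₂ j l b u hb), hθ]

theorem exists_graded_equiv_of_subsingleton {K Λ : Type*} [Field K] {H G : ℤ → Type*}
    [∀ j, AddCommGroup (H j)] [∀ j, AddCommGroup (G j)] [∀ j, Module K (H j)]
    [∀ j, Module K (G j)] (hH : ∀ j, Subsingleton (H j)) (hG : ∀ j, Subsingleton (G j))
    (μ₁ : ∀ j, Λ → H j → H (1 + j)) (μ₂ : ∀ j, Λ → G (1 + j) → G j) :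
    ∃ φ : ∀ j, H j ≃ₗ[K] Module.Dual K (G j),
      ∀ j l h u, φ (1 + j) (μ₁ j l h) u = φ j h (μ₂ j l u) :=
  ⟨fun j => LinearEquiv.ofSubsingleton _ _, fun j l h u => by
    rw [Subsingleton.elim u 0, Subsingleton.elim (μ₂ j l 0) 0, map_zero, map_zero]⟩

namespace GradedFreeResolution

variable {K : Type u} [Field K] {m n : ℕ} {d : Fin n → ℕ} {f : Fin n → PolyT K m}
  (F : GradedFreeResolution (gradingS K m d) (gradingRees f))

theorem powAugmentation_degree (hf : ∀ j, (f j).IsHomogeneous (d j)) (k : ℕ) (j : ℤ) :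
    (F.powAugmentation hf k).κ + (F.powAugmentation hf k).lin j = (j, (k : ℤ)) := by
  change ((0 : ℤ), (k : ℤ)) + (j, 0) = _
  rw [Prod.mk_add_mk, zero_add, add_zero]

theorem canonicalAugmentation_degree (γ : ℤ × ℤ) :
    F.canonicalAugmentation.κ + F.canonicalAugmentation.lin γ = γ := zero_add γ

theorem subsingleton_powCohomologyPiece
    (F : GradedFreeResolution (gradingS K m d) (gradingRees f))
    (hf : ∀ j, (f j).IsHomogeneous (d j)) (k : ℕ) {i : ℤ} (hi : i < 0 ∨ m < i) (j : ℤ) :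
    Subsingleton (powCohomologyPiece f k i j) :=
  (F.powAugmentation hf k).subsingleton_localCohomologyPiece (F.powAugmentation_degree hf k j)
    (F.chainComplex.cech_X_eq_bot Sum.inl _ hi)

variable {F}

theorem subsingleton_canonicalCohomologyPiece {γ : ℤ × ℤ} {Q : ℤ} (hQ : F.VanishesUpTo γ Q)
    (hnQ : n ≤ Q) {p : ℤ} (hp : p ≤ 0 ∨ n < p) : Subsingleton (canonicalCohomologyPiece F p γ) := by
  refine F.canonicalAugmentation.subsingleton_localCohomologyPiece
    (F.canonicalAugmentation_degree γ) ?_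
  obtain hp | hp := hp
  · exact hQ p hp _ (by omega)
  · exact F.dualComplex.cech_X_eq_bot Sum.inr _ (Or.inr hp)

theorem mulCochain_mem_powRel (F : GradedFreeResolution (gradingS K m d) (gradingRees f))
    (hf : ∀ j, (f j).IsHomogeneous (d j)) (k : ℕ) (j : ℤ) (l : Fin m) {q i : ℤ}
    {a : F.chainComplex.Cochain m} {h : powCohomologyPiece f k i j}
    (hah : (a, h) ∈ relComp ((F.chainComplex.cech Sum.inl (j, (k : ℤ))).edge m (-q) q.toNat)
      ((F.powAugmentation hf k).classRel i j)) :
    (F.chainComplex.mulCochain m (X (Sum.inl l)) a, powMulX f k i j l h) ∈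
      relComp ((F.chainComplex.cech Sum.inl (1 + j, (k : ℤ))).edge m (-q) q.toNat)
        ((F.powAugmentation hf k).classRel i (1 + j)) :=
  (F.powAugmentation hf k).mul_mem_relComp rfl (F.powAugmentation_degree hf k j)
    (F.powAugmentation_degree hf k (1 + j)) (X_mem_gradingT l) (rename_X _ _) hah _ rfl

theorem bidegree_add_neg (j k : ℤ) : ((j, k) + (-j, -k) : ℤ × ℤ) = 0 := add_neg_cancel (j, k)

end GradedFreeResolution

end

end GradedLC

set_option maxHeartbeats 1600000 in
open GradedLC GradedFreeResolution MvPolynomial in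
theorem corollary1p7 (K : Type*) [Field K] (m n : ℕ) (d : Fin n → ℕ)
    (f : Fin n → GradedLC.PolyT K m) (hf : ∀ j, (f j).IsHomogeneous (d j))
    (hI : GradedLC.genIdeal f ≠ ⊥)
    (hCM : ∀ (p : Ideal (GradedLC.Rees f)) [p.IsPrime], p ≠ GradedLC.reesMaximal f →
      GradedLC.IsCohenMacaulayLocal (Localization.AtPrime p))
    (F : GradedLC.GradedFreeResolution (GradedLC.gradingS K m d) (GradedLC.gradingRees f)) :
    ∃ k₀ : ℕ, ∀ k : ℕ, k₀ ≤ k → ∀ i : ℤ,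
      -- an isomorphism of graded `T`-modules, given by its homogeneous components of degree `j`;
      -- the component of degree `j` of the graded dual of `N` is the dual space of `N_{-j}`
      ∃ φ : ∀ j : ℤ, GradedLC.powCohomologyPiece f k i j ≃ₗ[K]
          Module.Dual K (GradedLC.canonicalCohomologyPiece F ((m : ℤ) + 1 - i) (-j, -(k : ℤ))),
        ∀ (j : ℤ) (l : Fin m) (h : GradedLC.powCohomologyPiece f k i j)
          (u : GradedLC.canonicalCohomologyPiece F ((m : ℤ) + 1 - i) (-(1 + j), -(k : ℤ))),
          φ (1 + j) (GradedLC.powMulX f k i j l h) u =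
            φ j h (GradedLC.canonicalMulX F ((m : ℤ) + 1 - i)
              (by ring : 1 + -(1 + j) = -j) (-(k : ℤ)) l u) := by
  -- As I is nonzero there is a generator, so the truncated difference n - 1 is the true one.
  have hn : 1 ≤ n := by
    by_contra! h
    obtain rfl : n = 0 := by omega
    exact hI (by rw [genIdeal, Set.range_eq_empty, Ideal.span_empty])
  -- The cutoff must be at least 2n for the edge isomorphism and at least n + q for the positions q
  -- ≤ m with q ≥ n; m + 2n covers both.
  have hbot := F.exists_dualComplex_X_eq_bot (m + 2 * n)
  obtain ⟨k₀, hk₀⟩ := hbot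
  refine ⟨k₀, fun k hk i => ?_⟩
  have hQ : ∀ j : ℤ, F.VanishesUpTo (-j, -(k : ℤ)) (m + 2 * n) := fun j =>
    hk₀ _ (neg_le_neg (Nat.cast_le.2 hk))
  have hδ : ∀ j : ℤ, ((1, 0) + (-(1 + j), -(k : ℤ)) : ℤ × ℤ) = (-j, -(k : ℤ)) := fun j => by
    rw [Prod.mk_add_mk, zero_add, neg_add, add_neg_cancel_left]
  have hpow := fun (hi : 0 ≤ (m : ℤ) - i) j => (F.powAugmentation hf k).relComp_isCorrespondence
    (F.powAugmentation_degree hf k j) (F.chain_edge_isCorrespondence _ hi (sub_sub_cancel _ i))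
  have hmul := fun j l a h => F.mulCochain_mem_powRel hf k j l (q := m - i) (i := i) (a := a) (h := h)
  -- The position is q = m - i, so that q + 1 = m + 1 - i. Here both edge isomorphisms are
  -- available.
  by_cases hlow : 0 ≤ (m : ℤ) - i ∧ (m : ℤ) - i < n
  · exact DoubleComplex.exists_graded_dual_equiv
      (fun j => F.isPerfectPairing_residuePairing (bidegree_add_neg j k)) (m - i)
      (fun j => hpow hlow.1 j)
      (fun j => F.canonicalAugmentation.relComp_isCorrespondence
        (F.canonicalAugmentation_degree (-j, -(k : ℤ)))
        (dual_edge_isCorrespondence hI hCM (hQ j) hn (by omega) hlow.2 (by ring)))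
      (fun l a b => residuePairing_mulCochain _ (X (Sum.inl l)) a b) hmul
      (fun j l b u hbu => F.canonicalAugmentation.mul_mem_relComp (hδ j)
        (F.canonicalAugmentation_degree _) (F.canonicalAugmentation_degree _)
        (X_mem_gradingS d l) rfl hbu _ rfl)
  -- Now m + 1 - i > n, so the right side is zero, and duality with the exact position q ≥ n shows
  -- that the left side is zero too.
  by_cases hhigh : 0 ≤ i ∧ (n : ℤ) ≤ m - i
  · have := fun j => subsingleton_canonicalCohomologyPiece (hQ j) (by omega) (p := m + 1 - i)
      (Or.inr (by omega))
    exact DoubleComplex.exists_graded_dual_equiv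
      (fun j => F.isPerfectPairing_residuePairing (bidegree_add_neg j k)) (m - i)
      (fun j => hpow (by omega) j)
      (fun j => isCorrespondence_prod_top
        (dual_cocycles_eq_coboundaries hI hCM (hQ j) hn hhigh.2 (by omega)))
      (fun l a b => residuePairing_mulCochain _ (X (Sum.inl l)) a b) hmul
      (fun j l b u hbu => ⟨FreeComplex.mulCochain_mem_cocycles Sum.inr (hδ j).symm
        (X_mem_gradingS d l) hbu.1, trivial⟩)
  -- What is left is i > m or i < 0, where m + 1 - i is ≤ 0 or > n, respectively; both sides vanish
  -- termwise.
  exact exists_graded_equiv_of_subsingleton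
    (fun j => F.subsingleton_powCohomologyPiece hf k (by omega) j)
    (fun j => subsingleton_canonicalCohomologyPiece (hQ j) (by omega) (by omega)) _ _
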